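/- Let $(\Omega,\mathcal F,\mathbb P,(\mathcal F_t)_{t\ge 0})$ be a filtered probability space satisfying the usual conditions. Let $\eta:[0,\infty)\to[0,\infty)$ be non-decreasing with $\eta(x)>0$ for all $x>0$ and $\lim_{x\to\infty}\eta(x)=+\infty$; put $\eta(\infty):=\infty$. Fix $c>0$ and set $$G(x):=\int_c^x\frac{\mathrm du}{\eta(u)}\in[-\infty,\infty],\qquad x\in[0,\infty].$$ For a non-negative right-continuous process $X$ write $X^*_t:=\sup_{0\le s\le t}X_s\in[0,\infty]$ and $X^*_{t^-}:=\sup_{s<t}X_s$ for $t>0$. We say that $(X,A,H,M)$ satisfies $\mathcal A_{\sup}$ (with $\eta$) if $X$ is an adapted non-negative right-continuous process, $A$ is a predictable non-decreasing càdlàg process with $A_0=0$, $H$ is an adapted non-negative non-decreasing càdlàg process, $M$ is a càdlàg local martingale with $M_0=0$, and for every $t\ge0$ $$X_t\le\int_{(0,t]}\eta(X^*_{s^-})\,\mathrm dA_s+M_t+H_t\qquad\mathbb P\text{-a.s.}$$ For $p\in(0,1)$ put $\alpha_1=(1-p)^{-1/p}$, $\alpha_2=p^{-1}$ and $\|Y\|_p=\mathbb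 E[|Y|^p]^{1/p}\in[0,\infty]$. Then the following assertions hold. (1) If $(X,A,H,M)$ satisfies $\mathcal A_{\sup}$, then for all stopping times $\tau$ and all deterministic times $T\ge0$ $$\mathbb E[G(X_{\tau\wedge T})]\le\mathbb E[A_{\tau\wedge T}]+G(\mathbb E[H_{\tau\wedge T}])$$ in $[-\infty,+\infty]$. Here $\mathbb E[Y]:=\mathbb E[Y^+]-\mathbb E[Y^-]$ if $\mathbb E[Y^+]<\infty$ and $\mathbb E[Y]:=+\infty$ if $\mathbb E[Y^+]=\infty$, and the right-hand side is read as $-\infty$ if $\mathbb E[A_{\tau\wedge T}]=+\infty$ and $G(\mathbb E[H_{\tau\wedge T}])=-\infty$. (2) Assume $\int_0^\varepsilon\frac{\mathrm du}{\eta(u)}=+\infty$ for all $\varepsilon>0$. If $(X,A,H,M)$ satisfies $\mathcal A_{\sup}$, $T\ge0$ and $H_T=0$ $\mathbb P$-a.s., then $X^*_T=0$ $\mathbb P$-a.s. (3) Assume $\int_0^\varepsilon\frac{\mathrm du}{\eta(u)}=+\infty$ for all $\varepsilon>0$. If $(X^{(n)},A,H^{(n)},M^{(n)})$ satisfies $\mathcal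 A_{\sup}$ for each $n\in\mathbb N$ (with the same $\eta$ and $A$ for all $n$), $T\ge0$ and $\lim_{n\to\infty}\mathbb E[H^{(n)}_T]=0$, then $$\lim_{n\to\infty}\mathbb P\Big[\sup_{t\in[0,T]}X^{(n)}_t>\delta\Big]=0\qquad\text{for each }\delta>0.$$ (4) Let $(X,A,H,M)$ satisfy $\mathcal A_{\sup}$ and let $T>0$ be such that $\mathbb P$-a.s. $X_t\ge c$ for all $t\in[0,T]$, where $c$ is the constant in the definition of $G$. Then for every $p\in(0,1)$ $$\|G(X^*_T)\|_p\le\alpha_1\alpha_2\,\|A_T+G(\mathbb E[H_T])\|_p .$$ If in addition $\int_1^\infty\frac{\mathrm du}{\eta(u)}=+\infty$, $\mathbb E[A_T^p]<\infty$ and $\mathbb E[H_T]<\infty$, then $X^*_T<\infty$ $\mathbb P$-a.s. -/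

import Mathlib

open MeasureTheory ProbabilityTheory Filter Set Topology
open scoped NNReal ENNReal

/-- The usual conditions: the filtration is right-continuous and its initial `σ`-algebra contains
every `P`-null set (`P s` is the outer measure of `s`, so subsets of null sets are included). -/
structure UsualConditions {Ω : Type*} {m : MeasurableSpace Ω} (𝓕 : Filtration ℝ≥0 m)
    (P : Measure Ω) : Prop where
  right_cont : 𝓕.rightCont = 𝓕
  null_mem : ∀ s : Set Ω, P s = 0 → MeasurableSet[𝓕 0] s

/-- Right-continuity of a path. -/
def IsRightContPath {E : Type*} [TopologicalSpace E] (f : ℝ≥0 → E) : Prop :=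
  ∀ t, ContinuousWithinAt f (Ici t) t

/-- A càdlàg path: right-continuous with left limits. -/
def IsCadlagPath {E : Type*} [TopologicalSpace E] (f : ℝ≥0 → E) : Prop :=
  IsRightContPath f ∧ ∀ t, ∃ l, Tendsto f (𝓝[<] t) (𝓝 l)

/-- A càdlàg local martingale starting at `0`. -/
structure IsCadlagLocalMartingale {Ω : Type*} {m : MeasurableSpace Ω} (𝓕 : Filtration ℝ≥0 m)
    (P : Measure Ω) (M : ℝ≥0 → Ω → ℝ) : Prop where
  adapted : StronglyAdapted 𝓕 M
  cadlag : ∀ ω, IsCadlagPath fun t => M t ω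
  zero : ∀ ω, M 0 ω = 0
  locally_martingale : Locally (fun Y : ℝ≥0 → Ω → ℝ => Martingale Y 𝓕 P) 𝓕 M P

/-- The running supremum `X*_t = sup_{0 ≤ s ≤ t} X_s`, with values in `[0, ∞]`. -/
noncomputable def runSup {Ω : Type*} (X : ℝ≥0 → Ω → ℝ≥0) (t : ℝ≥0) (ω : Ω) : ℝ≥0∞ :=
  ⨆ s : ℝ≥0, ⨆ _ : s ≤ t, (X s ω : ℝ≥0∞)

/-- The left limit `X*_{t-} = sup_{s < t} X_s` of the running supremum at `t > 0`. (It is only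
used for `t > 0`.) -/
noncomputable def runSupLeft {Ω : Type*} (X : ℝ≥0 → Ω → ℝ≥0) (t : ℝ≥0) (ω : Ω) : ℝ≥0∞ :=
  ⨆ s : ℝ≥0, ⨆ _ : s < t, (X s ω : ℝ≥0∞)

/-- A non-decreasing `η : [0, ∞) → [0, ∞)` extended to `[0, ∞]` by its limit at infinity. -/
noncomputable def etaExt (η : ℝ≥0 → ℝ≥0) (x : ℝ≥0∞) : ℝ≥0∞ :=
  if x = ⊤ then ⨆ u : ℝ≥0, (η u : ℝ≥0∞) else (η x.toNNReal : ℝ≥0∞)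

/-- The Lebesgue-Stieltjes measure `da` on `[0, ∞)` of a non-decreasing right-continuous path `a`;
it satisfies `da (s, t] = a t - a s`, and `da {0} = 0`. -/
noncomputable def pathMeasure (a : ℝ≥0 → ℝ≥0) (hm : Monotone a) (hr : IsRightContPath a) :
    Measure ℝ≥0 :=
  (StieltjesFunction.mk (fun t => (a t : ℝ)) (fun _ _ h => NNReal.coe_le_coe.2 (hm h))
    (fun t => NNReal.continuous_coe.continuousAt.comp_continuousWithinAt (hr t))).measure

/-- The assumption `𝒜_sup` on `(X, A, H, M)` and `η`. Every path integral
`∫_{(0,t]} η(X*_{s-}) dA_s` is a Lebesgue-Stieltjes integral with values in `[0, ∞]`. -/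
structure AssumptionSup {Ω : Type*} {m : MeasurableSpace Ω} (𝓕 : Filtration ℝ≥0 m)
    (P : Measure Ω) (η : ℝ≥0 → ℝ≥0) (X A H : ℝ≥0 → Ω → ℝ≥0) (M : ℝ≥0 → Ω → ℝ) : Prop where
  eta_mono : Monotone η
  eta_pos : ∀ x, 0 < x → 0 < η x
  X_adapted : StronglyAdapted 𝓕 X
  X_right_cont : ∀ ω, IsRightContPath fun t => X t ω
  A_predictable : IsStronglyPredictable 𝓕 A
  A_mono : ∀ ω, Monotone fun t => A t ω
  A_cadlag : ∀ ω, IsCadlagPath fun t => A t ω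
  A_zero : ∀ ω, A 0 ω = 0
  H_adapted : StronglyAdapted 𝓕 H
  H_mono : ∀ ω, Monotone fun t => H t ω
  H_cadlag : ∀ ω, IsCadlagPath fun t => H t ω
  M_local_martingale : IsCadlagLocalMartingale 𝓕 P M
  inequality : ∀ t : ℝ≥0, ∀ᵐ ω ∂P,
    ((X t ω : ℝ) : EReal) ≤
      ((∫⁻ s in Ioc 0 t, etaExt η (runSupLeft X s ω)
          ∂(pathMeasure (fun r => A r ω) (A_mono ω) (A_cadlag ω).1) : ℝ≥0∞) : EReal)
        + ((M t ω + (H t ω : ℝ) : ℝ) : EReal)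

/-- `G(x) = ∫_c^x du / η(u)` for `x ∈ [0, ∞]`, with values in `[-∞, ∞]`: the integral over
`(c, x]` if `x ≥ c`, minus the integral over `(x, c]` if `x ≤ c` (for `x = ∞` the first one is over
`(c, ∞)`). For each `x` at most one of the two integrals is nonzero. -/
noncomputable def bihariG (η : ℝ≥0 → ℝ≥0) (c : ℝ≥0) (x : ℝ≥0∞) : EReal :=
  ((∫⁻ u in {u : ℝ | (c : ℝ) < u ∧ ENNReal.ofReal u ≤ x},
      (η u.toNNReal : ℝ≥0∞)⁻¹ : ℝ≥0∞) : EReal)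
    - ((∫⁻ u in {u : ℝ | x < ENNReal.ofReal u ∧ u ≤ (c : ℝ)},
      (η u.toNNReal : ℝ≥0∞)⁻¹ : ℝ≥0∞) : EReal)

/-- The Osgood condition: `∫_0^ε du / η(u) = ∞` for all `ε > 0`. -/
def OsgoodCondition (η : ℝ≥0 → ℝ≥0) : Prop :=
  ∀ ε : ℝ, 0 < ε → ∫⁻ u in Ioc 0 ε, (η u.toNNReal : ℝ≥0∞)⁻¹ = ⊤

/-- The expectation `E[Y⁺] - E[Y⁻]` of a `[-∞, ∞]`-valued random variable, taken to be `+∞`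
whenever `E[Y⁺] = ∞` (so an upper bound `< ∞` on it includes `E[Y⁺] < ∞`). -/
noncomputable def extExpect {Ω : Type*} {m : MeasurableSpace Ω} (P : Measure Ω)
    (Y : Ω → EReal) : EReal :=
  open Classical in
  if ∫⁻ ω, (Y ω).toENNReal ∂P = ⊤ then ⊤
  else ((∫⁻ ω, (Y ω).toENNReal ∂P : ℝ≥0∞) : EReal) - ((∫⁻ ω, (-Y ω).toENNReal ∂P : ℝ≥0∞) : EReal)

/-- `‖Y‖_p = E[|Y|^p]^(1/p) ∈ [0, ∞]` for a `[-∞, ∞]`-valued random variable `Y`. -/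
noncomputable def pNorm {Ω : Type*} {m : MeasurableSpace Ω} (P : Measure Ω) (p : ℝ)
    (Y : Ω → EReal) : ℝ≥0∞ :=
  (∫⁻ ω, (Y ω).abs ^ p ∂P) ^ (1 / p)

/-- The constant `α₁ = (1 - p)^(-1/p)`. -/
noncomputable def alphaOne (p : ℝ) : ℝ := (1 - p) ^ (-1 / p)

/-- The constant `α₂ = p⁻¹`. -/
noncomputable def alphaTwo (p : ℝ) : ℝ := p⁻¹

/-! Since `η` is non-decreasing, `G` is concave: it lies below its supporting lines, and moving the
contact point of such a line up towards `z` lowers the value of the line at `z`. Fix `ε > 0` and let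
`Z = ∫ η(X*₋) dA + M + H + ε`, which dominates `X + ε`. Follow `Z` along a time grid, with the
running maximum of a constant `s₀` and of the past grid values of `X + ε` as contact point. The
contact point only moves up to values dominated by `Z`, so `G(Z)` is at most the initial supporting
line plus the increments of `Z` divided by `η` at the previous contact point
(`bihariReal_le_sum_increments`). This replaces Itô's formula and needs no regularity of `η`.

The increments split in three. The `M`-sum is a martingale transform with mean zero. The `H`-sum is
at most the increment of `H` over `η(s₀)`. In the `dA`-sum the ratio of `η(X*₋)` to `η` at the
contact point is eventually at most `1`, the shift `ε` supplying the slack, so its limit superior is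
at most `A`. With `s₀ = b + ε` and `E[H] ≤ b`, the linear terms have non-positive mean, whence
`E[G(X + ε)] ≤ a + G(b + ε)` for `E[A] ≤ a` (`AssumptionSup.integral_bihariReal_le_of_bounded`).
Localization and Fatou's lemma extend this to every bounded stopping time, and `ε → 0` gives (1)
when both expectations are finite.

The other assertions apply such estimates at the first passage of `X` over a level, with `A` kept
below some `u`. As `A` may jump across `u`, one must stop strictly before; predictability allows
this, with small probability of having stopped needlessly (`exists_stopping_lt_level`). Under the
Osgood condition `G(ε) → -∞`, so passing `δ` costs an arbitrarily large gap while the bound stays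
near `u`: this is (3). The constant sequence gives (2), which also settles the case of (1) where the
right-hand side is read as `-∞`. For (4), first passage gives a Lenglart tail estimate
(`AssumptionSup.measure_bihariG_runSup_le`), and integrating it against `p x^(p-1)` produces the
constant (`lintegral_rpow_le_of_tail`). -/

/-! ### Discretizing time from the right -/

/-- The smallest multiple of `1 / (k + 1)` that is strictly larger than `t`. -/
noncomputable def gridAbove (k : ℕ) (t : ℝ≥0) : ℝ≥0 :=
  ((⌊t * (k + 1)⌋₊ : ℝ≥0) + 1) / (k + 1)

lemma lt_gridAbove (k : ℕ) (t : ℝ≥0) : t < gridAbove k t := by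
  rw [gridAbove, lt_div_iff₀ (by positivity)]
  exact Nat.lt_floor_add_one _

lemma gridAbove_le (k : ℕ) (t : ℝ≥0) : gridAbove k t ≤ t + 1 / (k + 1) := by
  rw [gridAbove, add_div]
  gcongr
  rw [div_le_iff₀ (by positivity)]
  exact Nat.floor_le (by positivity)

lemma tendsto_gridAbove (t : ℝ≥0) : Tendsto (fun k => gridAbove k t) atTop (𝓝 t) := by
  refine tendsto_of_tendsto_of_tendsto_of_le_of_le tendsto_const_nhds ?_
    (fun k => (lt_gridAbove k t).le) (fun k => gridAbove_le k t)
  have h : Tendsto (fun k : ℕ => 1 / ((k : ℝ≥0) + 1)) atTop (𝓝 0) :=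
    tendsto_one_div_add_atTop_nhds_zero_nat
  simpa using tendsto_const_nhds.add h

/-- Reduces the stopping-time property of a discretized time to countably many events of the form `ρ
< q` with `q ≤ r`. -/
lemma gridAbove_le_iff (k : ℕ) (t r : ℝ≥0) :
    gridAbove k t ≤ r ↔ ∃ j : ℕ, ((j : ℝ≥0) + 1) / (k + 1) ≤ r ∧ t < ((j : ℝ≥0) + 1) / (k + 1) := by
  constructor
  · exact fun h => ⟨_, h, lt_gridAbove k t⟩
  · rintro ⟨j, hj, ht⟩
    refine le_trans ?_ hj
    rw [gridAbove]
    gcongr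
    rw [lt_div_iff₀ (by positivity)] at ht
    have : ⌊t * (k + 1)⌋₊ < j + 1 := by
      rw [Nat.floor_lt (by positivity)]
      exact_mod_cast ht
    omega

/-! ### Finite stopping times and optional stopping in continuous time -/

section Stopping

variable {Ω : Type*} {m : MeasurableSpace Ω} {𝓕 : Filtration ℝ≥0 m} {P : Measure Ω}

/-- Evaluating a right-continuous measurable process at a random time gives a random variable. -/
lemma measurable_eval_of_rightCont {E : Type*} [TopologicalSpace E]
    [TopologicalSpace.PseudoMetrizableSpace E] [MeasurableSpace E] [BorelSpace E]
    {X : ℝ≥0 → Ω → E} (hX : ∀ t, Measurable (X t)) (hr : ∀ ω, IsRightContPath fun t => X t ω)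
    {ρ : Ω → ℝ≥0} (hρ : Measurable ρ) : Measurable fun ω => X (ρ ω) ω := by
  refine measurable_of_tendsto_metrizable (f := fun k ω => X (gridAbove k (ρ ω)) ω) ?_ ?_
  · intro k
    have h1 : ∀ (Y : ℕ → Ω → E) (n : Ω → ℕ), (∀ j, Measurable (Y j)) → Measurable n →
        Measurable fun ω => Y (n ω) ω := fun Y n hY hn =>
      (measurable_from_prod_countable_right (f := fun p : ℕ × Ω => Y p.1 p.2) hY).comp
        (hn.prodMk measurable_id)
    exact h1 (fun j => X (((j : ℝ≥0) + 1) / (k + 1))) (fun ω => ⌊ρ ω * (k + 1)⌋₊)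
      (fun j => hX _) (Nat.measurable_floor.comp (hρ.mul_const _))
  · rw [tendsto_pi_nhds]
    intro ω
    refine (hr ω (ρ ω)).tendsto.comp (tendsto_nhdsWithin_iff.2 ⟨tendsto_gridAbove _, ?_⟩)
    exact Eventually.of_forall fun k => (lt_gridAbove k _).le

/-- A stopping time that takes finite values. -/
def IsFiniteStoppingTime (𝓕 : Filtration ℝ≥0 m) (ρ : Ω → ℝ≥0) : Prop :=
  ∀ t, MeasurableSet[𝓕 t] {ω | ρ ω ≤ t}

namespace IsFiniteStoppingTime

lemma isStoppingTime {ρ : Ω → ℝ≥0} (hρ : IsFiniteStoppingTime 𝓕 ρ) :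
    IsStoppingTime 𝓕 fun ω => WithTop.some (ρ ω) := by
  intro t
  have : {ω | WithTop.some (ρ ω) ≤ WithTop.some t} = {ω | ρ ω ≤ t} := by
    ext ω; exact WithTop.coe_le_coe
  exact this ▸ hρ t

lemma of_isStoppingTime {ρ : Ω → ℝ≥0} (hρ : IsStoppingTime 𝓕 fun ω => WithTop.some (ρ ω)) :
    IsFiniteStoppingTime 𝓕 ρ := by
  intro t
  have : {ω | WithTop.some (ρ ω) ≤ WithTop.some t} = {ω | ρ ω ≤ t} := by
    ext ω; exact WithTop.coe_le_coe
  exact this ▸ hρ t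

lemma const (t : ℝ≥0) : IsFiniteStoppingTime 𝓕 fun _ => t := fun _ => MeasurableSet.const _

lemma measurable {ρ : Ω → ℝ≥0} (hρ : IsFiniteStoppingTime 𝓕 ρ) : Measurable ρ :=
  measurable_of_Iic fun i => 𝓕.le i _ (hρ i)

lemma measurableSet_lt {ρ : Ω → ℝ≥0} (hρ : IsFiniteStoppingTime 𝓕 ρ) {s t : ℝ≥0} (hst : s ≤ t) :
    MeasurableSet[𝓕 t] {ω | ρ ω < s} := by
  have : {ω | WithTop.some (ρ ω) < WithTop.some s} = {ω | ρ ω < s} := by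
    ext ω; exact WithTop.coe_lt_coe
  exact this ▸ hρ.isStoppingTime.measurableSet_lt_le hst

lemma min {ρ σ : Ω → ℝ≥0} (hρ : IsFiniteStoppingTime 𝓕 ρ) (hσ : IsFiniteStoppingTime 𝓕 σ) :
    IsFiniteStoppingTime 𝓕 fun ω => min (ρ ω) (σ ω) := by
  intro t
  have : {ω | Min.min (ρ ω) (σ ω) ≤ t} = {ω | ρ ω ≤ t} ∪ {ω | σ ω ≤ t} := by
    ext ω; simp only [mem_ofPred_eq, mem_union, min_le_iff]
  exact this ▸ (hρ t).union (hσ t)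

lemma gridAbove {ρ : Ω → ℝ≥0} (hρ : IsFiniteStoppingTime 𝓕 ρ) (k : ℕ) :
    IsFiniteStoppingTime 𝓕 fun ω => gridAbove k (ρ ω) := by
  intro r
  simp only [gridAbove_le_iff]
  have : {ω | ∃ j : ℕ, ((j : ℝ≥0) + 1) / (k + 1) ≤ r ∧ ρ ω < ((j : ℝ≥0) + 1) / (k + 1)} =
      ⋃ j : ℕ, ⋃ _ : ((j : ℝ≥0) + 1) / (k + 1) ≤ r, {ω | ρ ω < ((j : ℝ≥0) + 1) / (k + 1)} := by
    ext ω; simp only [mem_ofPred_eq, mem_iUnion, exists_prop]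
  rw [this]
  exact MeasurableSet.iUnion fun j => MeasurableSet.iUnion fun hj => hρ.measurableSet_lt hj

end IsFiniteStoppingTime

/-- Optional stopping at a bounded stopping time for a right-continuous martingale. -/
lemma Martingale.integral_eval_eq [IsProbabilityMeasure P] {N : ℝ≥0 → Ω → ℝ}
    (hN : Martingale N 𝓕 P) (hr : ∀ ω, IsRightContPath fun t => N t ω) {ρ : Ω → ℝ≥0}
    (hρ : IsFiniteStoppingTime 𝓕 ρ) {T : ℝ≥0} (hT : ∀ ω, ρ ω ≤ T) :
    Integrable (fun ω => N (ρ ω) ω) P ∧ ∫ ω, N (ρ ω) ω ∂P = ∫ ω, N T ω ∂P := by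
  -- Approximation from the right by times with countable range, where optional sampling is already
  -- available; right-continuity of the paths then gives the limit.
  set σ : ℕ → Ω → ℝ≥0 := fun k ω => min (gridAbove k (ρ ω)) T with hσ
  have hst : ∀ k, IsStoppingTime 𝓕 fun ω => WithTop.some (σ k ω) := fun k =>
    ((hρ.gridAbove k).min (.const T)).isStoppingTime
  have hle : ∀ k ω, WithTop.some (σ k ω) ≤ WithTop.some T := fun k ω => WithTop.coe_le_coe.2 (min_le_right _ _)
  have hcount : ∀ k, (Set.range fun ω => WithTop.some (σ k ω)).Countable := by
    intro k
    refine (Set.countable_range fun j : ℕ =>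
      WithTop.some (min (((j : ℝ≥0) + 1) / (k + 1)) T)).mono ?_
    rintro _ ⟨ω, rfl⟩
    exact ⟨⌊ρ ω * (k + 1)⌋₊, rfl⟩
  have hce : ∀ k, (fun ω => N (σ k ω) ω) =ᵐ[P] P[N T | (hst k).measurableSpace] := fun k =>
    hN.stoppedValue_ae_eq_condExp_of_le_const_of_countable_range (hst k) (hle k) (hcount k)
  -- All the sampled values are conditional expectations of the single variable `N T`, hence
  -- uniformly integrable, so the pointwise limit holds in `L¹`.
  have hui : UniformIntegrable (fun k ω => N (σ k ω) ω) 1 P :=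
    UniformIntegrable.ae_eq
      ((hN.integrable T).uniformIntegrable_condExp (ℱ := fun k => (hst k).measurableSpace)
        fun k => (hst k).measurableSpace_le) fun k => (hce k).symm
  have hlim : ∀ ω, Tendsto (fun k => N (σ k ω) ω) atTop (𝓝 (N (ρ ω) ω)) := by
    intro ω
    refine (hr ω (ρ ω)).tendsto.comp (tendsto_nhdsWithin_iff.2 ⟨?_, ?_⟩)
    · have := (tendsto_gridAbove (ρ ω)).min (tendsto_const_nhds (x := T))
      rwa [min_eq_left (hT ω)] at this
    · exact Eventually.of_forall fun k => le_min (lt_gridAbove k _).le (hT ω)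
  have hmem : MemLp (fun ω => N (ρ ω) ω) 1 P := by
    exact hui.memLp_of_ae_tendsto (ae_of_all _ hlim)
  have hL1 := tendsto_Lp_finite_of_tendsto_ae le_rfl ENNReal.one_ne_top
    (fun k => hui.1 k) hmem hui.2.1 (ae_of_all _ hlim)
  have hint : ∀ k, ∫ ω, N (σ k ω) ω ∂P = ∫ ω, N T ω ∂P := by
    intro k
    rw [integral_congr_ae (hce k), integral_condExp]
  refine ⟨memLp_one_iff_integrable.1 hmem, ?_⟩
  have := tendsto_integral_of_L1' _ hmem.1
    (Eventually.of_forall fun k => memLp_one_iff_integrable.1 (hui.memLp k)) hL1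
  simp only [hint] at this
  exact tendsto_nhds_unique this tendsto_const_nhds

/-- The increments of a stopped right-continuous martingale are orthogonal to bounded random
variables known at the left end point. -/
lemma Martingale.integral_mul_increment_eq_zero [IsProbabilityMeasure P] {N : ℝ≥0 → Ω → ℝ}
    (hN : Martingale N 𝓕 P) (hr : ∀ ω, IsRightContPath fun t => N t ω) {ρ : Ω → ℝ≥0}
    (hρ : IsFiniteStoppingTime 𝓕 ρ) {s t : ℝ≥0} (hst : s ≤ t)
    {φ : Ω → ℝ} (hφ : StronglyMeasurable[𝓕 s] φ) {C : ℝ} (hC : ∀ ω, |φ ω| ≤ C) :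
    Integrable (fun ω => φ ω * (N (min t (ρ ω)) ω - N (min s (ρ ω)) ω)) P ∧
      ∫ ω, φ ω * (N (min t (ρ ω)) ω - N (min s (ρ ω)) ω) ∂P = 0 := by
  have hts : ∀ r : ℝ≥0, IsFiniteStoppingTime 𝓕 fun ω => min r (ρ ω) := fun r =>
    (IsFiniteStoppingTime.const r).min hρ
  have hi : ∀ r, Integrable (fun ω => N (min r (ρ ω)) ω) P := fun r =>
    (Martingale.integral_eval_eq hN hr (hts r) (T := r) fun ω => min_le_left _ _).1
  set Y : Ω → ℝ := fun ω => N (min t (ρ ω)) ω - N (min s (ρ ω)) ω with hY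
  have hYi : Integrable Y P := (hi t).sub (hi s)
  have hset : ∀ F, MeasurableSet[𝓕 s] F → ∫ ω in F, Y ω ∂P = 0 := by
    intro F hF
    classical
    -- Switching between the two times according to an event of `𝓕 s` is again a stopping time:
    -- before `s` both alternatives have occurred exactly when `ρ` has. Comparing the means at `κ`
    -- and at `min s ρ` isolates the increment on `F`.
    set κ : Ω → ℝ≥0 := fun ω => if ω ∈ F then min t (ρ ω) else min s (ρ ω) with hκ
    have hκs : IsFiniteStoppingTime 𝓕 κ := by
      intro r
      by_cases hrs : r < s
      · have : {ω | κ ω ≤ r} = {ω | ρ ω ≤ r} := by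
          ext ω
          simp only [hκ, mem_ofPred_eq]
          split_ifs
          · simp [(hrs.trans_le hst).not_ge]
          · simp [hrs.not_ge]
        rw [this]; exact hρ r
      · have hF' := 𝓕.mono (not_lt.1 hrs) _ hF
        have : {ω | κ ω ≤ r} = (F ∩ {ω | min t (ρ ω) ≤ r})
            ∪ (Fᶜ ∩ {ω | min s (ρ ω) ≤ r}) := by
          ext ω
          by_cases h : ω ∈ F <;> simp [hκ, h]
        rw [this]
        exact (hF'.inter (hts t r)).union (hF'.compl.inter (hts s r))
    have h1 := (Martingale.integral_eval_eq hN hr hκs (T := t) fun ω => by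
      simp only [hκ]; split_ifs
      · exact min_le_left _ _
      · exact (min_le_left _ _).trans hst).2
    have h2 := (Martingale.integral_eval_eq hN hr (hts s) (T := t) fun ω =>
      (min_le_left _ _).trans hst).2
    have h3 : (fun ω => N (κ ω) ω) = fun ω => F.indicator Y ω + N (min s (ρ ω)) ω := by
      ext ω
      by_cases h : ω ∈ F <;> simp [hκ, hY, h]
    rw [h3, integral_add (hYi.indicator (𝓕.le s _ hF)) (hi s), h2,
      integral_indicator (𝓕.le s _ hF)] at h1
    linarith
  have hce : P[Y | 𝓕 s] =ᵐ[P] 0 := by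
    refine (ae_eq_condExp_of_forall_setIntegral_eq (𝓕.le s) hYi
      (fun _ _ _ => integrableOn_zero) ?_ ?_).symm
    · intro F hF _
      simp [hset F hF]
    · exact stronglyMeasurable_zero.aestronglyMeasurable
  have hφY : Integrable (φ * Y) P := hYi.bdd_mul (c := C)
    (hφ.mono (𝓕.le s)).aestronglyMeasurable (ae_of_all _ fun ω => by simpa using hC ω)
  refine ⟨hφY, ?_⟩
  have h4 := condExp_mul_of_stronglyMeasurable_left hφ hφY hYi
  have h5 : ∫ ω, (φ * Y) ω ∂P = 0 := by
    rw [← integral_condExp (𝓕.le s), integral_congr_ae h4]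
    rw [integral_congr_ae (g := fun _ => (0 : ℝ))]
    · simp
    · filter_upwards [hce] with ω hω
      simp [hω]
  exact h5

end Stopping

/-! ### Foretelling the passage of a predictable increasing process -/

section Predictable

variable {Ω : Type*} {m : MeasurableSpace Ω} {𝓕 : Filtration ℝ≥0 m}

/-- Finite unions of the foretellable closed boxes `[s, t] × F`, where `F` is known at a time
strictly before `s`. -/
inductive IsForetellableElem (𝓕 : Filtration ℝ≥0 m) : Set (ℝ≥0 × Ω) → Prop
  | empty : IsForetellableElem 𝓕 ∅
  | box {r s t : ℝ≥0} {F : Set Ω} (hrs : r < s) (hF : MeasurableSet[𝓕 r] F) :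
      IsForetellableElem 𝓕 (Icc s t ×ˢ F)
  | union {U V : Set (ℝ≥0 × Ω)} : IsForetellableElem 𝓕 U → IsForetellableElem 𝓕 V →
      IsForetellableElem 𝓕 (U ∪ V)

namespace IsForetellableElem

lemma inter {U V : Set (ℝ≥0 × Ω)} (hU : IsForetellableElem 𝓕 U) (hV : IsForetellableElem 𝓕 V) :
    IsForetellableElem 𝓕 (U ∩ V) := by
  induction hU with
  | empty => simpa using empty
  | union _ _ h1 h2 => rw [union_inter_distrib_right]; exact h1.union h2
  | @box r s t F hrs hF =>
    induction hV with
    | empty => simpa using empty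
    | union _ _ h1 h2 => rw [inter_union_distrib_left]; exact h1.union h2
    | @box r' s' t' F' hrs' hF' =>
      rw [prod_inter_prod, Icc_inter_Icc]
      refine box (r := max r r') (max_lt_max hrs hrs') ?_
      exact (𝓕.mono (le_max_left _ _) _ hF).inter (𝓕.mono (le_max_right _ _) _ hF')

/-- The time intervals are closed so that Cantor's intersection theorem can be applied to sections
of decreasing sequences. -/
lemma isCompact_section {U : Set (ℝ≥0 × Ω)} (hU : IsForetellableElem 𝓕 U) (ω : Ω) :
    IsCompact {t | (t, ω) ∈ U} := by
  induction hU with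
  | empty => simp
  | union _ _ h1 h2 => exact h1.union h2
  | @box r s t F hrs hF =>
    by_cases h : ω ∈ F
    · have : {q | (q, ω) ∈ Icc s t ×ˢ F} = Icc s t := by ext q; simp [h]
      rw [this]; exact isCompact_Icc
    · simp [h]

lemma measurableSet {U : Set (ℝ≥0 × Ω)} (hU : IsForetellableElem 𝓕 U) : MeasurableSet U := by
  induction hU with
  | empty => exact MeasurableSet.empty
  | union _ _ h1 h2 => exact h1.union h2
  | box hrs hF => exact measurableSet_Icc.prod (𝓕.le _ _ hF)

lemma measurableSet_hit {U : Set (ℝ≥0 × Ω)} (hU : IsForetellableElem 𝓕 U) (T : ℝ≥0) :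
    MeasurableSet {ω | ∃ t ≤ T, (t, ω) ∈ U} := by
  induction hU with
  | empty => simp
  | @union U V _ _ h1 h2 =>
    have : {ω | ∃ t ≤ T, (t, ω) ∈ U ∪ V} =
        {ω | ∃ t ≤ T, (t, ω) ∈ U} ∪ {ω | ∃ t ≤ T, (t, ω) ∈ V} := by
      ext ω; simp only [mem_union, mem_ofPred_eq]; grind
    rw [this]; exact h1.union h2
  | @box r s t F hrs hF =>
    have : {ω | ∃ q ≤ T, (q, ω) ∈ Icc s t ×ˢ F} = {ω | s ≤ T ∧ s ≤ t} ∩ F := by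
      ext ω
      simp only [mem_prod, mem_Icc, mem_ofPred_eq, mem_inter_iff]
      constructor
      · rintro ⟨q, hq, ⟨h1, h2⟩, h3⟩
        exact ⟨⟨h1.trans hq, h1.trans h2⟩, h3⟩
      · rintro ⟨⟨h1, h2⟩, h3⟩
        exact ⟨s, h1, ⟨le_rfl, h2⟩, h3⟩
    rw [this]
    exact (MeasurableSet.const _).inter (𝓕.le _ _ hF)

/-- A foretellable elementary set can be avoided by stopping strictly before it. -/
lemma exists_stopping_before {U : Set (ℝ≥0 × Ω)} (hU : IsForetellableElem 𝓕 U) (T : ℝ≥0) :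
    ∃ ρ : Ω → ℝ≥0, IsFiniteStoppingTime 𝓕 ρ ∧ (∀ ω, ρ ω ≤ T) ∧
      (∀ t ω, (t, ω) ∈ U → ρ ω < t) ∧ ∀ ω, (¬ ∃ t ≤ T, (t, ω) ∈ U) → ρ ω = T := by
  induction hU with
  | empty => exact ⟨fun _ => T, .const T, by simp, by simp, by simp⟩
  | union _ _ ih ih' =>
    obtain ⟨ρ, h1, h2, h3, h4⟩ := ih
    obtain ⟨σ, k1, k2, k3, k4⟩ := ih'
    refine ⟨_, h1.min k1, fun ω => (min_le_left _ _).trans (h2 ω), ?_, ?_⟩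
    · rintro t ω (h | h)
      · exact (min_le_left _ _).trans_lt (h3 t ω h)
      · exact (min_le_right _ _).trans_lt (k3 t ω h)
    · intro ω h
      rw [h4 ω fun ⟨t, ht, h'⟩ => h ⟨t, ht, Or.inl h'⟩, k4 ω fun ⟨t, ht, h'⟩ => h ⟨t, ht, Or.inr h'⟩,
        min_self]
  | @box r s t F hrs hF =>
    classical
    by_cases hst : s ≤ T ∧ s ≤ t
    · obtain ⟨q, hrq, hqs⟩ := exists_between hrs
      refine ⟨fun ω => if ω ∈ F then q else T, ?_, ?_, ?_, ?_⟩
      · intro x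
        by_cases hx : q ≤ x
        · have : {ω | (if ω ∈ F then q else T) ≤ x} = F ∪ {_ω | T ≤ x} := by
            ext ω
            by_cases h : ω ∈ F <;> simp [h, hx]
          rw [this]
          exact (𝓕.mono (hrq.le.trans hx) _ hF).union (MeasurableSet.const _)
        · have : {ω | (if ω ∈ F then q else T) ≤ x} = ∅ := by
            ext ω
            by_cases h : ω ∈ F <;> simp [h]
            · exact not_le.1 hx
            · exact (not_le.1 hx).trans_le (hqs.le.trans hst.1)
          rw [this]
          exact @MeasurableSet.empty _ (𝓕 x)
      · intro ω
        dsimp only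
        split_ifs
        · exact hqs.le.trans hst.1
        · exact le_rfl
      · rintro y ω ⟨⟨h1, h2⟩, h3⟩
        simp only at h1 h2 h3
        simp only [h3, if_true]
        exact hqs.trans_le h1
      · intro ω h
        have : ω ∉ F := fun h' => h ⟨s, hst.1, ⟨⟨le_rfl, hst.2⟩, h'⟩⟩
        simp [this]
    · refine ⟨fun _ => T, .const T, by simp, ?_, by simp⟩
      rintro y ω ⟨⟨h1, h2⟩, h3⟩
      simp only at h1 h2 h3
      by_contra h
      exact hst ⟨h1.trans (not_lt.1 h), h1.trans h2⟩

lemma iInter_le {U : ℕ → Set (ℝ≥0 × Ω)} (hU : ∀ n, IsForetellableElem 𝓕 (U n)) (n : ℕ) :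
    IsForetellableElem 𝓕 (⋂ i ≤ n, U i) := by
  induction n with
  | zero => simpa using hU 0
  | succ n ih => rw [biInter_le_succ]; exact ih.inter (hU _)

end IsForetellableElem

/-- Countable decreasing intersections of foretellable elementary sets. -/
def IsForetellableClosed (𝓕 : Filtration ℝ≥0 m) (K : Set (ℝ≥0 × Ω)) : Prop :=
  ∃ U : ℕ → Set (ℝ≥0 × Ω), (∀ n, IsForetellableElem 𝓕 (U n)) ∧ Antitone U ∧ K = ⋂ n, U n

namespace IsForetellableClosed

lemma of_elem {U : Set (ℝ≥0 × Ω)} (hU : IsForetellableElem 𝓕 U) : IsForetellableClosed 𝓕 U :=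
  ⟨fun _ => U, fun _ => hU, antitone_const, (iInter_const U).symm⟩

lemma union {K L : Set (ℝ≥0 × Ω)} (hK : IsForetellableClosed 𝓕 K)
    (hL : IsForetellableClosed 𝓕 L) : IsForetellableClosed 𝓕 (K ∪ L) := by
  obtain ⟨U, hU, hUa, rfl⟩ := hK
  obtain ⟨V, hV, hVa, rfl⟩ := hL
  exact ⟨fun n => U n ∪ V n, fun n => (hU n).union (hV n), fun i j h =>
    union_subset_union (hUa h) (hVa h), (iInter_union_of_antitone hUa hVa).symm⟩

lemma iUnion_le {K : ℕ → Set (ℝ≥0 × Ω)} (hK : ∀ n, IsForetellableClosed 𝓕 (K n)) (n : ℕ) :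
    IsForetellableClosed 𝓕 (⋃ i ≤ n, K i) := by
  induction n with
  | zero => simpa using hK 0
  | succ n ih => rw [biUnion_le_succ]; exact ih.union (hK _)

/-- A diagonal argument: the `n`-th approximant intersects the `n`-th approximants of the first `n +
1` sets, which keeps the intersections finite and the sequence decreasing. -/
lemma iInter {K : ℕ → Set (ℝ≥0 × Ω)} (hK : ∀ n, IsForetellableClosed 𝓕 (K n)) :
    IsForetellableClosed 𝓕 (⋂ n, K n) := by
  choose U hU hUa hUK using hK
  refine ⟨fun n => ⋂ i ≤ n, U i n, fun n => IsForetellableElem.iInter_le (fun i => hU i n) n,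
    ?_, ?_⟩
  · intro j k hjk
    simp only [subset_iInter_iff]
    intro i hi
    exact (biInter_subset_of_mem (show i ∈ {i | i ≤ k} from hi.trans hjk)).trans (hUa i hjk)
  · ext x
    simp only [hUK, mem_iInter]
    constructor
    · exact fun h n i _ => h i n
    · exact fun h i n => hUa i (le_max_right i n) (h (max i n) i (le_max_left _ _))

lemma measurableSet {K : Set (ℝ≥0 × Ω)} (hK : IsForetellableClosed 𝓕 K) : MeasurableSet K := by
  obtain ⟨U, hU, _, rfl⟩ := hK
  exact MeasurableSet.iInter fun n => (hU n).measurableSet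

end IsForetellableClosed

/-- Inner approximation in measure by countable decreasing intersections of foretellable
elementary sets. -/
def IsInnerForetellable (𝓕 : Filtration ℝ≥0 m) (μ : Measure (ℝ≥0 × Ω)) (C : Set (ℝ≥0 × Ω)) :
    Prop :=
  ∀ e : ℝ≥0∞, e ≠ 0 → ∃ K, IsForetellableClosed 𝓕 K ∧ K ⊆ C ∧ μ (C \ K) ≤ e

namespace IsInnerForetellable

variable {μ : Measure (ℝ≥0 × Ω)}

lemma of_elem {U : Set (ℝ≥0 × Ω)} (hU : IsForetellableElem 𝓕 U) : IsInnerForetellable 𝓕 μ U :=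
  fun _ _ => ⟨U, .of_elem hU, subset_rfl, by simp⟩

lemma of_subset {C D : Set (ℝ≥0 × Ω)} (hD : IsInnerForetellable 𝓕 μ D) (hDC : D ⊆ C)
    (h : μ (C \ D) = 0) : IsInnerForetellable 𝓕 μ C := by
  intro e he
  obtain ⟨K, hK, hKD, hμ⟩ := hD e he
  refine ⟨K, hK, hKD.trans hDC, ?_⟩
  calc μ (C \ K) ≤ μ ((C \ D) ∪ (D \ K)) := measure_mono fun x hx => by
        by_cases hxD : x ∈ D
        · exact Or.inr ⟨hxD, hx.2⟩
        · exact Or.inl ⟨hx.1, hxD⟩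
    _ ≤ μ (C \ D) + μ (D \ K) := measure_union_le _ _
    _ ≤ e := by rw [h, zero_add]; exact hμ

lemma iInter {C : ℕ → Set (ℝ≥0 × Ω)} (hC : ∀ n, IsInnerForetellable 𝓕 μ (C n)) :
    IsInnerForetellable 𝓕 μ (⋂ n, C n) := by
  intro e he
  obtain ⟨d, hd, hde⟩ := ENNReal.exists_pos_sum_of_countable' he ℕ
  choose K hK hKC hμ using fun n => hC n (d n) (hd n).ne'
  refine ⟨_, IsForetellableClosed.iInter hK, iInter_mono hKC, ?_⟩
  calc μ ((⋂ n, C n) \ ⋂ n, K n) ≤ μ (⋃ n, C n \ K n) := measure_mono fun x hx => by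
        obtain ⟨h1, h2⟩ := hx
        simp only [mem_iInter, not_forall] at h1 h2
        obtain ⟨n, hn⟩ := h2
        exact mem_iUnion.2 ⟨n, h1 n, hn⟩
    _ ≤ ∑' n, μ (C n \ K n) := measure_iUnion_le _
    _ ≤ ∑' n, d n := ENNReal.tsum_le_tsum hμ
    _ ≤ e := hde.le

/-- A countable union of the inner approximants need not be of the required closed type, but finite
unions are, and continuity from above of the finite measure makes the truncation error small. -/
lemma iUnion [IsFiniteMeasure μ] {C : ℕ → Set (ℝ≥0 × Ω)}
    (hC : ∀ n, IsInnerForetellable 𝓕 μ (C n)) (hCm : ∀ n, MeasurableSet (C n)) :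
    IsInnerForetellable 𝓕 μ (⋃ n, C n) := by
  intro e he
  obtain ⟨d, hd, hde⟩ := ENNReal.exists_pos_sum_of_countable' he ℕ
  choose K hK hKC hμ using fun n => hC n (d n) (hd n).ne'
  have hlt : μ ((⋃ n, C n) \ ⋃ n, K n) < e := by
    calc μ ((⋃ n, C n) \ ⋃ n, K n) ≤ μ (⋃ n, C n \ K n) := measure_mono fun x hx => by
          obtain ⟨h1, h2⟩ := hx
          simp only [mem_iUnion, not_exists] at h1 h2
          obtain ⟨n, hn⟩ := h1
          exact mem_iUnion.2 ⟨n, hn, h2 n⟩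
      _ ≤ ∑' n, μ (C n \ K n) := measure_iUnion_le _
      _ ≤ ∑' n, d n := ENNReal.tsum_le_tsum hμ
      _ < e := hde
  have hlim : Tendsto (fun n => μ ((⋃ n, C n) \ ⋃ i ≤ n, K i)) atTop
      (𝓝 (μ (⋂ n, ((⋃ n, C n) \ ⋃ i ≤ n, K i)))) := by
    refine tendsto_measure_iInter_atTop (fun n => ?_) ?_ ⟨0, measure_ne_top _ _⟩
    · exact ((MeasurableSet.iUnion hCm).diff
        (IsForetellableClosed.iUnion_le hK n).measurableSet).nullMeasurableSet
    · intro i j hij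
      refine sdiff_subset_sdiff_right ?_
      exact biUnion_mono (fun k (hk : k ≤ i) => hk.trans hij) fun _ _ => subset_rfl
  have heq : (⋂ n, ((⋃ n, C n) \ ⋃ i ≤ n, K i)) = (⋃ n, C n) \ ⋃ n, K n := by
    ext x
    simp only [mem_iInter, Set.mem_sdiff, mem_iUnion, exists_prop, not_exists, not_and]
    exact ⟨fun h => ⟨(h 0).1, fun n => (h n).2 n le_rfl⟩, fun h n => ⟨h.1, fun i _ => h.2 i⟩⟩
  rw [heq] at hlim
  obtain ⟨n, hn⟩ := (hlim.eventually (gt_mem_nhds hlt)).exists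
  exact ⟨_, IsForetellableClosed.iUnion_le hK n,
    iUnion₂_subset fun i _ => (hKC i).trans (subset_iUnion C i), hn.le⟩

lemma of_iUnion_elem [IsFiniteMeasure μ] {C : Set (ℝ≥0 × Ω)} {V : ℕ → Set (ℝ≥0 × Ω)}
    (hV : ∀ n, IsForetellableElem 𝓕 (V n)) (hVC : ∀ n, V n ⊆ C) (h : μ (C \ ⋃ n, V n) = 0) :
    IsInnerForetellable 𝓕 μ C :=
  (iUnion (fun n => of_elem (hV n)) fun n => (hV n).measurableSet).of_subset
    (iUnion_subset hVC) h

end IsInnerForetellable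

lemma Filtration.predictable_le_prod (𝓕 : Filtration ℝ≥0 m) :
    𝓕.predictable ≤ (inferInstance : MeasurableSpace (ℝ≥0 × Ω)) :=
  measurableSpace_le_predictable_of_measurableSet
    (fun _ hF => (measurableSet_singleton _).prod (𝓕.le _ _ hF))
    (fun _ _ hF => measurableSet_Ioi.prod (𝓕.le _ _ hF))

lemma exists_nat_mem_Icc {i t : ℝ≥0} (h : i < t) :
    ∃ n : ℕ, t ∈ Icc (i + 1 / ((n : ℝ≥0) + 1)) n := by
  obtain ⟨k, hk⟩ := exists_nat_one_div_lt (tsub_pos_of_lt h)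
  obtain ⟨l, hl⟩ := exists_nat_ge t
  refine ⟨max k l, ?_, ?_⟩
  · have h1 : 1 / (((max k l : ℕ) : ℝ≥0) + 1) ≤ 1 / ((k : ℝ≥0) + 1) := by
      gcongr; exact le_max_left _ _
    calc i + 1 / (((max k l : ℕ) : ℝ≥0) + 1) ≤ i + (t - i) := by gcongr; exact h1.trans hk.le
      _ = t := add_tsub_cancel_of_le h.le
  · exact hl.trans (by exact_mod_cast le_max_right _ _)

/-- Predictable sets are inner approximable by intersections of foretellable elementary sets, for
finite measures that do not charge time `0`. -/
lemma isInnerForetellable_of_predictable {μ : Measure (ℝ≥0 × Ω)} [IsFiniteMeasure μ]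
    (h0 : μ ({0} ×ˢ univ) = 0) {C : Set (ℝ≥0 × Ω)} (hC : MeasurableSet[𝓕.predictable] C) :
    IsInnerForetellable 𝓕 μ C := by
  -- Approximability alone is not visibly stable under complements. Carrying a set together with its
  -- complement makes the class a σ-algebra, since both countable unions and countable intersections
  -- preserve approximability.
  suffices h : IsInnerForetellable 𝓕 μ C ∧ IsInnerForetellable 𝓕 μ Cᶜ from h.1
  have hpos : ∀ (n : ℕ) (i : ℝ≥0), i < i + 1 / ((n : ℝ≥0) + 1) := fun n i =>
    lt_add_of_pos_right _ (by positivity)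
  have huniv : ∀ D : Set (ℝ≥0 × Ω), (∀ t ω, 0 < t → (t, ω) ∈ D) → IsInnerForetellable 𝓕 μ D := by
    intro D hD
    refine IsInnerForetellable.of_iUnion_elem
      (V := fun n : ℕ => Icc (0 + 1 / ((n : ℝ≥0) + 1)) n ×ˢ univ)
      (fun n => .box (hpos n 0) MeasurableSet.univ) ?_ (measure_mono_null ?_ h0)
    · rintro n ⟨t, ω⟩ ⟨ht, -⟩
      exact hD t ω ((hpos n 0).trans_le ht.1)
    · rintro ⟨t, ω⟩ ⟨-, h⟩
      refine ⟨?_, mem_univ _⟩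
      by_contra h'
      obtain ⟨n, hn⟩ := exists_nat_mem_Icc (pos_iff_ne_zero.2 h')
      exact h (mem_iUnion.2 ⟨n, hn, mem_univ _⟩)
  have hle := Filtration.predictable_le_prod 𝓕
  refine MeasurableSpace.generateFrom_induction _
    (p := fun C _ => IsInnerForetellable 𝓕 μ C ∧ IsInnerForetellable 𝓕 μ Cᶜ) ?_ ?_ ?_ ?_ C hC
  · rintro _ (⟨F, hF, rfl⟩ | ⟨i, F, hF, rfl⟩) _
    · refine ⟨IsInnerForetellable.of_subset (.of_elem .empty) (empty_subset _)
        (measure_mono_null ?_ h0), huniv _ ?_⟩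
      · rintro ⟨t, ω⟩ ⟨⟨h, -⟩, -⟩
        exact ⟨h, mem_univ _⟩
      · rintro t ω ht ⟨h, -⟩
        exact ht.ne' h
    · constructor
      · refine IsInnerForetellable.of_iUnion_elem
          (V := fun n : ℕ => Icc (i + 1 / ((n : ℝ≥0) + 1)) n ×ˢ F)
          (fun n => .box (hpos n i) hF) ?_ ?_
        · rintro n ⟨t, ω⟩ ⟨ht, h⟩
          exact ⟨(hpos n i).trans_le ht.1, h⟩
        · convert measure_empty (μ := μ)
          rw [sdiff_eq_empty]
          rintro ⟨t, ω⟩ ⟨ht, h⟩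
          obtain ⟨n, hn⟩ := exists_nat_mem_Icc ht
          exact mem_iUnion.2 ⟨n, hn, h⟩
      · refine IsInnerForetellable.of_iUnion_elem
          (V := fun n : ℕ => Icc (i + 1 / ((n : ℝ≥0) + 1)) n ×ˢ Fᶜ ∪
            Icc (0 + 1 / ((n : ℝ≥0) + 1)) i ×ˢ univ)
          (fun n => .union (.box (hpos n i) hF.compl) (.box (hpos n 0) MeasurableSet.univ)) ?_
          (measure_mono_null ?_ h0)
        · rintro n ⟨t, ω⟩ (⟨-, h⟩ | ⟨h, -⟩) ⟨h1, h2⟩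
          · exact h h2
          · exact not_lt.2 h.2 h1
        · rintro ⟨t, ω⟩ ⟨h1, h⟩
          refine ⟨?_, mem_univ _⟩
          by_contra h'
          refine h (mem_iUnion.2 ?_)
          rcases le_or_gt t i with hti | hti
          · obtain ⟨n, hn⟩ := exists_nat_mem_Icc (pos_iff_ne_zero.2 h')
            exact ⟨n, Or.inr ⟨⟨hn.1, hti⟩, mem_univ _⟩⟩
          · obtain ⟨n, hn⟩ := exists_nat_mem_Icc hti
            exact ⟨n, Or.inl ⟨hn, fun hF => h1 ⟨hti, hF⟩⟩⟩
  · exact ⟨.of_elem .empty, huniv _ (by simp)⟩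
  · intro C _ h
    rw [compl_compl]
    exact h.symm
  · intro C hC h
    refine ⟨.iUnion (fun n => (h n).1) fun n => hle _ (hC n), ?_⟩
    rw [compl_iUnion]
    exact .iInter fun n => (h n).2

/-- An infimum being strictly below `i` is a countable union of events, whereas the non-strict
version is not; right-continuity of the filtration makes the strict version sufficient. -/
lemma IsFiniteStoppingTime.iInf [𝓕.IsRightContinuous] {ρ : ℕ → Ω → ℝ≥0}
    (hρ : ∀ n, IsFiniteStoppingTime 𝓕 (ρ n)) : IsFiniteStoppingTime 𝓕 fun ω => ⨅ n, ρ n ω := by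
  refine .of_isStoppingTime (isStoppingTime_of_measurableSet_lt_of_isRightContinuous fun i => ?_)
  have : {ω | WithTop.some (⨅ n, ρ n ω) < WithTop.some i} = ⋃ n, {ω | ρ n ω < i} := by
    ext ω
    simp only [mem_ofPred_eq, mem_iUnion]
    exact WithTop.coe_lt_coe.trans (ciInf_lt_iff (OrderBot.bddBelow _))
  rw [this]
  exact MeasurableSet.iUnion fun n => (hρ n).measurableSet_lt le_rfl

/-- A predictable non-decreasing process can be stopped strictly before it reaches a level. -/
lemma exists_stopping_lt_level {P : Measure Ω} [IsProbabilityMeasure P] [𝓕.IsRightContinuous]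
    {A : ℝ≥0 → Ω → ℝ≥0} (hA : IsStronglyPredictable 𝓕 A) (hmono : ∀ ω, Monotone fun t => A t ω)
    (hr : ∀ ω, IsRightContPath fun t => A t ω) (h0 : ∀ ω, A 0 ω = 0) {u : ℝ≥0} (hu : 0 < u)
    (T : ℝ≥0) {e : ℝ≥0∞} (he : e ≠ 0) :
    ∃ ρ : Ω → ℝ≥0, IsFiniteStoppingTime 𝓕 ρ ∧ (∀ ω, ρ ω ≤ T) ∧
      (∀ᵐ ω ∂P, A (ρ ω) ω < u) ∧ P {ω | A T ω < u ∧ ρ ω < T} ≤ e := by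
  have hAm : ∀ t, Measurable (A t) := fun t =>
    ((hA.stronglyAdapted t).mono (𝓕.le t)).measurable
  set B : Set (ℝ≥0 × Ω) := {p | u ≤ A p.1 p.2} with hB
  have hBm : MeasurableSet[𝓕.predictable] B :=
    @StronglyMeasurable.measurable (ℝ≥0 × Ω) ℝ≥0 _ 𝓕.predictable _ _ _ _ hA _ measurableSet_Ici
  set S : Set Ω := {ω | u ≤ A T ω} with hS
  have hSm : MeasurableSet S := hAm T measurableSet_Ici
  set D : Ω → Set ℝ≥0 := fun ω => {t | u ≤ A t ω ∨ T ≤ t} with hD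
  set σ : Ω → ℝ≥0 := fun ω => sInf (D ω) with hσ
  have hDne : ∀ ω, (D ω).Nonempty := fun ω => ⟨T, Or.inr le_rfl⟩
  -- By right-continuity of `A` the infimum is attained, so `σ` really is the first time (before
  -- `T`) at which the level has been reached.
  have hσmem : ∀ ω, σ ω ∈ D ω := by
    intro ω
    by_contra hcon
    simp only [hD, mem_ofPred_eq, not_or, not_le] at hcon
    have h1 : ∀ᶠ t in 𝓝[≥] (σ ω), A t ω < u ∧ t < T :=
      ((hr ω (σ ω)).eventually (gt_mem_nhds hcon.1)).and
        (mem_nhdsWithin_of_mem_nhds (gt_mem_nhds hcon.2))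
    obtain ⟨v, hv, hsub⟩ := (mem_nhdsGE_iff_exists_Ico_subset).1 h1
    obtain ⟨t, ht, htv⟩ := exists_lt_of_csInf_lt (hDne ω) (show sInf (D ω) < v from hv)
    have h2 := hsub ⟨csInf_le (OrderBot.bddBelow _) ht, htv⟩
    rcases ht with ht | ht
    · exact not_lt.2 ht h2.1
    · exact not_lt.2 ht h2.2
  have hσT : ∀ ω, σ ω ≤ T := fun ω => csInf_le (OrderBot.bddBelow _) (Or.inr le_rfl)
  have hσm : Measurable σ := by
    refine measurable_of_Iic fun t => ?_
    have : σ ⁻¹' Iic t = {ω | u ≤ A t ω} ∪ {_ω | T ≤ t} := by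
      ext ω
      simp only [mem_preimage, mem_Iic, mem_union, mem_ofPred_eq]
      constructor
      · intro h
        rcases hσmem ω with h' | h'
        · exact Or.inl (h'.trans (hmono ω h))
        · exact Or.inr (h'.trans h)
      · exact fun h => csInf_le (OrderBot.bddBelow _) h
    rw [this]
    exact (hAm t measurableSet_Ici).union (MeasurableSet.const _)
  have hgm : Measurable fun ω => (σ ω, ω) := hσm.prodMk measurable_id
  -- The measure carried by the graph of the passage time. Approximating `{u ≤ A}` from inside for
  -- this measure captures the graph up to small probability, and `A 0 = 0 < u` ensures that time
  -- `0` is not charged.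
  set μ : Measure (ℝ≥0 × Ω) := (P.restrict S).map fun ω => (σ ω, ω) with hμ
  have hAσ : ∀ ω ∈ S, u ≤ A (σ ω) ω := by
    intro ω hω
    rcases hσmem ω with h' | h'
    · exact h'
    · exact le_trans hω (hmono ω h')
  have hμ0 : μ ({0} ×ˢ univ) = 0 := by
    rw [hμ, Measure.map_apply hgm ((measurableSet_singleton _).prod MeasurableSet.univ),
      Measure.restrict_apply (hgm ((measurableSet_singleton _).prod MeasurableSet.univ))]
    convert measure_empty (μ := P)
    ext ω
    simp only [mem_inter_iff, mem_preimage, mem_prod, mem_singleton_iff, mem_univ, and_true,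
      mem_empty_iff_false, iff_false, not_and]
    intro h hω
    have := hAσ ω hω
    rw [h, h0] at this
    exact not_lt.2 this hu
  have hinner := isInnerForetellable_of_predictable hμ0 hBm
  obtain ⟨d, hd, hde⟩ := ENNReal.exists_pos_sum_of_countable' he ℕ
  choose K hK hKB hμK using fun n => hinner (d n) (hd n).ne'
  choose U hU hUa hUK using hK
  -- Off `S` the closed set `K n` has no point before `T`, because `A` stays below `u` there. By
  -- compactness of sections some `U n k` also misses `[0, T]`, so for large `k` needless stopping
  -- is unlikely.
  have hhit : ∀ n, ∃ k, P (Sᶜ ∩ {ω | ∃ t ≤ T, (t, ω) ∈ U n k}) ≤ d n := by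
    intro n
    have hlim : Tendsto (fun k => P (Sᶜ ∩ {ω | ∃ t ≤ T, (t, ω) ∈ U n k})) atTop
        (𝓝 (P (⋂ k, (Sᶜ ∩ {ω | ∃ t ≤ T, (t, ω) ∈ U n k})))) := by
      refine tendsto_measure_iInter_atTop
        (fun k => (hSm.compl.inter ((hU n k).measurableSet_hit T)).nullMeasurableSet) ?_
        ⟨0, measure_ne_top _ _⟩
      rintro i j hij ω ⟨h1, t, ht, h2⟩
      exact ⟨h1, t, ht, hUa n hij h2⟩
    have hemp : (⋂ k, (Sᶜ ∩ {ω | ∃ t ≤ T, (t, ω) ∈ U n k})) = ∅ := by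
      ext ω
      simp only [mem_iInter, mem_inter_iff, mem_empty_iff_false, iff_false]
      intro h
      have hne : (⋂ k, {t | (t, ω) ∈ U n k} ∩ Iic T).Nonempty := by
        refine IsCompact.nonempty_iInter_of_sequence_nonempty_isCompact_isClosed _ ?_ ?_ ?_ ?_
        · exact fun k => inter_subset_inter_left _ fun t ht => hUa n k.le_succ ht
        · rintro k
          obtain ⟨-, t, ht, h2⟩ := h k
          exact ⟨t, h2, ht⟩
        · exact ((hU n 0).isCompact_section ω).inter_right isClosed_Iic
        · exact fun k => ((hU n k).isCompact_section ω).isClosed.inter isClosed_Iic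
      obtain ⟨t, ht⟩ := hne
      simp only [mem_iInter, mem_inter_iff, mem_ofPred_eq, mem_Iic] at ht
      have h3 : (t, ω) ∈ B := hKB n (by rw [hUK n]; exact mem_iInter.2 fun k => (ht k).1)
      exact (h 0).1 (le_trans h3 (hmono ω (ht 0).2))
    rw [hemp, measure_empty] at hlim
    obtain ⟨k, hk⟩ := (hlim.eventually (gt_mem_nhds (hd n))).exists
    exact ⟨k, hk.le⟩
  choose k hk using hhit
  choose ρ hρs hρT hρlt hρeq using fun n => (hU n (k n)).exists_stopping_before T
  refine ⟨_, IsFiniteStoppingTime.iInf hρs, fun ω =>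
    (ciInf_le (OrderBot.bddBelow _) 0).trans (hρT 0 ω), ?_, ?_⟩
  -- Almost every passage point lies in some `K n`, and the corresponding `ρ n` stops strictly
  -- before all of `U n (k n) ⊇ K n`; hence the infimum precedes the passage.
  · have hnull : P (S ∩ {ω | ∀ n, (σ ω, ω) ∉ K n}) = 0 := by
      refine le_antisymm (ENNReal.le_of_forall_pos_le_add fun ε hε _ => ?_) (zero_le)
      have hsum : Tendsto d atTop (𝓝 0) :=
        ENNReal.tendsto_atTop_zero_of_tsum_ne_top (hde.trans_le le_top).ne
      obtain ⟨n, hn⟩ := (hsum.eventually (gt_mem_nhds (ENNReal.coe_pos.2 hε))).exists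
      rw [zero_add]
      have hKm : MeasurableSet (K n) :=
        IsForetellableClosed.measurableSet ⟨U n, hU n, hUa n, hUK n⟩
      have hBm' := Filtration.predictable_le_prod 𝓕 _ hBm
      calc P (S ∩ {ω | ∀ n, (σ ω, ω) ∉ K n})
          ≤ P ((fun ω => (σ ω, ω)) ⁻¹' (B \ K n) ∩ S) :=
            measure_mono fun ω hω => ⟨⟨hAσ ω hω.1, hω.2 n⟩, hω.1⟩
        _ = μ (B \ K n) := by
            rw [hμ, Measure.map_apply hgm (hBm'.diff hKm),
              Measure.restrict_apply (hgm (hBm'.diff hKm))]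
        _ ≤ d n := hμK n
        _ ≤ ε := hn.le
    filter_upwards [measure_eq_zero_iff_ae_notMem.1 hnull] with ω hω
    by_cases hωS : ω ∈ S
    · simp only [mem_inter_iff, hωS, true_and, mem_ofPred_eq, not_forall, not_not] at hω
      obtain ⟨n, hn⟩ := hω
      have hlt : ⨅ n, ρ n ω < σ ω := (ciInf_le (OrderBot.bddBelow _) n).trans_lt
        (hρlt n _ ω (by rw [hUK n] at hn; exact mem_iInter.1 hn _))
      by_contra hcon
      exact notMem_of_lt_csInf hlt (OrderBot.bddBelow _) (Or.inl (not_lt.1 hcon))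
    · exact (hmono ω ((ciInf_le (OrderBot.bddBelow _) 0).trans (hρT 0 ω))).trans_lt (not_le.1 hωS)
  · calc P {ω | A T ω < u ∧ ⨅ n, ρ n ω < T}
        ≤ P (⋃ n, (Sᶜ ∩ {ω | ∃ t ≤ T, (t, ω) ∈ U n (k n)})) := measure_mono fun ω hω => by
          obtain ⟨h1, h2⟩ := hω
          obtain ⟨n, hn⟩ := (ciInf_lt_iff (OrderBot.bddBelow _)).1 h2
          refine mem_iUnion.2 ⟨n, not_le.2 h1, ?_⟩
          by_contra hcon
          exact hn.ne (hρeq n ω hcon)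
      _ ≤ ∑' n, P (Sᶜ ∩ {ω | ∃ t ≤ T, (t, ω) ∈ U n (k n)}) := measure_iUnion_le _
      _ ≤ ∑' n, d n := ENNReal.tsum_le_tsum hk
      _ ≤ e := hde.le

end Predictable

/-! ### The function `G`: concavity, continuity and limits -/

section Bihari

/-- The real function `x ↦ ∫_c^x du / η(u)` on `(0, ∞)`. -/
noncomputable def bihariReal (η : ℝ≥0 → ℝ≥0) (c : ℝ≥0) (x : ℝ) : ℝ :=
  ∫ u in (c : ℝ)..x, (η u.toNNReal : ℝ)⁻¹

variable {η : ℝ≥0 → ℝ≥0} {c : ℝ≥0}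

lemma inv_eta_antitoneOn (hη : Monotone η) (hpos : ∀ x, 0 < x → 0 < η x) :
    AntitoneOn (fun u : ℝ => (η u.toNNReal : ℝ)⁻¹) (Ioi 0) := by
  intro x hx y _ hxy
  have h1 : 0 < η x.toNNReal := hpos _ (Real.toNNReal_pos.2 hx)
  have h2 : η x.toNNReal ≤ η y.toNNReal := hη (Real.toNNReal_le_toNNReal hxy)
  exact inv_anti₀ (by exact_mod_cast h1) (by exact_mod_cast h2)

lemma inv_eta_intervalIntegrable (hη : Monotone η) (hpos : ∀ x, 0 < x → 0 < η x) {x y : ℝ}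
    (hx : 0 < x) (hy : 0 < y) :
    IntervalIntegrable (fun u : ℝ => (η u.toNNReal : ℝ)⁻¹) volume x y :=
  ((inv_eta_antitoneOn hη hpos).mono fun _ hu =>
    (lt_min hx hy).trans_le hu.1).intervalIntegrable

lemma bihariReal_sub (hη : Monotone η) (hpos : ∀ x, 0 < x → 0 < η x) (hc : 0 < c) {x y : ℝ}
    (hx : 0 < x) (hy : 0 < y) :
    bihariReal η c y - bihariReal η c x = ∫ u in x..y, (η u.toNNReal : ℝ)⁻¹ :=
  intervalIntegral.integral_interval_sub_left
    (inv_eta_intervalIntegrable hη hpos (by exact_mod_cast hc) hy)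
    (inv_eta_intervalIntegrable hη hpos (by exact_mod_cast hc) hx)

lemma bihariReal_self : bihariReal η c c = 0 := intervalIntegral.integral_same

lemma bihariReal_mono (hη : Monotone η) (hpos : ∀ x, 0 < x → 0 < η x) (hc : 0 < c) {x y : ℝ}
    (hx : 0 < x) (hxy : x ≤ y) : bihariReal η c x ≤ bihariReal η c y := by
  rw [← sub_nonneg, bihariReal_sub hη hpos hc hx (hx.trans_le hxy)]
  exact intervalIntegral.integral_nonneg hxy fun u _ => by positivity

/-- The graph of `x ↦ ∫_c^x du / η(u)` lies below its supporting lines. -/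
lemma bihariReal_sub_le (hη : Monotone η) (hpos : ∀ x, 0 < x → 0 < η x) (hc : 0 < c) {x y : ℝ}
    (hx : 0 < x) (hy : 0 < y) :
    bihariReal η c y - bihariReal η c x ≤ (y - x) * (η x.toNNReal : ℝ)⁻¹ := by
  have hanti := inv_eta_antitoneOn hη hpos
  have hconst : ∫ _ in x..y, (η x.toNNReal : ℝ)⁻¹ = (y - x) * (η x.toNNReal : ℝ)⁻¹ := by simp
  rw [bihariReal_sub hη hpos hc hx hy, ← hconst]
  rcases le_total x y with h | h
  · exact intervalIntegral.integral_mono_on h (inv_eta_intervalIntegrable hη hpos hx hy)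
      intervalIntegrable_const fun u hu => hanti hx (hx.trans_le hu.1) hu.1
  · rw [intervalIntegral.integral_symm, intervalIntegral.integral_symm y x]
    refine neg_le_neg ?_
    exact intervalIntegral.integral_mono_on h intervalIntegrable_const
      (inv_eta_intervalIntegrable hη hpos hy hx) fun u hu => hanti (hy.trans_le hu.1) hx hu.2

lemma bihariReal_continuousAt (hη : Monotone η) (hpos : ∀ x, 0 < x → 0 < η x) (hc : 0 < c) {x : ℝ}
    (hx : 0 < x) : ContinuousAt (bihariReal η c) x := by
  have hc' : (0 : ℝ) < c := by exact_mod_cast hc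
  have hcont := intervalIntegral.continuousOn_primitive_interval'
    (inv_eta_intervalIntegrable hη hpos (x := min c (x / 2)) (y := max c (x + 1))
      (by positivity) (by positivity)) (a := (c : ℝ))
    (by rw [uIcc_of_le ((min_le_left _ _).trans (le_max_left _ _))]
        exact ⟨min_le_left _ _, le_max_left _ _⟩)
  refine hcont.continuousAt ?_
  rw [uIcc_of_le ((min_le_left _ _).trans (le_max_left _ _))]
  exact Icc_mem_nhds ((min_le_right _ _).trans_lt (by linarith))
    (lt_of_lt_of_le (by linarith) (le_max_right _ _))

lemma lintegral_inv_eta (hη : Monotone η) (hpos : ∀ x, 0 < x → 0 < η x) {a b : ℝ}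
    (ha : 0 < a) (hab : a ≤ b) :
    ∫⁻ u in Ioc a b, (η u.toNNReal : ℝ≥0∞)⁻¹ =
      ENNReal.ofReal (∫ u in a..b, (η u.toNNReal : ℝ)⁻¹) := by
  rw [intervalIntegral.integral_of_le hab, ofReal_integral_eq_lintegral_ofReal]
  · refine setLIntegral_congr_fun measurableSet_Ioc fun u hu => ?_
    have h := hpos u.toNNReal (Real.toNNReal_pos.2 (ha.trans hu.1))
    rw [ENNReal.ofReal_inv_of_pos (by exact_mod_cast h), ENNReal.ofReal_coe_nnreal]
  · exact (inv_eta_intervalIntegrable hη hpos ha (ha.trans_le hab)).1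
  · exact ae_of_all _ fun u => by positivity

lemma bihariG_mono : Monotone (bihariG η c) := by
  intro x y hxy
  refine EReal.sub_le_sub ?_ ?_
  · exact EReal.coe_ennreal_le_coe_ennreal_iff.2
      (lintegral_mono_set fun u hu => ⟨hu.1, hu.2.trans hxy⟩)
  · exact EReal.coe_ennreal_le_coe_ennreal_iff.2
      (lintegral_mono_set fun u hu => ⟨hxy.trans_lt hu.1, hu.2⟩)

lemma bihariG_of_le {x : ℝ≥0∞} (hx : c ≤ x) : bihariG η c x =
    ((∫⁻ u in {u : ℝ | (c : ℝ) < u ∧ ENNReal.ofReal u ≤ x}, (η u.toNNReal : ℝ≥0∞)⁻¹ : ℝ≥0∞) :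
      EReal) := by
  have : {u : ℝ | x < ENNReal.ofReal u ∧ u ≤ (c : ℝ)} = ∅ := by
    ext u
    simp only [mem_ofPred_eq, mem_empty_iff_false, iff_false, not_and]
    intro h1 h2
    have h3 := ENNReal.ofReal_le_ofReal h2
    rw [ENNReal.ofReal_coe_nnreal] at h3
    exact not_lt.2 (h3.trans hx) h1
  simp [bihariG, this]

lemma bihariG_of_ge {x : ℝ≥0∞} (hx : x ≤ c) : bihariG η c x =
    -((∫⁻ u in {u : ℝ | x < ENNReal.ofReal u ∧ u ≤ (c : ℝ)}, (η u.toNNReal : ℝ≥0∞)⁻¹ : ℝ≥0∞) :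
      EReal) := by
  have : {u : ℝ | (c : ℝ) < u ∧ ENNReal.ofReal u ≤ x} = ∅ := by
    ext u
    simp only [mem_ofPred_eq, mem_empty_iff_false, iff_false, not_and]
    intro h1 h2
    rw [← ENNReal.ofReal_coe_nnreal] at hx
    exact not_le.2 h1 ((ENNReal.ofReal_le_ofReal_iff c.2).1 (h2.trans hx))
  simp [bihariG, this]

lemma bihariG_nonneg {x : ℝ≥0∞} (hx : c ≤ x) : 0 ≤ bihariG η c x := by
  rw [bihariG_of_le hx]; exact EReal.coe_ennreal_nonneg _

lemma bihariG_top : bihariG η c ⊤ =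
    ((∫⁻ u in Ioi (c : ℝ), (η u.toNNReal : ℝ≥0∞)⁻¹ : ℝ≥0∞) : EReal) := by
  rw [bihariG_of_le le_top]
  congr 3
  simp [Ioi]

lemma bihariG_zero : bihariG η c 0 =
    -((∫⁻ u in Ioc 0 (c : ℝ), (η u.toNNReal : ℝ≥0∞)⁻¹ : ℝ≥0∞) : EReal) := by
  rw [bihariG_of_ge (zero_le)]
  congr 4
  ext u; simp

lemma bihariG_eq_bihariReal (hη : Monotone η) (hpos : ∀ x, 0 < x → 0 < η x) (hc : 0 < c) {x : ℝ≥0}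
    (hx : 0 < x) : bihariG η c x = (bihariReal η c x : EReal) := by
  have hc' : (0 : ℝ) < c := by exact_mod_cast hc
  have hx' : (0 : ℝ) < x := by exact_mod_cast hx
  rcases le_total c x with h | h
  · have h' : (c : ℝ) ≤ x := by exact_mod_cast h
    have hset : {u : ℝ | (c : ℝ) < u ∧ ENNReal.ofReal u ≤ x} = Ioc (c : ℝ) x := by
      ext u
      rw [← ENNReal.ofReal_coe_nnreal]
      exact and_congr_right fun _ => ENNReal.ofReal_le_ofReal_iff x.2
    rw [bihariG_of_le (by exact_mod_cast h), hset, lintegral_inv_eta hη hpos hc' h',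
      EReal.coe_ennreal_ofReal, max_eq_left]
    · rfl
    · exact intervalIntegral.integral_nonneg h' fun u _ => by positivity
  · have h' : (x : ℝ) ≤ c := by exact_mod_cast h
    have hset : {u : ℝ | (x : ℝ≥0∞) < ENNReal.ofReal u ∧ u ≤ (c : ℝ)} = Ioc (x : ℝ) c := by
      ext u
      rw [← ENNReal.ofReal_coe_nnreal]
      exact and_congr_left fun _ => ENNReal.ofReal_lt_ofReal_iff_of_nonneg x.2
    rw [bihariG_of_ge (by exact_mod_cast h), hset, lintegral_inv_eta hη hpos hx' h',
      EReal.coe_ennreal_ofReal, max_eq_left, ← EReal.coe_neg, ← intervalIntegral.integral_symm]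
    · rfl
    · exact intervalIntegral.integral_nonneg h' fun u _ => by positivity

/-- The shift by `ε` keeps the argument away from `0`, where `G` may be `-∞`, so that real-valued
calculus applies. -/
lemma bihariG_le_bihariReal (hη : Monotone η) (hpos : ∀ x, 0 < x → 0 < η x) (hc : 0 < c)
    (x : ℝ≥0) {ε : ℝ≥0} (hε : 0 < ε) :
    bihariG η c x ≤ (bihariReal η c (x + ε : ℝ≥0) : EReal) := by
  rw [← bihariG_eq_bihariReal hη hpos hc (by positivity)]
  exact bihariG_mono (by exact_mod_cast le_self_add)

lemma tendsto_lintegral_Ioc_zero (f : ℝ → ℝ≥0∞) (c : ℝ) :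
    Tendsto (fun n : ℕ => ∫⁻ u in Ioc (1 / ((n : ℝ) + 1)) c, f u) atTop
      (𝓝 (∫⁻ u in Ioc 0 c, f u)) := by
  have hU : Ioc 0 c = ⋃ n : ℕ, Ioc (1 / ((n : ℝ) + 1)) c := by
    ext u
    simp only [mem_Ioc, mem_iUnion]
    constructor
    · rintro ⟨h1, h2⟩
      obtain ⟨n, hn⟩ := exists_nat_one_div_lt h1
      exact ⟨n, hn, h2⟩
    · rintro ⟨n, h1, h2⟩
      exact ⟨lt_trans (by positivity) h1, h2⟩
  have hm : Monotone fun n : ℕ => Ioc (1 / ((n : ℝ) + 1)) c := by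
    intro i j hij
    refine Ioc_subset_Ioc_left ?_
    gcongr
  rw [hU, setLIntegral_iUnion_of_directed _ hm.directed_le]
  exact tendsto_atTop_iSup fun i j hij => lintegral_mono_set (hm hij)

lemma tendsto_lintegral_Ioc_atTop (f : ℝ → ℝ≥0∞) (c : ℝ) :
    Tendsto (fun n : ℕ => ∫⁻ u in Ioc c (n : ℝ), f u) atTop (𝓝 (∫⁻ u in Ioi c, f u)) := by
  have hU : Ioi c = ⋃ n : ℕ, Ioc c (n : ℝ) := by
    ext u
    simp only [mem_Ioc, mem_iUnion, mem_Ioi]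
    constructor
    · intro h
      obtain ⟨n, hn⟩ := exists_nat_ge u
      exact ⟨n, h, hn⟩
    · rintro ⟨n, h1, h2⟩
      exact h1
  have hm : Monotone fun n : ℕ => Ioc c (n : ℝ) := by
    intro i j hij
    refine Ioc_subset_Ioc_right ?_
    exact_mod_cast hij
  rw [hU, setLIntegral_iUnion_of_directed _ hm.directed_le]
  exact tendsto_atTop_iSup fun i j hij => lintegral_mono_set (hm hij)

/-- Right-continuity of `G` at finite points. -/
lemma tendsto_bihariReal_add (hη : Monotone η) (hpos : ∀ x, 0 < x → 0 < η x) (hc : 0 < c)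
    (x : ℝ≥0) :
    Tendsto (fun n : ℕ => (bihariReal η c (x + 1 / ((n : ℝ) + 1)) : EReal)) atTop
      (𝓝 (bihariG η c x)) := by
  have h0 : Tendsto (fun n : ℕ => (x : ℝ) + 1 / ((n : ℝ) + 1)) atTop (𝓝 x) := by
    simpa using (tendsto_const_nhds (x := (x : ℝ))).add
      (tendsto_one_div_add_atTop_nhds_zero_nat (𝕜 := ℝ))
  rcases eq_or_ne x 0 with rfl | hx
  · rw [ENNReal.coe_zero, bihariG_zero]
    have hlim := (continuous_coe_ennreal_ereal.tendsto _).comp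
      (tendsto_lintegral_Ioc_zero (fun u => (η u.toNNReal : ℝ≥0∞)⁻¹) c)
    refine (hlim.neg).congr' ?_
    have hev : ∀ᶠ n : ℕ in atTop, 1 / ((n : ℝ) + 1) < c :=
      tendsto_one_div_add_atTop_nhds_zero_nat.eventually (gt_mem_nhds (by exact_mod_cast hc))
    filter_upwards [hev] with n hn
    have hp : (0 : ℝ) < 1 / ((n : ℝ) + 1) := by positivity
    simp only [Function.comp]
    rw [lintegral_inv_eta hη hpos hp hn.le, EReal.coe_ennreal_ofReal, max_eq_left,
      ← EReal.coe_neg, ← intervalIntegral.integral_symm, NNReal.coe_zero, zero_add]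
    · rfl
    · exact intervalIntegral.integral_nonneg hn.le fun u _ => by positivity
  · have hx0 : 0 < x := pos_iff_ne_zero.2 hx
    rw [bihariG_eq_bihariReal hη hpos hc hx0]
    refine (continuous_coe_real_ereal.tendsto _).comp ?_
    exact (bihariReal_continuousAt hη hpos hc (by exact_mod_cast hx0)).tendsto.comp h0

lemma tendsto_bihariReal_atTop (hη : Monotone η) (hpos : ∀ x, 0 < x → 0 < η x) (hc : 0 < c) :
    Tendsto (fun n : ℕ => (bihariReal η c n : EReal)) atTop (𝓝 (bihariG η c ⊤)) := by
  rw [bihariG_top]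
  refine ((continuous_coe_ennreal_ereal.tendsto _).comp
    (tendsto_lintegral_Ioc_atTop (fun u => (η u.toNNReal : ℝ≥0∞)⁻¹) c)).congr' ?_
  filter_upwards [eventually_ge_atTop ⌈(c : ℝ)⌉₊] with n hn
  have hcn : (c : ℝ) ≤ n := Nat.ceil_le.1 hn
  simp only [Function.comp]
  rw [lintegral_inv_eta hη hpos (by exact_mod_cast hc) hcn, EReal.coe_ennreal_ofReal, max_eq_left]
  · rfl
  · exact intervalIntegral.integral_nonneg hcn fun u _ => by positivity

/-- Under the Osgood condition, `G(x) → -∞` as `x → 0`. -/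
lemma OsgoodCondition.exists_bihariReal_lt (ho : OsgoodCondition η) (hη : Monotone η)
    (hpos : ∀ x, 0 < x → 0 < η x) (hc : 0 < c) (B : ℝ) :
    ∃ ε : ℝ≥0, 0 < ε ∧ ∀ x : ℝ≥0, 0 < x → x ≤ ε → bihariReal η c x < B := by
  have h := tendsto_bihariReal_add hη hpos hc 0
  rw [ENNReal.coe_zero, bihariG_zero, ho c (by exact_mod_cast hc)] at h
  obtain ⟨n, hn⟩ := (h.eventually (gt_mem_nhds (show -((⊤ : ℝ≥0∞) : EReal) < (B : EReal) by
    simp))).exists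
  refine ⟨1 / ((n : ℝ≥0) + 1), by positivity, fun x hx hxe => ?_⟩
  have h1 : bihariReal η c (1 / ((n : ℝ) + 1)) < B := by
    have := EReal.coe_lt_coe_iff.1 hn
    simpa using this
  refine (bihariReal_mono hη hpos hc (by exact_mod_cast hx) ?_).trans_lt h1
  have : (x : ℝ) ≤ ((1 / ((n : ℝ≥0) + 1) : ℝ≥0) : ℝ) := by exact_mod_cast hxe
  simpa using this

lemma osgoodCondition_of_bihariG_zero (hη : Monotone η) (hpos : ∀ x, 0 < x → 0 < η x)
    (h : bihariG η c 0 = ⊥) : OsgoodCondition η := by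
  intro ε hε
  rw [bihariG_zero, EReal.neg_eq_bot_iff, EReal.coe_ennreal_eq_top_iff] at h
  by_contra hcon
  refine absurd h (ne_of_lt ?_)
  calc ∫⁻ u in Ioc 0 (c : ℝ), (η u.toNNReal : ℝ≥0∞)⁻¹
      ≤ ∫⁻ u in Ioc 0 ε ∪ Ioc ε (max ε c), (η u.toNNReal : ℝ≥0∞)⁻¹ := by
        refine lintegral_mono_set ?_
        rw [Ioc_union_Ioc_eq_Ioc hε.le (le_max_left _ _)]
        exact Ioc_subset_Ioc_right (le_max_right _ _)
    _ ≤ _ := lintegral_union_le _ _ _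
    _ < ⊤ := ENNReal.add_lt_top.2 ⟨lt_top_iff_ne_top.2 hcon, by
        rw [lintegral_inv_eta hη hpos hε (le_max_left _ _)]; exact ENNReal.ofReal_lt_top⟩

lemma bihariG_top_eq_top (hη : Monotone η) (hpos : ∀ x, 0 < x → 0 < η x)
    (h : ∫⁻ u in Ioi (1 : ℝ), (η u.toNNReal : ℝ≥0∞)⁻¹ = ⊤) : bihariG η c ⊤ = ⊤ := by
  rw [bihariG_top, EReal.coe_ennreal_eq_top_iff]
  by_contra hcon
  refine absurd h (ne_of_lt ?_)
  calc ∫⁻ u in Ioi (1 : ℝ), (η u.toNNReal : ℝ≥0∞)⁻¹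
      ≤ ∫⁻ u in Ioc 1 (max 1 (c : ℝ)) ∪ Ioi (c : ℝ), (η u.toNNReal : ℝ≥0∞)⁻¹ := by
        refine lintegral_mono_set fun u hu => ?_
        rcases le_or_gt u c with h | h
        · exact Or.inl ⟨hu, h.trans (le_max_right _ _)⟩
        · exact Or.inr h
    _ ≤ _ := lintegral_union_le _ _ _
    _ < ⊤ := ENNReal.add_lt_top.2 ⟨by
        rw [lintegral_inv_eta hη hpos one_pos (le_max_left _ _)]
        exact ENNReal.ofReal_lt_top, lt_top_iff_ne_top.2 hcon⟩

end Bihari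

/-! ### Supporting lines with a moving contact point -/

section Discrete

/-- The running maximum of `s₀` and the first terms of a sequence. -/
noncomputable def gridMax (s₀ : ℝ≥0) (x : ℕ → ℝ≥0) : ℕ → ℝ≥0
  | 0 => max s₀ (x 0)
  | n + 1 => max (gridMax s₀ x n) (x (n + 1))

lemma gridMax_mono (s₀ : ℝ≥0) (x : ℕ → ℝ≥0) : Monotone (gridMax s₀ x) :=
  monotone_nat_of_le_succ fun _ => le_max_left _ _

lemma le_gridMax (s₀ : ℝ≥0) (x : ℕ → ℝ≥0) (n : ℕ) : s₀ ≤ gridMax s₀ x n :=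
  (le_max_left _ _).trans (gridMax_mono s₀ x n.zero_le)

lemma apply_le_gridMax (s₀ : ℝ≥0) (x : ℕ → ℝ≥0) {i n : ℕ} (h : i ≤ n) : x i ≤ gridMax s₀ x n := by
  refine le_trans ?_ (gridMax_mono s₀ x h)
  cases i with
  | zero => exact le_max_right _ _
  | succ i => exact le_max_right _ _

variable {η : ℝ≥0 → ℝ≥0} {c : ℝ≥0}

/-- Raising the contact point of a supporting line of `G` towards `z` lowers its value at `z`. -/
lemma supportLine_anti (hη : Monotone η) (hpos : ∀ x, 0 < x → 0 < η x) (hc : 0 < c)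
    {s s' : ℝ≥0} {z : ℝ} (hs : 0 < s) (hss' : s ≤ s') (hz : (s' : ℝ) ≤ z) :
    bihariReal η c s' + (z - s') * (η s' : ℝ)⁻¹ ≤ bihariReal η c s + (z - s) * (η s : ℝ)⁻¹ := by
  have h1 := bihariReal_sub_le hη hpos hc (x := s) (y := s') (by exact_mod_cast hs)
    (by exact_mod_cast hs.trans_le hss')
  rw [Real.toNNReal_coe] at h1
  have h2 : (η s' : ℝ)⁻¹ ≤ (η s : ℝ)⁻¹ :=
    inv_anti₀ (by exact_mod_cast hpos s hs) (by exact_mod_cast hη hss')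
  have h3 := mul_le_mul_of_nonneg_left h2 (sub_nonneg.2 hz)
  linarith

lemma le_supportLine (hη : Monotone η) (hpos : ∀ x, 0 < x → 0 < η x) (hc : 0 < c)
    {s : ℝ≥0} {z : ℝ} (hs : 0 < s) (hz : 0 < z) :
    bihariReal η c z ≤ bihariReal η c s + (z - s) * (η s : ℝ)⁻¹ := by
  have h1 := bihariReal_sub_le hη hpos hc (x := s) (y := z) (by exact_mod_cast hs) hz
  rw [Real.toNNReal_coe] at h1
  linarith

/-- Discrete-time form of the estimate of `G(z_k)` by a transform of the increments of `z`. -/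
lemma bihariReal_le_sum_increments (hη : Monotone η) (hpos : ∀ x, 0 < x → 0 < η x) (hc : 0 < c)
    {s₀ : ℝ≥0} (hs₀ : 0 < s₀) {x : ℕ → ℝ≥0} {z : ℕ → ℝ} {k : ℕ} (hx : ∀ i < k, (x i : ℝ) ≤ z i)
    (hz : 0 < z k) :
    bihariReal η c (z k) ≤ bihariReal η c s₀ + (z 0 - s₀) * (η s₀ : ℝ)⁻¹ +
      ∑ i ∈ Finset.range k, (z (i + 1) - z i) * (η (gridMax s₀ x i) : ℝ)⁻¹ := by
  have hpos' : ∀ i, 0 < gridMax s₀ x i := fun i => hs₀.trans_le (le_gridMax _ _ _)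
  cases k with
  | zero => simpa using le_supportLine hη hpos hc hs₀ hz
  | succ k =>
    -- The invariant bounds the current supporting line at `z i`, not `G(z i)` itself. Advancing `z`
    -- along the same line costs exactly the increment times the slope; raising the contact point
    -- afterwards costs nothing because the new maximum is at most `z (i + 1)`. The bound on `G` is
    -- read off only at the end.
    have key : ∀ i ≤ k, bihariReal η c (gridMax s₀ x i) +
        (z i - gridMax s₀ x i) * (η (gridMax s₀ x i) : ℝ)⁻¹ ≤
        bihariReal η c s₀ + (z 0 - s₀) * (η s₀ : ℝ)⁻¹ +
          ∑ j ∈ Finset.range i, (z (j + 1) - z j) * (η (gridMax s₀ x j) : ℝ)⁻¹ := by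
      intro i hi
      induction i with
      | zero =>
        rw [Finset.sum_range_zero, add_zero]
        rcases le_total (x 0) s₀ with h | h
        · simp [gridMax, max_eq_left h]
        · simp only [gridMax, max_eq_right h]
          exact supportLine_anti hη hpos hc hs₀ h (hx 0 (by omega))
      | succ i ih =>
        have ih := ih (by omega)
        rw [Finset.sum_range_succ]
        have hstep : bihariReal η c (gridMax s₀ x (i + 1)) +
            (z (i + 1) - gridMax s₀ x (i + 1)) * (η (gridMax s₀ x (i + 1)) : ℝ)⁻¹ ≤
            bihariReal η c (gridMax s₀ x i) +
              (z (i + 1) - gridMax s₀ x i) * (η (gridMax s₀ x i) : ℝ)⁻¹ := by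
          rcases le_total (x (i + 1)) (gridMax s₀ x i) with h | h
          · simp [gridMax, max_eq_left h]
          · simp only [gridMax, max_eq_right h]
            exact supportLine_anti hη hpos hc (hpos' i) h (hx (i + 1) (by omega))
        linarith
    have h1 := key k le_rfl
    have h2 := le_supportLine hη hpos hc (hpos' k) hz
    rw [Finset.sum_range_succ]
    linarith

end Discrete

/-! ### Pathwise estimate along a refining grid -/

section Path

variable {η : ℝ≥0 → ℝ≥0} {c : ℝ≥0}

lemma pathMeasure_Ioc (a : ℝ≥0 → ℝ≥0) (hm : Monotone a) (hr : IsRightContPath a) (s t : ℝ≥0) :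
    pathMeasure a hm hr (Ioc s t) = ENNReal.ofReal (a t - a s) :=
  StieltjesFunction.measure_Ioc _ _ _

/-- The left-continuous running supremum of a single path. -/
noncomputable def pathSupLeft (x : ℝ≥0 → ℝ≥0) (t : ℝ≥0) : ℝ≥0∞ :=
  ⨆ s : ℝ≥0, ⨆ _ : s < t, (x s : ℝ≥0∞)

lemma pathSupLeft_mono (x : ℝ≥0 → ℝ≥0) : Monotone (pathSupLeft x) := fun _ _ h =>
  iSup_mono fun _ => iSup_mono' fun hs => ⟨hs.trans_le h, le_rfl⟩

lemma etaExt_mono (hη : Monotone η) : Monotone (etaExt η) := by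
  intro x y hxy
  rcases eq_or_ne y ⊤ with rfl | hy
  · rcases eq_or_ne x ⊤ with rfl | hx
    · exact le_rfl
    · simp only [etaExt, hx, if_false, if_true]
      exact le_iSup (fun u : ℝ≥0 => (η u : ℝ≥0∞)) x.toNNReal
  · have hx : x ≠ ⊤ := ne_top_of_le_ne_top hy hxy
    simp only [etaExt, hx, hy, if_false]
    exact_mod_cast hη (ENNReal.toNNReal_mono hy hxy)

lemma etaExt_coe (x : ℝ≥0) : etaExt η x = η x := by simp [etaExt]

/-- The uniform grid of mesh `1 / (n + 1)`. -/
noncomputable def gridPoint (n i : ℕ) : ℝ≥0 := (i : ℝ≥0) / (n + 1)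

lemma gridPoint_zero (n : ℕ) : gridPoint n 0 = 0 := by simp [gridPoint]

lemma gridPoint_mono (n : ℕ) : Monotone (gridPoint n) := by
  intro i j h; unfold gridPoint; gcongr

lemma gridPoint_lt_iff {n i : ℕ} {s : ℝ≥0} : gridPoint n i < s ↔ i < ⌈s * (n + 1)⌉₊ := by
  rw [gridPoint, div_lt_iff₀ (by positivity), Nat.lt_ceil]

lemma le_gridPoint_iff {n i : ℕ} {s : ℝ≥0} : s ≤ gridPoint n i ↔ ⌈s * (n + 1)⌉₊ ≤ i := by
  rw [← not_lt, gridPoint_lt_iff, not_lt]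

lemma gridPoint_ge (T n : ℕ) : (T : ℝ≥0) ≤ gridPoint n (T * (n + 1)) := by
  rw [gridPoint, le_div_iff₀ (by positivity)]; push_cast; exact le_rfl

lemma eventually_gridPoint_mem_Ico {r v : ℝ≥0} (h : r < v) :
    ∀ᶠ n : ℕ in atTop, ∃ j, gridPoint n j ∈ Ico r v := by
  have h1 : ∀ᶠ n : ℕ in atTop, 1 / ((n : ℝ≥0) + 1) < v - r :=
    (tendsto_one_div_add_atTop_nhds_zero_nat (𝕜 := ℝ≥0)).eventually
      (gt_mem_nhds (tsub_pos_of_lt h))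
  filter_upwards [h1] with n hn
  refine ⟨⌈r * (n + 1)⌉₊, le_gridPoint_iff.2 le_rfl, ?_⟩
  rw [gridPoint, div_lt_iff₀ (by positivity)]
  have h2 : ((⌈r * (n + 1)⌉₊ : ℕ) : ℝ≥0) < r * (n + 1) + 1 := Nat.ceil_lt_add_one (by positivity)
  refine h2.trans_le ?_
  have h3 : 1 ≤ (v - r) * ((n : ℝ≥0) + 1) := by
    rw [div_lt_iff₀ (by positivity)] at hn; exact hn.le
  calc r * (n + 1) + 1 ≤ r * (n + 1) + (v - r) * (n + 1) := by gcongr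
    _ = v * (n + 1) := by rw [← add_mul, add_tsub_cancel_of_le h.le]

lemma sum_lintegral_Ioc (μ : Measure ℝ≥0) (f : ℝ≥0 → ℝ≥0∞) {t : ℕ → ℝ≥0} (ht : Monotone t)
    (N : ℕ) : ∑ i ∈ Finset.range N, ∫⁻ s in Ioc (t i) (t (i + 1)), f s ∂μ =
      ∫⁻ s in Ioc (t 0) (t N), f s ∂μ := by
  induction N with
  | zero => simp
  | succ N ih =>
    rw [Finset.sum_range_succ, ih, ← lintegral_union measurableSet_Ioc,
      Ioc_union_Ioc_eq_Ioc (ht N.zero_le) (ht N.le_succ)]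
    exact Ioc_disjoint_Ioc_of_le le_rfl

/-- The running maxima of a shifted path along the grid of mesh `1 / (n + 1)`. -/
noncomputable def pathGridMax (s₀ ε : ℝ≥0) (x : ℝ≥0 → ℝ≥0) (n : ℕ) : ℕ → ℝ≥0 :=
  gridMax s₀ fun j => x (gridPoint n j) + ε

/-- The integral of `η(x*_-)` weighted by the slopes at the grid maxima. -/
noncomputable def weightedIntegral (η : ℝ≥0 → ℝ≥0) (s₀ ε : ℝ≥0) (x : ℝ≥0 → ℝ≥0)
    (μ : Measure ℝ≥0) (ρ : ℝ≥0) (n : ℕ) : ℝ≥0∞ :=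
  ∫⁻ s in Ioc 0 ρ, etaExt η (pathSupLeft x s) *
    (η (pathGridMax s₀ ε x n (⌈s * (n + 1)⌉₊ - 1)) : ℝ≥0∞)⁻¹ ∂μ

variable {s₀ ε ρ K : ℝ≥0} {x : ℝ≥0 → ℝ≥0} {μ : Measure ℝ≥0}

lemma measurable_weightedIntegrand (hη : Monotone η) (s₀ ε : ℝ≥0) (x : ℝ≥0 → ℝ≥0) (n : ℕ) :
    Measurable fun s : ℝ≥0 => etaExt η (pathSupLeft x s) *
      (η (pathGridMax s₀ ε x n (⌈s * (n + 1)⌉₊ - 1)) : ℝ≥0∞)⁻¹ := by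
  refine Measurable.mul ?_ ?_
  · exact ((etaExt_mono hη).comp (pathSupLeft_mono x)).measurable
  · exact (measurable_from_nat (f := fun k : ℕ =>
      (η (pathGridMax s₀ ε x n (k - 1)) : ℝ≥0∞)⁻¹)).comp
      (Nat.measurable_ceil.comp (measurable_id.mul_const _))

/-- A crude bound uniform in the grid. The grid maximum may lag behind the true supremum, so the
ratio can exceed `1` for a fixed mesh; this bound is what dominates in the limit. -/
lemma weightedIntegrand_le (hη : Monotone η) (hpos : ∀ x, 0 < x → 0 < η x) (hs₀ : 0 < s₀)
    (hK : ∀ s < ρ, x s ≤ K) (n : ℕ) {s : ℝ≥0} (hs : s ≤ ρ) :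
    etaExt η (pathSupLeft x s) * (η (pathGridMax s₀ ε x n (⌈s * (n + 1)⌉₊ - 1)) : ℝ≥0∞)⁻¹ ≤
      (η K / η s₀ : ℝ≥0) := by
  have h1 : etaExt η (pathSupLeft x s) ≤ η K := by
    rw [← etaExt_coe]
    exact etaExt_mono hη (iSup₂_le fun r hr => by exact_mod_cast hK r (hr.trans_le hs))
  have h2 : (η (pathGridMax s₀ ε x n (⌈s * (n + 1)⌉₊ - 1)) : ℝ≥0∞)⁻¹ ≤ (η s₀ : ℝ≥0∞)⁻¹ :=
    ENNReal.inv_le_inv.2 (by exact_mod_cast hη (le_gridMax _ _ _))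
  rw [ENNReal.coe_div (hpos _ hs₀).ne', div_eq_mul_inv]
  exact mul_le_mul' h1 h2

/-- Some earlier value plus `ε` strictly exceeds the supremum, and by right-continuity so do the
values on an interval to its right. A fine grid has a point in that interval before `s`, and then
the contact point has caught up with the supremum. -/
lemma eventually_weightedIntegrand_le_one (hη : Monotone η) (hε : 0 < ε) (hx : IsRightContPath x) (hK : ∀ s < ρ, x s ≤ K) {s : ℝ≥0}
    (hs0 : 0 < s) (hs : s ≤ ρ) :
    ∀ᶠ n : ℕ in atTop, etaExt η (pathSupLeft x s) *
      (η (pathGridMax s₀ ε x n (⌈s * (n + 1)⌉₊ - 1)) : ℝ≥0∞)⁻¹ ≤ 1 := by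
  have hfin : pathSupLeft x s ≤ K := iSup₂_le fun r hr => by exact_mod_cast hK r (hr.trans_le hs)
  obtain ⟨Y, hY⟩ : ∃ Y : ℝ≥0, (Y : ℝ≥0∞) = pathSupLeft x s :=
    ⟨_, ENNReal.coe_toNNReal (ne_top_of_le_ne_top ENNReal.coe_ne_top hfin)⟩
  obtain ⟨r, hrs, hr⟩ : ∃ r < s, Y < x r + ε := by
    by_contra! hcon
    have h1 : pathSupLeft x s ≤ (Y - ε : ℝ≥0) := iSup₂_le fun r hr => by
      exact_mod_cast le_tsub_of_add_le_right (hcon r hr)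
    rw [← hY] at h1
    have h2 : Y ≤ Y - ε := by exact_mod_cast h1
    have h3 : ε ≤ Y := le_of_add_le_right (hcon 0 hs0)
    exact absurd h2 (not_le.2 (tsub_lt_self (hε.trans_le h3) hε))
  have hnear : ∀ᶠ q in 𝓝[≥] r, Y < x q + ε := by
    have : ContinuousWithinAt (fun q => x q + ε) (Ici r) r := (hx r).add continuousWithinAt_const
    exact this.eventually (lt_mem_nhds hr)
  obtain ⟨v, hv, hsub⟩ := (mem_nhdsGE_iff_exists_Ico_subset).1 hnear
  filter_upwards [eventually_gridPoint_mem_Ico (lt_min hrs hv)] with n hn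
  obtain ⟨j, hj1, hj2⟩ := hn
  have h1 : Y < x (gridPoint n j) + ε := hsub ⟨hj1, hj2.trans_le (min_le_right _ _)⟩
  have h2 : j ≤ ⌈s * (n + 1)⌉₊ - 1 := by
    have := gridPoint_lt_iff.1 (hj2.trans_le (min_le_left _ _)); omega
  have h3 : Y ≤ pathGridMax s₀ ε x n (⌈s * (n + 1)⌉₊ - 1) :=
    h1.le.trans (apply_le_gridMax s₀ (fun j => x (gridPoint n j) + ε) h2)
  rw [← hY, etaExt_coe]
  have h4 : (η Y : ℝ≥0∞) ≤ η (pathGridMax s₀ ε x n (⌈s * (n + 1)⌉₊ - 1)) := by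
    exact_mod_cast hη h3
  rw [← div_eq_mul_inv]
  exact ENNReal.div_le_of_le_mul (by rwa [one_mul])

lemma weightedIntegral_le (hη : Monotone η) (hpos : ∀ x, 0 < x → 0 < η x) (hs₀ : 0 < s₀)
    (hK : ∀ s < ρ, x s ≤ K) (n : ℕ) :
    weightedIntegral η s₀ ε x μ ρ n ≤ (η K / η s₀ : ℝ≥0) * μ (Ioc 0 ρ) := by
  rw [← setLIntegral_const]
  exact setLIntegral_mono measurable_const fun s hs => weightedIntegrand_le hη hpos hs₀ hK n hs.2

lemma eventually_weightedIntegral_lt (hη : Monotone η) (hpos : ∀ x, 0 < x → 0 < η x)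
    (hs₀ : 0 < s₀) (hε : 0 < ε) (hx : IsRightContPath x) (hK : ∀ s < ρ, x s ≤ K)
    (hμ : μ (Ioc 0 ρ) ≠ ⊤) {d : ℝ≥0∞} (hd : μ (Ioc 0 ρ) < d) :
    ∀ᶠ n : ℕ in atTop, weightedIntegral η s₀ ε x μ ρ n < d := by
  -- The integrand itself need not converge; its maximum with `1` does, to the constant `1`, so
  -- dominated convergence applies.
  set F : ℕ → ℝ≥0 → ℝ≥0∞ := fun n s => max 1 (etaExt η (pathSupLeft x s) *
      (η (pathGridMax s₀ ε x n (⌈s * (n + 1)⌉₊ - 1)) : ℝ≥0∞)⁻¹) with hF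
  have hlim : Tendsto (fun n => ∫⁻ s in Ioc 0 ρ, F n s ∂μ) atTop
      (𝓝 (∫⁻ _ in Ioc 0 ρ, 1 ∂μ)) := by
    refine tendsto_lintegral_of_dominated_convergence
      (fun _ => max 1 ((η K / η s₀ : ℝ≥0) : ℝ≥0∞)) ?_ ?_ ?_ ?_
    · exact fun n => measurable_const.max (measurable_weightedIntegrand hη s₀ ε x n)
    · intro n
      filter_upwards [ae_restrict_mem measurableSet_Ioc] with s hs
      exact max_le_max le_rfl (weightedIntegrand_le hη hpos hs₀ hK n hs.2)
    · rw [setLIntegral_const]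
      exact ENNReal.mul_ne_top (by simp) hμ
    · filter_upwards [ae_restrict_mem measurableSet_Ioc] with s hs
      refine tendsto_const_nhds.congr' ?_
      filter_upwards [eventually_weightedIntegrand_le_one hη hε hx hK hs.1 hs.2] with n hn
      exact (max_eq_left hn).symm
  rw [setLIntegral_const, one_mul] at hlim
  filter_upwards [hlim.eventually (gt_mem_nhds hd)] with n hn
  exact (lintegral_mono fun s => le_max_right _ _).trans_lt hn

/-- The weighted sum of the increments of the integral of `η(x*_-)` over a grid. -/
lemma sum_increments_eq_weightedIntegral (s₀ ε : ℝ≥0) (n : ℕ) {N : ℕ}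
    (hN : ρ ≤ gridPoint n N) (hs₀ : 0 < s₀) (hη : Monotone η) (hpos : ∀ x, 0 < x → 0 < η x)
    (hfin : ∫⁻ s in Ioc 0 ρ, etaExt η (pathSupLeft x s) ∂μ ≠ ⊤) :
    ∑ i ∈ Finset.range N,
      ((∫⁻ s in Ioc 0 (min (gridPoint n (i + 1)) ρ), etaExt η (pathSupLeft x s) ∂μ).toReal -
        (∫⁻ s in Ioc 0 (min (gridPoint n i) ρ), etaExt η (pathSupLeft x s) ∂μ).toReal) *
          (η (pathGridMax s₀ ε x n i) : ℝ)⁻¹ =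
      (weightedIntegral η s₀ ε x μ ρ n).toReal := by
  set f : ℝ≥0 → ℝ≥0∞ := fun s => etaExt η (pathSupLeft x s) with hf
  set t : ℕ → ℝ≥0 := fun i => min (gridPoint n i) ρ with ht
  have htm : Monotone t := fun i j h => min_le_min (gridPoint_mono n h) le_rfl
  have ht0 : t 0 = 0 := by simp [ht, gridPoint_zero]
  have htN : t N = ρ := min_eq_right hN
  have hfm : Measurable f := ((etaExt_mono hη).comp (pathSupLeft_mono x)).measurable
  have hle : ∀ i, ∫⁻ s in Ioc 0 (t i), f s ∂μ ≠ ⊤ := fun i =>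
    ne_top_of_le_ne_top hfin (lintegral_mono_set (Ioc_subset_Ioc_right (min_le_right _ _)))
  have hpiece : ∀ i, ∫⁻ s in Ioc (t i) (t (i + 1)), f s *
      (η (pathGridMax s₀ ε x n (⌈s * (n + 1)⌉₊ - 1)) : ℝ≥0∞)⁻¹ ∂μ =
      (∫⁻ s in Ioc (t i) (t (i + 1)), f s ∂μ) * (η (pathGridMax s₀ ε x n i) : ℝ≥0∞)⁻¹ := by
    intro i
    rw [← lintegral_mul_const _ hfm]
    refine setLIntegral_congr_fun measurableSet_Ioc fun s hs => ?_
    have h1 : s ≤ gridPoint n (i + 1) := hs.2.trans (min_le_left _ _)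
    have h2 : gridPoint n i < s := by
      rcases min_lt_iff.1 hs.1 with h | h
      · exact h
      · exact absurd (hs.2.trans (min_le_right _ _)) (not_le.2 h)
    -- The integral runs over intervals open on the left, so the index active at `s` is that of the
    -- last grid point strictly before `s`.
    have h3 : ⌈s * (n + 1)⌉₊ - 1 = i := by
      have := gridPoint_lt_iff.1 h2
      have := le_gridPoint_iff.1 h1
      omega
    simp only [h3]
  have hsum := sum_lintegral_Ioc μ (fun s => f s *
    (η (pathGridMax s₀ ε x n (⌈s * (n + 1)⌉₊ - 1)) : ℝ≥0∞)⁻¹) htm N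
  rw [ht0, htN] at hsum
  rw [weightedIntegral, ← hsum, ENNReal.toReal_sum]
  · refine Finset.sum_congr rfl fun i _ => ?_
    rw [hpiece, ENNReal.toReal_mul, ENNReal.toReal_inv, ENNReal.coe_toReal]
    congr 1
    have hsplit : ∫⁻ s in Ioc 0 (t (i + 1)), f s ∂μ =
        ∫⁻ s in Ioc 0 (t i), f s ∂μ + ∫⁻ s in Ioc (t i) (t (i + 1)), f s ∂μ := by
      rw [← lintegral_union measurableSet_Ioc (Ioc_disjoint_Ioc_of_le le_rfl),
        Ioc_union_Ioc_eq_Ioc zero_le (htm i.le_succ)]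
    have hne : ∫⁻ s in Ioc (t i) (t (i + 1)), f s ∂μ ≠ ⊤ :=
      ne_top_of_le_ne_top (hle (i + 1)) (hsplit ▸ le_add_self)
    rw [hsplit, ENNReal.toReal_add (hle i) hne]
    ring
  · intro i _
    rw [hpiece]
    refine ENNReal.mul_ne_top ?_ (ENNReal.inv_ne_top.2 ?_)
    · exact ne_top_of_le_ne_top (hle (i + 1)) (lintegral_mono_set (Ioc_subset_Ioc_left zero_le))
    · exact_mod_cast (hpos _ (hs₀.trans_le (le_gridMax _ _ _))).ne'

/-- Pathwise estimate of `G(x_ρ + ε)` along a grid. -/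
lemma bihariReal_path_le (hη : Monotone η) (hpos : ∀ x, 0 < x → 0 < η x) (hc : 0 < c)
    (hs₀ : 0 < s₀) (hε : 0 < ε) {h : ℝ≥0 → ℝ≥0} (hh : Monotone h) {M : ℝ≥0 → ℝ} (hM : M 0 = 0)
    (hfin : ∫⁻ s in Ioc 0 ρ, etaExt η (pathSupLeft x s) ∂μ ≠ ⊤)
    (hineq : ∀ t ≤ ρ, (x t : ℝ) ≤
      (∫⁻ s in Ioc 0 t, etaExt η (pathSupLeft x s) ∂μ).toReal + M t + h t) (n : ℕ) {N : ℕ}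
    (hN : ρ ≤ gridPoint n N) :
    bihariReal η c (x ρ + ε) ≤ bihariReal η c s₀ + (h ρ + ε - s₀) * (η s₀ : ℝ)⁻¹ +
      (weightedIntegral η s₀ ε x μ ρ n).toReal +
      ∑ i ∈ Finset.range N, (η (pathGridMax s₀ ε x n i) : ℝ)⁻¹ *
        (M (min (gridPoint n (i + 1)) ρ) - M (min (gridPoint n i) ρ)) := by
  set I : ℝ≥0 → ℝ := fun t => (∫⁻ s in Ioc 0 t, etaExt η (pathSupLeft x s) ∂μ).toReal with hI
  set t : ℕ → ℝ≥0 := fun i => min (gridPoint n i) ρ with ht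
  set z : ℕ → ℝ := fun i => I (t i) + M (t i) + h (t i) + ε with hz
  have htm : Monotone t := fun i j h => min_le_min (gridPoint_mono n h) le_rfl
  have ht0 : t 0 = 0 := by simp [ht, gridPoint_zero]
  have htN : t N = ρ := min_eq_right hN
  have hI0 : I 0 = 0 := by simp [hI]
  set k := ⌈ρ * (n + 1)⌉₊ with hk
  have hkN : k ≤ N := le_gridPoint_iff.1 hN
  have hconst : ∀ i, k ≤ i → t i = ρ := fun i hi => min_eq_right (le_gridPoint_iff.2 hi)
  have hzρ : (x ρ : ℝ) + ε ≤ z k := by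
    have := hineq ρ le_rfl
    simp only [hz, hconst k le_rfl]
    linarith
  have hε' : (0 : ℝ) < ε := by exact_mod_cast hε
  have hxpos : (0 : ℝ) < x ρ + ε := by positivity
  have hmain := bihariReal_le_sum_increments hη hpos hc hs₀
    (x := fun j => x (gridPoint n j) + ε) (z := z) (k := k) (fun i hi => by
      have h1 : gridPoint n i < ρ := gridPoint_lt_iff.2 hi
      have h2 : t i = gridPoint n i := min_eq_left h1.le
      have h3 := hineq _ h1.le
      simp only [hz, h2]
      push_cast
      linarith) (hxpos.trans_le hzρ)
  -- Beyond index `k` the stopped grid is constant, so the increments vanish. The sum can thus be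
  -- extended to a range independent of the path, although the slopes there look past `ρ`.
  have hext : ∑ i ∈ Finset.range k, (z (i + 1) - z i) * (η (pathGridMax s₀ ε x n i) : ℝ)⁻¹ =
      ∑ i ∈ Finset.range N, (z (i + 1) - z i) * (η (pathGridMax s₀ ε x n i) : ℝ)⁻¹ := by
    refine Finset.sum_subset (Finset.range_mono hkN) fun i _ hi => ?_
    have hi' : k ≤ i := by simpa using hi
    simp [hz, hconst i hi', hconst (i + 1) (hi'.trans i.le_succ)]
  have hH : ∑ i ∈ Finset.range N, ((h (t (i + 1)) : ℝ) - h (t i)) *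
      (η (pathGridMax s₀ ε x n i) : ℝ)⁻¹ ≤ (h ρ - h 0) * (η s₀ : ℝ)⁻¹ := by
    calc _ ≤ ∑ i ∈ Finset.range N, ((h (t (i + 1)) : ℝ) - h (t i)) * (η s₀ : ℝ)⁻¹ := by
          refine Finset.sum_le_sum fun i _ => mul_le_mul_of_nonneg_left ?_ ?_
          · exact inv_anti₀ (by exact_mod_cast hpos s₀ hs₀)
              (by exact_mod_cast hη (le_gridMax _ _ _))
          · rw [sub_nonneg]; exact_mod_cast hh (htm i.le_succ)
      _ = _ := by
          rw [← Finset.sum_mul, Finset.sum_range_sub (fun i => (h (t i) : ℝ)), htN, ht0]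
  have hIsum := sum_increments_eq_weightedIntegral s₀ ε n hN hs₀ hη hpos hfin
  have hsplit : ∑ i ∈ Finset.range N, (z (i + 1) - z i) * (η (pathGridMax s₀ ε x n i) : ℝ)⁻¹ =
      ∑ i ∈ Finset.range N, (I (t (i + 1)) - I (t i)) * (η (pathGridMax s₀ ε x n i) : ℝ)⁻¹ +
      ∑ i ∈ Finset.range N, ((h (t (i + 1)) : ℝ) - h (t i)) *
        (η (pathGridMax s₀ ε x n i) : ℝ)⁻¹ +
      ∑ i ∈ Finset.range N, (η (pathGridMax s₀ ε x n i) : ℝ)⁻¹ *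
        (M (t (i + 1)) - M (t i)) := by
    rw [← Finset.sum_add_distrib, ← Finset.sum_add_distrib]
    refine Finset.sum_congr rfl fun i _ => ?_
    simp only [hz]
    ring
  have hmono := bihariReal_mono hη hpos hc hxpos hzρ
  have hz0 : z 0 = h 0 + ε := by simp [hz, ht0, hI0, hM]
  change _ = (weightedIntegral η s₀ ε x μ ρ n).toReal at hIsum
  change bihariReal η c (z k) ≤ _ + _ +
    ∑ i ∈ Finset.range k, (z (i + 1) - z i) * (η (pathGridMax s₀ ε x n i) : ℝ)⁻¹ at hmain
  rw [hext, hsplit, hz0] at hmain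
  have hring : ((h 0 : ℝ) + ε - s₀) * (η s₀ : ℝ)⁻¹ + (h ρ - h 0) * (η s₀ : ℝ)⁻¹ =
    (h ρ + ε - s₀) * (η s₀ : ℝ)⁻¹ := by ring
  linarith

end Path

/-! ### The expectation estimate for bounded paths and a true martingale -/

section Core

variable {Ω : Type*} {m : MeasurableSpace Ω} {P : Measure Ω} {𝓕 : Filtration ℝ≥0 m}
  {η : ℝ≥0 → ℝ≥0} {X A H : ℝ≥0 → Ω → ℝ≥0} {M : ℝ≥0 → Ω → ℝ} {c : ℝ≥0}

lemma integrable_coe_of_lintegral_le {f : Ω → ℝ≥0} (hf : Measurable f) {a : ℝ≥0}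
    (h : ∫⁻ ω, (f ω : ℝ≥0∞) ∂P ≤ a) :
    Integrable (fun ω => (f ω : ℝ)) P ∧ ∫ ω, (f ω : ℝ) ∂P ≤ a := by
  have hi : Integrable (fun ω => (f ω : ℝ)) P := by
    refine ⟨hf.coe_nnreal_real.aestronglyMeasurable, ?_⟩
    rw [hasFiniteIntegral_iff_ofNNReal]
    exact h.trans_lt ENNReal.coe_lt_top
  refine ⟨hi, ?_⟩
  rw [integral_eq_lintegral_of_nonneg_ae (f := fun ω => (f ω : ℝ)) (ae_of_all _ fun ω => (f ω).2)
    hf.coe_nnreal_real.aestronglyMeasurable]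
  simp only [ENNReal.ofReal_coe_nnreal]
  exact ENNReal.toReal_le_coe_of_le_coe h

lemma IsRightContPath.exists_bound_right {x : ℝ≥0 → ℝ≥0} (hx : IsRightContPath x) {t K : ℝ≥0}
    (hK : ∀ s < t, x s ≤ K) : ∃ v > t, ∀ s < v, x s ≤ max K (x t + 1) := by
  have h1 : ∀ᶠ s in 𝓝[≥] t, x s < x t + 1 := (hx t).eventually (gt_mem_nhds (by simp))
  obtain ⟨v, hv, hsub⟩ := (mem_nhdsGE_iff_exists_Ico_subset).1 h1
  refine ⟨v, hv, fun s hs => ?_⟩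
  rcases lt_or_ge s t with h | h
  · exact (hK s h).trans (le_max_left _ _)
  · exact (hsub ⟨h, hs⟩ : x s < x t + 1).le.trans (le_max_right _ _)

lemma lintegral_etaExt_le (hη : Monotone η) {x : ℝ≥0 → ℝ≥0} {K s t : ℝ≥0}
    (hK : ∀ r < t, x r ≤ K) (μ : Measure ℝ≥0) :
    ∫⁻ r in Ioc s t, etaExt η (pathSupLeft x r) ∂μ ≤ η K * μ (Ioc s t) := by
  rw [← setLIntegral_const]
  refine setLIntegral_mono measurable_const fun r hr => ?_
  rw [← etaExt_coe]
  exact etaExt_mono hη (iSup₂_le fun q hq => by exact_mod_cast hK q (hq.trans_le hr.2))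

/-- Up to explosion of `X`, the defining inequality holds simultaneously at all times. -/
lemma AssumptionSup.ae_forall_le (h : AssumptionSup 𝓕 P η X A H M) :
    ∀ᵐ ω ∂P, ∀ t K : ℝ≥0, (∀ s < t, X s ω ≤ K) →
      ∫⁻ s in Ioc 0 t, etaExt η (pathSupLeft (fun r => X r ω) s)
        ∂(pathMeasure (fun r => A r ω) (h.A_mono ω) (h.A_cadlag ω).1) ≠ ⊤ ∧
      (X t ω : ℝ) ≤ (∫⁻ s in Ioc 0 t, etaExt η (pathSupLeft (fun r => X r ω) s)
        ∂(pathMeasure (fun r => A r ω) (h.A_mono ω) (h.A_cadlag ω).1)).toReal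
          + M t ω + H t ω := by
  obtain ⟨D, hDc, hDd⟩ := TopologicalSpace.exists_countable_dense ℝ≥0
  have hae : ∀ᵐ ω ∂P, ∀ q ∈ D, ((X q ω : ℝ) : EReal) ≤
      ((∫⁻ s in Ioc 0 q, etaExt η (runSupLeft X s ω)
        ∂(pathMeasure (fun r => A r ω) (h.A_mono ω) (h.A_cadlag ω).1) : ℝ≥0∞) : EReal)
        + ((M q ω + (H q ω : ℝ) : ℝ) : EReal) :=
    (ae_ball_iff hDc).2 fun q _ => h.inequality q
  filter_upwards [hae] with ω hω t K hK
  set μ := pathMeasure (fun r => A r ω) (h.A_mono ω) (h.A_cadlag ω).1 with hμ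
  set f : ℝ≥0 → ℝ≥0∞ := fun s => etaExt η (pathSupLeft (fun r => X r ω) s) with hf
  obtain ⟨v, htv, hv⟩ := (h.X_right_cont ω).exists_bound_right hK
  set C := max K (X t ω + 1) with hC
  have hμI : ∀ s r : ℝ≥0, μ (Ioc s r) = ENNReal.ofReal (A r ω - A s ω) :=
    fun s r => pathMeasure_Ioc _ _ _ s r
  have hbd : ∀ s r : ℝ≥0, r ≤ v → ∫⁻ q in Ioc s r, f q ∂μ ≤
      η C * ENNReal.ofReal (A r ω - A s ω) := by
    intro s r hr
    rw [← hμI]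
    exact lintegral_etaExt_le h.eta_mono (fun q hq => hv q (hq.trans_le hr)) μ
  have hne : ∀ s r : ℝ≥0, r ≤ v → ∫⁻ q in Ioc s r, f q ∂μ ≠ ⊤ := fun s r hr =>
    ne_top_of_le_ne_top (ENNReal.mul_ne_top ENNReal.coe_ne_top ENNReal.ofReal_ne_top) (hbd s r hr)
  refine ⟨hne 0 t htv.le, ?_⟩
  -- The exceptional null set is chosen for countably many times only. For other times one
  -- approaches from the right, where `X` remains bounded by `C`, so the extra integral is at most
  -- `η(C)` times an increment of `A`, which tends to `0`.
  have hq : ∀ q ∈ D, t < q → q < v → (X q ω : ℝ) - (η C * (A q ω - A t ω) + M q ω + H q ω) ≤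
      (∫⁻ s in Ioc 0 t, f s ∂μ).toReal := by
    intro q hqD htq hqv
    have h1 := hω q hqD
    change ((X q ω : ℝ) : EReal) ≤ ((∫⁻ s in Ioc 0 q, f s ∂μ : ℝ≥0∞) : EReal) + _ at h1
    rw [← EReal.coe_ennreal_toReal (hne 0 q hqv.le), ← EReal.coe_add, EReal.coe_le_coe_iff] at h1
    have h2 : ∫⁻ s in Ioc 0 q, f s ∂μ = ∫⁻ s in Ioc 0 t, f s ∂μ + ∫⁻ s in Ioc t q, f s ∂μ := by
      rw [← lintegral_union measurableSet_Ioc (Ioc_disjoint_Ioc_of_le le_rfl),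
        Ioc_union_Ioc_eq_Ioc zero_le htq.le]
    have hA : (A t ω : ℝ) ≤ A q ω := by exact_mod_cast h.A_mono ω htq.le
    have h3 : (∫⁻ s in Ioc t q, f s ∂μ).toReal ≤ η C * (A q ω - A t ω) := by
      have := ENNReal.toReal_mono (ENNReal.mul_ne_top ENNReal.coe_ne_top ENNReal.ofReal_ne_top)
        (hbd t q hqv.le)
      rwa [ENNReal.toReal_mul, ENNReal.coe_toReal, ENNReal.toReal_ofReal (sub_nonneg.2 hA)] at this
    rw [h2, ENNReal.toReal_add (hne 0 t htv.le) (hne t q hqv.le)] at h1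
    linarith
  have hrc : ∀ {Y : ℝ≥0 → ℝ}, IsRightContPath Y → Tendsto Y (𝓝[>] t) (𝓝 (Y t)) := fun hY =>
    ((hY t).mono Ioi_subset_Ici_self).tendsto
  have hcoe : ∀ {Y : ℝ≥0 → ℝ≥0}, IsRightContPath Y → IsRightContPath fun s => (Y s : ℝ) :=
    fun hY s => NNReal.continuous_coe.continuousAt.comp_continuousWithinAt (hY s)
  have hlim : Tendsto (fun q => (X q ω : ℝ) - (η C * (A q ω - A t ω) + M q ω + H q ω)) (𝓝[>] t)
      (𝓝 ((X t ω : ℝ) - (η C * (A t ω - A t ω) + M t ω + H t ω))) :=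
    (hrc (hcoe (h.X_right_cont ω))).sub
      ((((tendsto_const_nhds.mul ((hrc (hcoe (h.A_cadlag ω).1)).sub tendsto_const_nhds))).add
        (hrc (h.M_local_martingale.cadlag ω).1)).add (hrc (hcoe (h.H_cadlag ω).1)))
  have hfreq : ∃ᶠ q in 𝓝[>] t, (X q ω : ℝ) - (η C * (A q ω - A t ω) + M q ω + H q ω) ≤
      (∫⁻ s in Ioc 0 t, f s ∂μ).toReal := by
    rw [frequently_iff]
    intro U hU
    obtain ⟨w, hw, hsub⟩ := (mem_nhdsGT_iff_exists_Ioo_subset).1 hU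
    obtain ⟨q, hqD, hq1, hq2⟩ := hDd.exists_between (lt_min hw htv)
    exact ⟨q, hsub ⟨hq1, hq2.trans_le (min_le_left _ _)⟩,
      hq q hqD hq1 (hq2.trans_le (min_le_right _ _))⟩
  have := le_of_tendsto_of_frequently hlim hfreq
  rw [sub_self, mul_zero, zero_add] at this
  linarith

lemma AssumptionSup.measurable_X (h : AssumptionSup 𝓕 P η X A H M) (t : ℝ≥0) :
    Measurable (X t) := ((h.X_adapted t).mono (𝓕.le t)).measurable

lemma AssumptionSup.measurable_A (h : AssumptionSup 𝓕 P η X A H M) (t : ℝ≥0) :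
    Measurable (A t) := ((h.A_predictable.stronglyAdapted t).mono (𝓕.le t)).measurable

lemma AssumptionSup.measurable_H (h : AssumptionSup 𝓕 P η X A H M) (t : ℝ≥0) :
    Measurable (H t) := ((h.H_adapted t).mono (𝓕.le t)).measurable

/-- The slope applied to an increment is known at its left end point; this is what makes the `M`-sum
a martingale transform. -/
lemma AssumptionSup.measurable_slope (h : AssumptionSup 𝓕 P η X A H M) (s₀ ε : ℝ≥0) (n i : ℕ) :
    StronglyMeasurable[𝓕 (gridPoint n i)] fun ω =>
      (η (pathGridMax s₀ ε (fun r => X r ω) n i) : ℝ)⁻¹ := by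
  have hmax : ∀ j ≤ i, Measurable[𝓕 (gridPoint n i)] fun ω =>
      pathGridMax s₀ ε (fun r => X r ω) n j := by
    have hX : ∀ j ≤ i, Measurable[𝓕 (gridPoint n i)] fun ω => X (gridPoint n j) ω + ε := by
      intro j hj
      have := ((h.X_adapted (gridPoint n j)).mono (𝓕.mono (gridPoint_mono n hj))).measurable
      exact (measurable_id.add_const ε).comp this
    intro j hj
    induction j with
    | zero => exact measurable_const.max (hX 0 hj)
    | succ j ih => exact (ih (by omega)).max (hX (j + 1) hj)
  exact ((h.eta_mono.measurable.comp (hmax i le_rfl)).coe_nnreal_real.inv).stronglyMeasurable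

/-- The estimate of `E[G(X_ρ + ε)]` for a stopping time `ρ` up to which `X` is bounded and `M` is a
martingale. -/
lemma AssumptionSup.integral_bihariReal_le_of_bounded [IsProbabilityMeasure P]
    (h : AssumptionSup 𝓕 P η X A H M) (hc : 0 < c) {ρ : Ω → ℝ≥0}
    (hρ : IsFiniteStoppingTime 𝓕 ρ) {T K : ℝ≥0} (hT : ∀ ω, ρ ω ≤ T)
    (hK : ∀ ω, ∀ s < ρ ω, X s ω ≤ K) {N : ℝ≥0 → Ω → ℝ} (hN : Martingale N 𝓕 P)
    (hNr : ∀ ω, IsRightContPath fun t => N t ω)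
    (hMN : ∀ t ω, M (min t (ρ ω)) ω = N (min t (ρ ω)) ω) {a b ε : ℝ≥0}
    (ha : ∫⁻ ω, (A (ρ ω) ω : ℝ≥0∞) ∂P ≤ a) (hb : ∫⁻ ω, (H (ρ ω) ω : ℝ≥0∞) ∂P ≤ b)
    (hε : 0 < ε) :
    Integrable (fun ω => bihariReal η c (X (ρ ω) ω + ε)) P ∧
      ∫ ω, bihariReal η c (X (ρ ω) ω + ε) ∂P ≤ a + bihariReal η c (b + ε) := by
  have hη := h.eta_mono
  have hpos := h.eta_pos
  have hρm := hρ.measurable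
  -- The initial contact point is chosen so that the linear term `(H + ε - s₀) / η(s₀)` has
  -- non-positive mean, leaving only `G(b + ε)`.
  set s₀ : ℝ≥0 := b + ε with hs₀def
  have hs₀ : 0 < s₀ := by positivity
  set g₀ : ℝ := (η s₀ : ℝ)⁻¹ with hg₀
  have hg₀pos : 0 ≤ g₀ := by positivity
  have hXρ : Measurable fun ω => X (ρ ω) ω :=
    measurable_eval_of_rightCont h.measurable_X h.X_right_cont hρm
  have hAρ : Measurable fun ω => A (ρ ω) ω :=
    measurable_eval_of_rightCont h.measurable_A (fun ω => (h.A_cadlag ω).1) hρm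
  have hHρ : Measurable fun ω => H (ρ ω) ω :=
    measurable_eval_of_rightCont h.measurable_H (fun ω => (h.H_cadlag ω).1) hρm
  obtain ⟨hAi, hAle⟩ := integrable_coe_of_lintegral_le hAρ ha
  obtain ⟨hHi, hHle⟩ := integrable_coe_of_lintegral_le hHρ hb
  set Y : Ω → ℝ := fun ω => bihariReal η c (X (ρ ω) ω + ε) with hY
  have hε' : (0 : ℝ) < ε := by exact_mod_cast hε
  have hYm : Measurable Y := by
    have hmono : Monotone fun x : ℝ≥0 => bihariReal η c ((x : ℝ) + ε) := fun x y hxy =>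
      bihariReal_mono hη hpos hc (by positivity) (by gcongr)
    exact hmono.measurable.comp hXρ
  set Nn : ℕ → ℕ := fun n => ⌈T⌉₊ * (n + 1) with hNn
  have hNnle : ∀ n ω, ρ ω ≤ gridPoint n (Nn n) := fun n ω =>
    (hT ω).trans ((Nat.le_ceil T).trans (gridPoint_ge _ n))
  set φ : ℕ → ℕ → Ω → ℝ := fun n i ω => (η (pathGridMax s₀ ε (fun r => X r ω) n i) : ℝ)⁻¹ with hφ
  have hφle : ∀ n i ω, |φ n i ω| ≤ g₀ := by
    intro n i ω
    rw [abs_of_nonneg (by positivity)]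
    exact inv_anti₀ (by exact_mod_cast hpos s₀ hs₀) (by exact_mod_cast hη (le_gridMax _ _ _))
  set mart : ℕ → Ω → ℝ := fun n ω => ∑ i ∈ Finset.range (Nn n), φ n i ω *
      (N (min (gridPoint n (i + 1)) (ρ ω)) ω - N (min (gridPoint n i) (ρ ω)) ω) with hmart
  have hterm : ∀ n i, _ := fun n i => Martingale.integral_mul_increment_eq_zero hN hNr hρ
    (gridPoint_mono n i.le_succ) (h.measurable_slope s₀ ε n i) (hφle n i)
  have hmart_int : ∀ n, Integrable (mart n) P := fun n =>
    integrable_finsetSum _ fun i _ => (hterm n i).1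
  have hmart_zero : ∀ n, ∫ ω, mart n ω ∂P = 0 := fun n => by
    rw [hmart, integral_finsetSum _ fun i _ => (hterm n i).1]
    exact Finset.sum_eq_zero fun i _ => (hterm n i).2
  -- Used only in pointwise comparisons and never integrated over `Ω`, so no measurability in `ω` is
  -- required.
  set J : ℕ → Ω → ℝ := fun n ω => (weightedIntegral η s₀ ε (fun r => X r ω)
    (pathMeasure (fun r => A r ω) (h.A_mono ω) (h.A_cadlag ω).1) (ρ ω) n).toReal with hJ
  have hμI : ∀ ω, pathMeasure (fun r => A r ω) (h.A_mono ω) (h.A_cadlag ω).1 (Ioc 0 (ρ ω)) =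
      (A (ρ ω) ω : ℝ≥0∞) := by
    intro ω
    rw [pathMeasure_Ioc, h.A_zero, NNReal.coe_zero, sub_zero, ENNReal.ofReal_coe_nnreal]
  set C : ℝ := ((η K / η s₀ : ℝ≥0) : ℝ) with hC
  have hJle : ∀ n ω, J n ω ≤ C * A (ρ ω) ω := by
    intro n ω
    have := weightedIntegral_le hη hpos hs₀ (ε := ε) (hK ω)
      (μ := pathMeasure (fun r => A r ω) (h.A_mono ω) (h.A_cadlag ω).1) n
    rw [hμI, ← ENNReal.coe_mul] at this
    exact (ENNReal.toReal_le_coe_of_le_coe this).trans_eq (NNReal.coe_mul _ _)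
  have hJev : ∀ ω, ∀ d > 0, ∀ᶠ n in atTop, J n ω < A (ρ ω) ω + d := by
    intro ω d hd
    have := eventually_weightedIntegral_lt hη hpos hs₀ hε (h.X_right_cont ω) (hK ω)
      (μ := pathMeasure (fun r => A r ω) (h.A_mono ω) (h.A_cadlag ω).1)
      (by rw [hμI]; exact ENNReal.coe_ne_top) (d := ENNReal.ofReal (A (ρ ω) ω + d)) (by
        rw [hμI, ← ENNReal.ofReal_coe_nnreal]
        exact (ENNReal.ofReal_lt_ofReal_iff (by positivity)).2 (by linarith))
    filter_upwards [this] with n hn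
    exact ENNReal.toReal_lt_of_lt_ofReal hn
  have hpath : ∀ᵐ ω ∂P, ∀ n, Y ω ≤
      bihariReal η c s₀ + (H (ρ ω) ω + ε - s₀) * g₀ + J n ω + mart n ω := by
    filter_upwards [h.ae_forall_le] with ω hω n
    have h1 := bihariReal_path_le hη hpos hc hs₀ hε (h.H_mono ω) (M := fun t => M t ω)
      (h.M_local_martingale.zero ω) (hω (ρ ω) K (hK ω)).1
      (fun t ht => (hω t K fun s hs => hK ω s (hs.trans_le ht)).2) n (hNnle n ω)
    simp only [hMN] at h1
    exact h1
  have hYlow : ∀ ω, bihariReal η c ε ≤ Y ω := fun ω =>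
    bihariReal_mono hη hpos hc hε' (by simp)
  have hHint : Integrable (fun ω => bihariReal η c s₀ + (H (ρ ω) ω + ε - s₀) * g₀) P :=
    (integrable_const _).add
      (((hHi.add (integrable_const _)).sub (integrable_const _)).mul_const _)
  have hYi : Integrable Y P := by
    have hB : Integrable (fun ω => bihariReal η c s₀ + (H (ρ ω) ω + ε - s₀) * g₀ +
        C * A (ρ ω) ω + mart 0 ω) P := (hHint.add (hAi.const_mul _)).add (hmart_int 0)
    refine ((integrable_const |bihariReal η c ε|).add hB.abs).mono'
      hYm.aestronglyMeasurable ?_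
    filter_upwards [hpath] with ω hω
    have h1 := hω 0
    have h2 := hJle 0 ω
    have h3 := hYlow ω
    simp only [Pi.add_apply, Real.norm_eq_abs]
    rw [abs_le]
    constructor
    · linarith [neg_abs_le (bihariReal η c ε), abs_nonneg (bihariReal η c s₀ +
        (H (ρ ω) ω + ε - s₀) * g₀ + C * A (ρ ω) ω + mart 0 ω)]
    · linarith [abs_nonneg (bihariReal η c ε), le_abs_self (bihariReal η c s₀ +
        (H (ρ ω) ω + ε - s₀) * g₀ + C * A (ρ ω) ω + mart 0 ω)]
  refine ⟨hYi, ?_⟩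
  -- The `M`-sums need not converge pathwise, but they have mean zero. Moving them to the left gives
  -- variables whose mean does not depend on `n` and which are bounded by `J n`.
  set f : ℕ → Ω → ℝ := fun n ω =>
    Y ω - (bihariReal η c s₀ + (H (ρ ω) ω + ε - s₀) * g₀) - mart n ω with hf
  have hfi : ∀ n, Integrable (f n) P := fun n => (hYi.sub hHint).sub (hmart_int n)
  have hfint : ∀ n, ∫ ω, f n ω ∂P =
      ∫ ω, Y ω ∂P - ∫ ω, (bihariReal η c s₀ + (H (ρ ω) ω + ε - s₀) * g₀) ∂P := by
    intro n
    rw [hf, integral_sub (f := fun ω => Y ω - (bihariReal η c s₀ + (H (ρ ω) ω + ε - s₀) * g₀))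
      (hYi.sub hHint) (hmart_int n), hmart_zero n, sub_zero, integral_sub hYi hHint]
  have hfJ : ∀ᵐ ω ∂P, ∀ n, f n ω ≤ J n ω := by
    filter_upwards [hpath] with ω hω n
    have := hω n
    simp only [hf]; linarith
  -- The excess of `f n` over `A` tends to `0` pointwise and is dominated by `C * A`; its mean
  -- bounds a quantity free of `n`, which is therefore non-positive.
  set D : ℕ → Ω → ℝ := fun n ω => max (f n ω - A (ρ ω) ω) 0 with hD
  have hDi : ∀ n, Integrable (D n) P := fun n => ((hfi n).sub hAi).pos_part
  have hDlim : Tendsto (fun n => ∫ ω, D n ω ∂P) atTop (𝓝 (∫ _, (0 : ℝ) ∂P)) := by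
    refine tendsto_integral_of_dominated_convergence (fun ω => C * A (ρ ω) ω)
      (fun n => (hDi n).1) (hAi.const_mul C) ?_ ?_
    · intro n
      filter_upwards [hfJ] with ω hω
      have h1 := hω n
      have h2 := hJle n ω
      have h3 : (0 : ℝ) ≤ A (ρ ω) ω := (A (ρ ω) ω).2
      have h4 : 0 ≤ C * A (ρ ω) ω := mul_nonneg (NNReal.coe_nonneg _) h3
      rw [Real.norm_eq_abs, abs_of_nonneg (le_max_right _ _)]
      exact max_le (by linarith) h4
    · filter_upwards [hfJ] with ω hω
      rw [Metric.tendsto_atTop']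
      intro d hd
      obtain ⟨n₀, hn₀⟩ := eventually_atTop.1 (hJev ω d hd)
      refine ⟨n₀, fun n hn => ?_⟩
      have h1 := hω n
      have h2 := hn₀ n hn.le
      rw [Real.dist_eq, sub_zero, abs_of_nonneg (le_max_right _ _)]
      exact max_lt (by linarith) hd
  have hfinal : ∀ n, ∫ ω, Y ω ∂P - ∫ ω, (bihariReal η c s₀ + (H (ρ ω) ω + ε - s₀) * g₀) ∂P -
      ∫ ω, (A (ρ ω) ω : ℝ) ∂P ≤ ∫ ω, D n ω ∂P := by
    intro n
    rw [← hfint n, ← integral_sub (hfi n) hAi]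
    exact integral_mono ((hfi n).sub hAi) (hDi n) fun ω => le_max_left _ _
  have h1 := ge_of_tendsto' hDlim hfinal
  rw [integral_zero] at h1
  have h2 : ∫ ω, (bihariReal η c s₀ + (H (ρ ω) ω + ε - s₀) * g₀) ∂P ≤ bihariReal η c s₀ := by
    have h3 : ∫ ω, (bihariReal η c s₀ + (H (ρ ω) ω + ε - s₀) * g₀) ∂P =
        bihariReal η c s₀ + (∫ ω, (H (ρ ω) ω : ℝ) ∂P + ε - s₀) * g₀ := by
      have h6 : (fun ω => bihariReal η c s₀ + ((H (ρ ω) ω : ℝ) + ε - s₀) * g₀) =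
          fun ω => (bihariReal η c s₀ + (ε - s₀) * g₀) + H (ρ ω) ω * g₀ := by
        ext ω; ring
      rw [h6, integral_add (integrable_const _) (hHi.mul_const _), integral_mul_const,
        integral_const, probReal_univ, one_smul]
      ring
    rw [h3]
    have h4 : (∫ ω, (H (ρ ω) ω : ℝ) ∂P + ε - s₀) ≤ 0 := by
      rw [hs₀def]; push_cast; linarith
    nlinarith [mul_nonneg (neg_nonneg.2 h4) hg₀pos]
  have h5 : bihariReal η c s₀ = bihariReal η c (b + ε) := by rw [hs₀def, NNReal.coe_add]
  linarith

end Core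

/-! ### First passage times of a right-continuous process -/

section Hitting

variable {Ω : Type*} {m : MeasurableSpace Ω} {P : Measure Ω} {𝓕 : Filtration ℝ≥0 m}
  {X : ℝ≥0 → Ω → ℝ≥0}

/-- The first time before `T` at which `X` exceeds `K`, and `T` if there is none. -/
noncomputable def hitAbove (X : ℝ≥0 → Ω → ℝ≥0) (K T : ℝ≥0) (ω : Ω) : ℝ≥0 :=
  sInf ({t | K < X t ω} ∪ Ici T)

lemma hitAbove_le (X : ℝ≥0 → Ω → ℝ≥0) (K T : ℝ≥0) (ω : Ω) : hitAbove X K T ω ≤ T :=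
  csInf_le (OrderBot.bddBelow _) (Or.inr self_mem_Ici)

lemma hitAbove_le_of_lt {K T t : ℝ≥0} {ω : Ω} (h : K < X t ω) : hitAbove X K T ω ≤ t :=
  csInf_le (OrderBot.bddBelow _) (Or.inl h)

lemma le_of_lt_hitAbove {K T t : ℝ≥0} {ω : Ω} (h : t < hitAbove X K T ω) : X t ω ≤ K := by
  by_contra hcon
  exact not_le.2 h (hitAbove_le_of_lt (not_le.1 hcon))

lemma hitAbove_lt_iff {K T t : ℝ≥0} {ω : Ω} :
    hitAbove X K T ω < t ↔ (∃ s < t, K < X s ω) ∨ T < t := by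
  constructor
  · intro h
    obtain ⟨s, hs | hs, hst⟩ := exists_lt_of_csInf_lt ⟨T, Or.inr self_mem_Ici⟩ h
    · exact Or.inl ⟨s, hst, hs⟩
    · exact Or.inr (lt_of_le_of_lt hs hst)
  · rintro (⟨s, hst, hs⟩ | h)
    · exact (hitAbove_le_of_lt hs).trans_lt hst
    · exact (hitAbove_le _ _ _ _).trans_lt h

/-- The strict inequality may fail at the infimum itself; right-continuity preserves only the
non-strict one, which is all the tail estimates need. -/
lemma le_apply_hitAbove (hX : ∀ ω, IsRightContPath fun t => X t ω) {K T : ℝ≥0} {ω : Ω}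
    (h : ∃ t ≤ T, K < X t ω) : K ≤ X (hitAbove X K T ω) ω := by
  obtain ⟨t, htT, ht⟩ := h
  by_contra! hcon
  set r := hitAbove X K T ω with hr
  have hrt : r ≤ t := hitAbove_le_of_lt ht
  have hlt : r < t := lt_of_le_of_ne hrt fun h => by rw [h] at hcon; exact lt_asymm ht hcon
  have h1 : ∀ᶠ s in 𝓝[≥] r, X s ω < K := (hX ω r).eventually (gt_mem_nhds hcon)
  obtain ⟨v, hv, hsub⟩ := (mem_nhdsGE_iff_exists_Ico_subset).1 h1
  rcases hitAbove_lt_iff.1 (lt_min hv hlt : hitAbove X K T ω < min v t) with ⟨s, hs, hsK⟩ | h2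
  · have hs1 : r ≤ s := hitAbove_le_of_lt hsK
    exact lt_asymm hsK (hsub ⟨hs1, hs.trans_le (min_le_left _ _)⟩)
  · exact not_lt.2 htT (h2.trans_le (min_le_right _ _))

lemma le_apply_hitAbove_of_lt (hX : ∀ ω, IsRightContPath fun t => X t ω) {K T : ℝ≥0} {ω : Ω}
    (h : hitAbove X K T ω < T) : K ≤ X (hitAbove X K T ω) ω := by
  rcases hitAbove_lt_iff.1 h with ⟨s, hs, hsK⟩ | h
  · exact le_apply_hitAbove hX ⟨s, hs.le, hsK⟩
  · exact absurd h (lt_irrefl _)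

lemma hitAbove_mono {K K' : ℝ≥0} (h : K ≤ K') (T : ℝ≥0) (ω : Ω) :
    hitAbove X K T ω ≤ hitAbove X K' T ω :=
  csInf_le_csInf (OrderBot.bddBelow _) ⟨T, Or.inr self_mem_Ici⟩
    (union_subset_union_left _ fun _ ht => lt_of_le_of_lt h ht)

/-- Strict passage before `t` can be tested on a countable dense set of times by right-continuity of
the paths; right-continuity of the filtration does the rest. -/
lemma isFiniteStoppingTime_hitAbove [𝓕.IsRightContinuous] (hX : StronglyAdapted 𝓕 X)
    (hr : ∀ ω, IsRightContPath fun t => X t ω) (K T : ℝ≥0) :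
    IsFiniteStoppingTime 𝓕 (hitAbove X K T) := by
  refine .of_isStoppingTime (isStoppingTime_of_measurableSet_lt_of_isRightContinuous fun t => ?_)
  obtain ⟨D, hDc, hDd⟩ := TopologicalSpace.exists_countable_dense ℝ≥0
  have : {ω | WithTop.some (hitAbove X K T ω) < WithTop.some t} =
      (⋃ q ∈ D ∩ Iio t, {ω | K < X q ω}) ∪ {_ω | T < t} := by
    ext ω
    refine WithTop.coe_lt_coe.trans (hitAbove_lt_iff.trans ?_)
    simp only [mem_union, mem_iUnion, mem_ofPred_eq, exists_prop]
    refine or_congr ⟨?_, ?_⟩ Iff.rfl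
    · rintro ⟨s, hst, hs⟩
      have h1 : ∀ᶠ q in 𝓝[≥] s, K < X q ω := (hr ω s).eventually (lt_mem_nhds hs)
      obtain ⟨v, hv, hsub⟩ := (mem_nhdsGE_iff_exists_Ico_subset).1 h1
      obtain ⟨q, hqD, hq1, hq2⟩ := hDd.exists_between (lt_min hv hst)
      exact ⟨q, ⟨hqD, hq2.trans_le (min_le_right _ _)⟩,
        hsub ⟨hq1.le, hq2.trans_le (min_le_left _ _)⟩⟩
    · rintro ⟨q, ⟨-, hqt⟩, hq⟩
      exact ⟨q, hqt, hq⟩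
  rw [this]
  refine MeasurableSet.union (MeasurableSet.biUnion (hDc.mono inter_subset_left) ?_)
    (MeasurableSet.const _)
  rintro q ⟨-, hq⟩
  exact 𝓕.mono (le_of_lt hq) _ ((hX q).measurable measurableSet_Ioi)

end Hitting

/-! ### Removing boundedness -/

section Localization

variable {Ω : Type*} {m : MeasurableSpace Ω} {P : Measure Ω} {𝓕 : Filtration ℝ≥0 m}
  {η : ℝ≥0 → ℝ≥0} {X A H : ℝ≥0 → Ω → ℝ≥0} {M : ℝ≥0 → Ω → ℝ} {c : ℝ≥0}

/-- A stopping time cut off at a deterministic time. -/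
noncomputable def cutoff (τ : Ω → WithTop ℝ≥0) (T : ℝ≥0) (ω : Ω) : ℝ≥0 :=
  (min (WithTop.some T) (τ ω)).untopA

lemma coe_cutoff (τ : Ω → WithTop ℝ≥0) (T : ℝ≥0) (ω : Ω) :
    WithTop.some (cutoff τ T ω) = min (WithTop.some T) (τ ω) := by
  have h : min (WithTop.some T) (τ ω) ≠ ⊤ :=
    ne_top_of_le_ne_top WithTop.coe_ne_top (min_le_left _ _)
  rw [cutoff, WithTop.untopA_eq_untop h, WithTop.coe_untop]

lemma cutoff_le (τ : Ω → WithTop ℝ≥0) (T : ℝ≥0) (ω : Ω) : cutoff τ T ω ≤ T := by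
  rw [← WithTop.coe_le_coe, coe_cutoff]; exact min_le_left _ _

lemma coe_cutoff_le (τ : Ω → WithTop ℝ≥0) (T : ℝ≥0) (ω : Ω) :
    WithTop.some (cutoff τ T ω) ≤ τ ω := by
  rw [coe_cutoff]; exact min_le_right _ _

lemma cutoff_eq_of_le {τ : Ω → WithTop ℝ≥0} {T : ℝ≥0} {ω : Ω} (h : WithTop.some T ≤ τ ω) :
    cutoff τ T ω = T := by
  rw [← WithTop.coe_inj, coe_cutoff, min_eq_left h]

lemma isFiniteStoppingTime_cutoff {τ : Ω → WithTop ℝ≥0} (hτ : IsStoppingTime 𝓕 τ) (T : ℝ≥0) :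
    IsFiniteStoppingTime 𝓕 (cutoff τ T) := by
  refine .of_isStoppingTime ?_
  simp only [coe_cutoff]
  exact (isStoppingTime_const 𝓕 T).min hτ

/-- A local martingale is stopped by a localizing sequence to right-continuous martingales. -/
lemma IsCadlagLocalMartingale.exists_martingale (hM : IsCadlagLocalMartingale 𝓕 P M) :
    ∃ τ : ℕ → Ω → WithTop ℝ≥0, (∀ n, IsStoppingTime 𝓕 (τ n)) ∧
      (∀ᵐ ω ∂P, Tendsto (fun n => τ n ω) atTop (𝓝 ⊤)) ∧
      ∀ n, ∃ N : ℝ≥0 → Ω → ℝ, Martingale N 𝓕 P ∧ (∀ ω, IsRightContPath fun t => N t ω) ∧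
        ∀ (t : ℝ≥0) ω, WithTop.some t ≤ τ n ω → N t ω = M t ω := by
  obtain ⟨τ, hτ, hp⟩ := hM.locally_martingale
  refine ⟨τ, hτ.isStoppingTime, hτ.tendsto_top, fun n => ⟨_, hp n, fun ω => ?_, fun t ω ht => ?_⟩⟩
  · by_cases hω : ω ∈ {ω | ⊥ < τ n ω}
    · have heq : (fun t => stoppedProcess (fun i => {ω | ⊥ < τ n ω}.indicator (M i)) (τ n) t ω) =
          fun t => M (min (WithTop.some t) (τ n ω)).untopA ω := by
        ext t
        exact indicator_of_mem hω _
      rw [heq]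
      intro t
      rcases hτω : τ n ω with _ | s
      · have : (fun t => M (min (WithTop.some t) (none : WithTop ℝ≥0)).untopA ω) =
            fun t => M t ω := by
          ext t
          congr 1
        rw [this]
        exact (hM.cadlag ω).1 t
      · have : (fun t => M (min (WithTop.some t) (some s : WithTop ℝ≥0)).untopA ω) =
            fun t => M (min t s) ω := by
          ext t
          congr 1
        rw [this]
        refine ContinuousWithinAt.comp (f := fun t => min t s) (g := fun t => M t ω) (x := t)
          (s := Ici t) (t := Ici (min t s)) ((hM.cadlag ω).1 (min t s)) ?_ ?_
        · exact (continuous_id.min continuous_const).continuousWithinAt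
        · exact fun r hr => (min_le_min_right s hr : min t s ≤ min r s)
    · have heq : (fun t => stoppedProcess (fun i => {ω | ⊥ < τ n ω}.indicator (M i)) (τ n) t ω) =
          fun _ => 0 := by
        ext t
        exact indicator_of_notMem hω _
      rw [heq]
      exact fun t => continuousWithinAt_const
  · rw [stoppedProcess_eq_of_le ht]
    by_cases hω : ω ∈ {ω | ⊥ < τ n ω}
    · exact indicator_of_mem hω _
    · rw [indicator_of_notMem hω]
      -- Localization sets the process to zero where the stopping time is `0`; there only time `0`
      -- matters, and `M 0 = 0`.
      have h0 : τ n ω = ⊥ := not_bot_lt_iff.1 hω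
      rw [h0, le_bot_iff] at ht
      have ht0 : t = 0 := WithTop.coe_inj.1 ht
      rw [ht0, hM.zero]

/-- The fundamental estimate of `E[G(X_θ + ε)]`, normalised to be non-negative. -/
lemma AssumptionSup.lintegral_bihariReal_le [IsProbabilityMeasure P] [𝓕.IsRightContinuous]
    (h : AssumptionSup 𝓕 P η X A H M) (hc : 0 < c) {θ : Ω → ℝ≥0}
    (hθ : IsFiniteStoppingTime 𝓕 θ) {T : ℝ≥0} (hT : ∀ ω, θ ω ≤ T) {a b ε : ℝ≥0}
    (ha : ∫⁻ ω, (A (θ ω) ω : ℝ≥0∞) ∂P ≤ a) (hb : ∫⁻ ω, (H (θ ω) ω : ℝ≥0∞) ∂P ≤ b)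
    (hε : 0 < ε) :
    ∫⁻ ω, ENNReal.ofReal (bihariReal η c (X (θ ω) ω + ε) - bihariReal η c ε) ∂P ≤
      ENNReal.ofReal (a + bihariReal η c (b + ε) - bihariReal η c ε) := by
  have hη := h.eta_mono
  have hpos := h.eta_pos
  have hε' : (0 : ℝ) < ε := by exact_mod_cast hε
  obtain ⟨τ, hτs, hτ, hN⟩ := h.M_local_martingale.exists_martingale
  choose N hNm hNr hNM using hN
  -- Up to `ρ n` the process `X` is bounded by `n` and `M` agrees with a true martingale, so the
  -- bounded estimate applies; Fatou's lemma then needs only a pointwise lower bound for the limit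
  -- inferior.
  set ρ : ℕ → Ω → ℝ≥0 := fun n ω =>
    min (min (hitAbove X n T ω) (cutoff (τ n) T ω)) (θ ω) with hρ
  have hρs : ∀ n, IsFiniteStoppingTime 𝓕 (ρ n) := fun n =>
    ((isFiniteStoppingTime_hitAbove h.X_adapted h.X_right_cont _ _).min
      (isFiniteStoppingTime_cutoff (hτs n) T)).min hθ
  have hρθ : ∀ n ω, ρ n ω ≤ θ ω := fun n ω => min_le_right _ _
  have hmono : Monotone fun x : ℝ≥0 => bihariReal η c ((x : ℝ) + ε) := fun x y hxy =>
    bihariReal_mono hη hpos hc (by positivity) (by gcongr)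
  have hbound : ∀ n, ∫⁻ ω, ENNReal.ofReal (bihariReal η c (X (ρ n ω) ω + ε) -
      bihariReal η c ε) ∂P ≤ ENNReal.ofReal (a + bihariReal η c (b + ε) - bihariReal η c ε) := by
    intro n
    obtain ⟨hi, hle⟩ := h.integral_bihariReal_le_of_bounded hc (hρs n)
      (fun ω => (hρθ n ω).trans (hT ω)) (K := n)
      (fun ω s hs => le_of_lt_hitAbove
        (hs.trans_le ((min_le_left _ _).trans (min_le_left _ _)))) (hNm n) (hNr n)
      (fun t ω => (hNM n _ ω (le_trans (WithTop.coe_le_coe.2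
        ((min_le_right _ _).trans ((min_le_left _ _).trans (min_le_right _ _))))
        (coe_cutoff_le (τ n) T ω))).symm)
      ((lintegral_mono fun ω => ENNReal.coe_le_coe.2 (h.A_mono ω (hρθ n ω))).trans ha)
      ((lintegral_mono fun ω => ENNReal.coe_le_coe.2 (h.H_mono ω (hρθ n ω))).trans hb) hε
    have hi2 : Integrable (fun ω => bihariReal η c (X (ρ n ω) ω + ε) - bihariReal η c ε) P :=
      hi.sub (integrable_const _)
    rw [← ofReal_integral_eq_lintegral_ofReal hi2
      (ae_of_all _ fun ω => sub_nonneg.2 (by simpa using hmono (zero_le (a := X (ρ n ω) ω)))),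
      integral_sub hi (integrable_const _)]
    refine ENNReal.ofReal_le_ofReal ?_
    rw [integral_const, probReal_univ, one_smul]
    linarith
  have hmeas : ∀ n, Measurable fun ω => ENNReal.ofReal (bihariReal η c (X (ρ n ω) ω + ε) -
      bihariReal η c ε) := fun n =>
    ((hmono.measurable.comp (measurable_eval_of_rightCont h.measurable_X h.X_right_cont
      (hρs n).measurable)).sub_const _).ennreal_ofReal
  calc ∫⁻ ω, ENNReal.ofReal (bihariReal η c (X (θ ω) ω + ε) - bihariReal η c ε) ∂P
      ≤ ∫⁻ ω, liminf (fun n => ENNReal.ofReal (bihariReal η c (X (ρ n ω) ω + ε) -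
          bihariReal η c ε)) atTop ∂P := by
        refine lintegral_mono_ae ?_
        filter_upwards [hτ] with ω hω
        refine le_liminf_of_le (by isBoundedDefault) ?_
        have h1 : ∀ᶠ n in atTop, WithTop.some T < τ n ω :=
          hω.eventually (lt_mem_nhds (WithTop.coe_lt_top T))
        by_cases hex : ∃ n : ℕ, θ ω ≤ hitAbove X n T ω
        · obtain ⟨n₀, hn₀⟩ := hex
          filter_upwards [h1, eventually_ge_atTop n₀] with n hn hnn
          have h2 : ρ n ω = θ ω := by
            simp only [hρ, cutoff_eq_of_le hn.le]
            refine min_eq_right (le_min (hn₀.trans (hitAbove_mono ?_ T ω)) (hT ω))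
            exact_mod_cast hnn
          rw [h2]
        -- As left limits of `X` are not assumed, `X` may be unbounded before `θ`, and then `ρ n`
        -- never reaches `θ`. In that case the value of `X` at `ρ n` is at least `n`, which
        -- eventually exceeds the value at `θ`.
        · push Not at hex
          filter_upwards [h1, eventually_ge_atTop ⌈X (θ ω) ω⌉₊] with n hn hnn
          have h2 : ρ n ω = hitAbove X n T ω := by
            simp only [hρ, cutoff_eq_of_le hn.le, min_eq_left (hitAbove_le X n T ω)]
            exact min_eq_left (hex n).le
          rw [h2]
          refine ENNReal.ofReal_le_ofReal (sub_le_sub_right (hmono ?_) _)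
          refine le_trans (Nat.ceil_le.1 hnn) ?_
          exact le_apply_hitAbove_of_lt h.X_right_cont ((hex n).trans_le (hT ω))
    _ ≤ liminf (fun n => ∫⁻ ω, ENNReal.ofReal (bihariReal η c (X (ρ n ω) ω + ε) -
          bihariReal η c ε) ∂P) atTop := lintegral_liminf_le hmeas
    _ ≤ _ := liminf_le_of_le (by isBoundedDefault) fun x hx => by
        obtain ⟨n, hn⟩ := hx.exists
        exact hn.trans (hbound n)

end Localization

/-! ### Tail estimates and the Osgood condition -/

section Consequences

variable {Ω : Type*} {m : MeasurableSpace Ω} {P : Measure Ω} {𝓕 : Filtration ℝ≥0 m}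
  {η : ℝ≥0 → ℝ≥0} {c : ℝ≥0}

/-- Undoes the normalization by `G(ε)`: the finite bound on the non-negative integral provides
integrability as well. -/
lemma AssumptionSup.integral_bihariReal_le [IsProbabilityMeasure P] [𝓕.IsRightContinuous]
    {X A H : ℝ≥0 → Ω → ℝ≥0} {M : ℝ≥0 → Ω → ℝ}
    (h : AssumptionSup 𝓕 P η X A H M) (hc : 0 < c) {θ : Ω → ℝ≥0}
    (hθ : IsFiniteStoppingTime 𝓕 θ) {T : ℝ≥0} (hT : ∀ ω, θ ω ≤ T) {a b ε : ℝ≥0}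
    (ha : ∫⁻ ω, (A (θ ω) ω : ℝ≥0∞) ∂P ≤ a) (hb : ∫⁻ ω, (H (θ ω) ω : ℝ≥0∞) ∂P ≤ b)
    (hε : 0 < ε) :
    Integrable (fun ω => bihariReal η c (X (θ ω) ω + ε)) P ∧
      ∫ ω, bihariReal η c (X (θ ω) ω + ε) ∂P ≤ a + bihariReal η c (b + ε) := by
  have hε' : (0 : ℝ) < ε := by exact_mod_cast hε
  have hmono : Monotone fun x : ℝ≥0 => bihariReal η c ((x : ℝ) + ε) := fun x y hxy =>
    bihariReal_mono h.eta_mono h.eta_pos hc (by positivity) (by gcongr)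
  have hnn : ∀ x : ℝ≥0, 0 ≤ bihariReal η c (x + ε) - bihariReal η c ε := fun x =>
    sub_nonneg.2 (by simpa using hmono (zero_le (a := x)))
  have hmeas : Measurable fun ω => bihariReal η c (X (θ ω) ω + ε) :=
    hmono.measurable.comp (measurable_eval_of_rightCont h.measurable_X h.X_right_cont hθ.measurable)
  have hle := h.lintegral_bihariReal_le hc hθ hT ha hb hε
  have hi : Integrable (fun ω => bihariReal η c (X (θ ω) ω + ε) - bihariReal η c ε) P := by
    refine ⟨(hmeas.sub_const _).aestronglyMeasurable, ?_⟩
    rw [hasFiniteIntegral_iff_ofReal (ae_of_all _ fun ω => hnn _)]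
    exact hle.trans_lt ENNReal.ofReal_lt_top
  have hi' : Integrable (fun ω => bihariReal η c (X (θ ω) ω + ε)) P := by
    exact (hi.add (integrable_const (bihariReal η c ε))).congr (ae_of_all _ fun ω => by simp)
  refine ⟨hi', ?_⟩
  rw [← ofReal_integral_eq_lintegral_ofReal hi (ae_of_all _ fun ω => hnn _),
    integral_sub hi' (integrable_const _), integral_const, probReal_univ, one_smul] at hle
  have hnn' : 0 ≤ (a : ℝ) + bihariReal η c (b + ε) - bihariReal η c ε := by
    have := hnn b
    have : (0 : ℝ) ≤ a := a.2
    linarith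
  have := (ENNReal.ofReal_le_ofReal_iff hnn').1 hle
  linarith

/-- A tail estimate for `X` up to a stopping time before which `A` is bounded. -/
lemma AssumptionSup.measure_exceed_mul_le [IsProbabilityMeasure P] [𝓕.IsRightContinuous]
    {X A H : ℝ≥0 → Ω → ℝ≥0} {M : ℝ≥0 → Ω → ℝ}
    (h : AssumptionSup 𝓕 P η X A H M) (hc : 0 < c) {θ ρ : Ω → ℝ≥0}
    (hθ : IsFiniteStoppingTime 𝓕 θ) {T : ℝ≥0} (hT : ∀ ω, θ ω ≤ T)
    (hρ : IsFiniteStoppingTime 𝓕 ρ) {u b ε δ : ℝ≥0} (hA : ∀ᵐ ω ∂P, A (ρ ω) ω < u)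
    (hb : ∫⁻ ω, (H (θ ω) ω : ℝ≥0∞) ∂P ≤ b) (hε : 0 < ε) :
    ENNReal.ofReal (bihariReal η c (δ + ε) - bihariReal η c ε) *
        P {ω | (∃ s ≤ θ ω, δ < X s ω) ∧ θ ω ≤ ρ ω} ≤
      ENNReal.ofReal (u + bihariReal η c (b + ε) - bihariReal η c ε) := by
  have hmono : Monotone fun x : ℝ≥0 => bihariReal η c ((x : ℝ) + ε) := fun x y hxy =>
    bihariReal_mono h.eta_mono h.eta_pos hc
      (add_pos_of_nonneg_of_pos x.2 (by exact_mod_cast hε)) (by gcongr)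
  -- Stopping at first passage turns an event about the supremum into one about a single value, to
  -- which Markov's inequality applies; the cut at `ρ` keeps `A` below `u`.
  set κ : Ω → ℝ≥0 := fun ω => min (min (hitAbove X δ T ω) (ρ ω)) (θ ω) with hκ
  have hκs : IsFiniteStoppingTime 𝓕 κ :=
    ((isFiniteStoppingTime_hitAbove h.X_adapted h.X_right_cont _ _).min hρ).min hθ
  have hle := h.lintegral_bihariReal_le hc hκs (fun ω => (min_le_right _ _).trans (hT ω))
    (a := u) (b := b) ?_ ?_ hε
  · refine le_trans ?_ hle
    refine le_trans (mul_le_mul_right (measure_mono ?_) _) (mul_meas_ge_le_lintegral₀ ?_ _)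
    · rintro ω ⟨⟨s, hs, hsX⟩, hθρ⟩
      have h1 : hitAbove X δ T ω ≤ s := hitAbove_le_of_lt hsX
      have h2 : κ ω = hitAbove X δ T ω := by
        simp only [hκ]
        rw [min_eq_left (h1.trans (hs.trans hθρ)), min_eq_left (h1.trans hs)]
      refine ENNReal.ofReal_le_ofReal (sub_le_sub_right (hmono ?_) _)
      rw [h2]
      exact le_apply_hitAbove h.X_right_cont ⟨s, hs.trans (hT ω), hsX⟩
    · exact ((hmono.measurable.comp (measurable_eval_of_rightCont h.measurable_X h.X_right_cont
        hκs.measurable)).sub_const _).ennreal_ofReal.aemeasurable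
  · calc ∫⁻ ω, (A (κ ω) ω : ℝ≥0∞) ∂P ≤ ∫⁻ _, (u : ℝ≥0∞) ∂P := by
          refine lintegral_mono_ae ?_
          filter_upwards [hA] with ω hω
          exact_mod_cast (h.A_mono ω ((min_le_left _ _).trans (min_le_right _ _))).trans hω.le
      _ = u := by simp
  · exact (lintegral_mono fun ω => ENNReal.coe_le_coe.2 (h.H_mono ω (min_le_right _ _))).trans hb

lemma exists_measure_ge_le [IsProbabilityMeasure P] {f : Ω → ℝ≥0} (hf : Measurable f) {e : ℝ≥0∞}
    (he : 0 < e) : ∃ u : ℝ≥0, 0 < u ∧ P {ω | u ≤ f ω} ≤ e := by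
  have hlim : Tendsto (fun n : ℕ => P {ω | (n : ℝ≥0) ≤ f ω}) atTop
      (𝓝 (P (⋂ n : ℕ, {ω | (n : ℝ≥0) ≤ f ω}))) := by
    refine tendsto_measure_iInter_atTop (fun n => (hf measurableSet_Ici).nullMeasurableSet) ?_
      ⟨0, measure_ne_top _ _⟩
    intro i j hij ω hω
    change (j : ℝ≥0) ≤ f ω at hω
    exact le_trans (by exact_mod_cast hij) hω
  have hempty : (⋂ n : ℕ, {ω | (n : ℝ≥0) ≤ f ω}) = ∅ := by
    ext ω
    simp only [mem_iInter, mem_ofPred_eq, mem_empty_iff_false, iff_false, not_forall, not_le]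
    exact exists_nat_gt _
  rw [hempty, measure_empty] at hlim
  obtain ⟨n, hn1, hn2⟩ := ((hlim.eventually (gt_mem_nhds he)).and (eventually_gt_atTop 0)).exists
  exact ⟨n, by exact_mod_cast hn2, hn1.le⟩

/-- Convergence to zero in probability of the maximal process when `E[H_θ] → 0`. -/
lemma tendsto_measure_exceed [IsProbabilityMeasure P] [𝓕.IsRightContinuous]
    (ho : OsgoodCondition η) (hc : 0 < c) {X : ℕ → ℝ≥0 → Ω → ℝ≥0} {A : ℝ≥0 → Ω → ℝ≥0}
    {H : ℕ → ℝ≥0 → Ω → ℝ≥0} {M : ℕ → ℝ≥0 → Ω → ℝ}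
    (h : ∀ n, AssumptionSup 𝓕 P η (X n) A (H n) (M n)) {θ : Ω → ℝ≥0}
    (hθ : IsFiniteStoppingTime 𝓕 θ) {T : ℝ≥0} (hT : ∀ ω, θ ω ≤ T)
    (hH : Tendsto (fun n => ∫⁻ ω, (H n (θ ω) ω : ℝ≥0∞) ∂P) atTop (𝓝 0)) {δ : ℝ≥0} (hδ : 0 < δ) :
    Tendsto (fun n => P {ω | ∃ s ≤ θ ω, δ < X n s ω}) atTop (𝓝 0) := by
  have hη := (h 0).eta_mono
  have hpos := (h 0).eta_pos
  refine ENNReal.tendsto_nhds_zero.2 fun e' he' => ?_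
  obtain ⟨e, he, hee⟩ : ∃ e : ℝ≥0, 0 < e ∧ (e : ℝ≥0∞) + e + e ≤ e' := by
    obtain ⟨d, hd0, hd⟩ := ENNReal.lt_iff_exists_nnreal_btwn.1 he'
    refine ⟨d / 3, by have := ENNReal.coe_pos.1 hd0; positivity, le_trans ?_ hd.le⟩
    have : d / 3 + d / 3 + d / 3 = d := by
      ext; push_cast; ring
    exact_mod_cast this.le
  obtain ⟨u, hu, hPu⟩ := exists_measure_ge_le (P := P) ((h 0).measurable_A T)
    (ENNReal.coe_pos.2 he)
  obtain ⟨ρ, hρs, hρT, hAρ, hPρ⟩ := exists_stopping_lt_level (P := P) (h 0).A_predictable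
    (h 0).A_mono (fun ω => ((h 0).A_cadlag ω).1) (h 0).A_zero hu T
    (ENNReal.coe_pos.2 he).ne'
  -- The shift is chosen last, once `u` and `e` are fixed, so that the gap `G(δ + ε) - G(ε)` is at
  -- least `(u + 1) / e`. With `b` then small, the right-hand side is at most `u + 1`, and the
  -- probability at most `e`.
  obtain ⟨ε, hε, hLε⟩ := ho.exists_bihariReal_lt hη hpos hc (bihariReal η c δ - (u + 1) / e)
  have hLε := hLε ε hε le_rfl
  have hε' : (0 : ℝ) < ε := by exact_mod_cast hε
  have he' : (0 : ℝ) < e := by exact_mod_cast he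
  obtain ⟨b, hb, hbL⟩ : ∃ b : ℝ≥0, 0 < b ∧ bihariReal η c (b + ε) - bihariReal η c ε ≤ 1 := by
    have hcont : Tendsto (fun n : ℕ => bihariReal η c (1 / ((n : ℝ) + 1) + ε)) atTop
        (𝓝 (bihariReal η c ε)) := by
      refine (bihariReal_continuousAt hη hpos hc hε').tendsto.comp ?_
      simpa using (tendsto_one_div_add_atTop_nhds_zero_nat (𝕜 := ℝ)).add_const (ε : ℝ)
    obtain ⟨n, hn⟩ := (hcont.eventually
      (gt_mem_nhds (show bihariReal η c ε < bihariReal η c ε + 1 by linarith))).exists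
    refine ⟨1 / ((n : ℝ≥0) + 1), by positivity, ?_⟩
    push_cast
    linarith
  have hbev : ∀ᶠ n in atTop, ∫⁻ ω, (H n (θ ω) ω : ℝ≥0∞) ∂P < b :=
    hH.eventually (gt_mem_nhds (ENNReal.coe_pos.2 hb))
  filter_upwards [hbev] with n hn
  have hexc := (h n).measure_exceed_mul_le hc hθ hT hρs (δ := δ) hAρ hn.le hε
  have hgap : ((u : ℝ) + 1) / e ≤ bihariReal η c (δ + ε) - bihariReal η c ε := by
    have := bihariReal_mono hη hpos hc (x := δ) (y := δ + ε) (by exact_mod_cast hδ) (by linarith)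
    linarith
  have h1 : P {ω | (∃ s ≤ θ ω, δ < X n s ω) ∧ θ ω ≤ ρ ω} ≤ e := by
    have h2 : ENNReal.ofReal (((u : ℝ) + 1) / e) *
        P {ω | (∃ s ≤ θ ω, δ < X n s ω) ∧ θ ω ≤ ρ ω} ≤
        ENNReal.ofReal (((u : ℝ) + 1) / e) * e := by
      calc _ ≤ _ := mul_le_mul_left (ENNReal.ofReal_le_ofReal hgap) _
        _ ≤ _ := hexc
        _ ≤ ENNReal.ofReal (u + 1) := ENNReal.ofReal_le_ofReal (by linarith)
        _ = ENNReal.ofReal (((u : ℝ) + 1) / e) * e := by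
          rw [← ENNReal.ofReal_coe_nnreal, ← ENNReal.ofReal_mul (by positivity),
            div_mul_cancel₀ _ he'.ne']
    exact (ENNReal.mul_le_mul_iff_right (ENNReal.ofReal_pos.2 (by positivity)).ne'
      ENNReal.ofReal_ne_top).1 h2
  calc P {ω | ∃ s ≤ θ ω, δ < X n s ω}
      ≤ P ({ω | (∃ s ≤ θ ω, δ < X n s ω) ∧ θ ω ≤ ρ ω} ∪ {ω | u ≤ A T ω} ∪
          {ω | A T ω < u ∧ ρ ω < T}) := measure_mono fun ω hω => by
        by_cases h1 : u ≤ A T ω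
        · exact Or.inl (Or.inr h1)
        · by_cases h2 : ρ ω < T
          · exact Or.inr ⟨not_le.1 h1, h2⟩
          · exact Or.inl (Or.inl ⟨hω, (hT ω).trans (not_lt.1 h2)⟩)
    _ ≤ e + e + e := (measure_union_le _ _).trans
        (add_le_add ((measure_union_le _ _).trans (add_le_add h1 hPu)) hPρ)
    _ ≤ _ := hee

/-- A constant sequence of processes: its exceedance probabilities are constant and tend to `0`. -/
lemma AssumptionSup.ae_not_exceed [IsProbabilityMeasure P] [𝓕.IsRightContinuous]
    (ho : OsgoodCondition η) (hc : 0 < c) {X A H : ℝ≥0 → Ω → ℝ≥0} {M : ℝ≥0 → Ω → ℝ}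
    (h : AssumptionSup 𝓕 P η X A H M) {θ : Ω → ℝ≥0}
    (hθ : IsFiniteStoppingTime 𝓕 θ) {T : ℝ≥0} (hT : ∀ ω, θ ω ≤ T)
    (hH : ∫⁻ ω, (H (θ ω) ω : ℝ≥0∞) ∂P = 0) :
    ∀ᵐ ω ∂P, ∀ s ≤ θ ω, X s ω = 0 := by
  have hδ : ∀ k : ℕ, ∀ᵐ ω ∂P, ¬ ∃ s ≤ θ ω, (1 / ((k : ℝ≥0) + 1)) < X s ω := by
    intro k
    have := tendsto_measure_exceed ho hc (X := fun _ => X) (H := fun _ => H) (M := fun _ => M)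
      (fun _ => h) hθ hT (by simp [hH]) (δ := 1 / ((k : ℝ≥0) + 1)) (by positivity)
    exact measure_eq_zero_iff_ae_notMem.1 (tendsto_nhds_unique tendsto_const_nhds this)
  filter_upwards [ae_all_iff.2 hδ] with ω hω s hs
  by_contra hne
  obtain ⟨k, hk⟩ := exists_nat_one_div_lt (pos_iff_ne_zero.2 hne)
  exact hω k ⟨s, hs, hk⟩

lemma lt_runSup_iff {X : ℝ≥0 → Ω → ℝ≥0} {T δ : ℝ≥0} {ω : Ω} :
    (δ : ℝ≥0∞) < runSup X T ω ↔ ∃ s ≤ T, δ < X s ω := by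
  simp only [runSup, lt_iSup_iff, ENNReal.coe_lt_coe, exists_prop]

lemma extExpect_le_integral {Y : Ω → EReal} {f : Ω → ℝ} (hf : Integrable f P)
    (hY : ∀ ω, Y ω ≤ f ω) : extExpect P Y ≤ (∫ ω, f ω ∂P : ℝ) := by
  have h1 : ∫⁻ ω, (Y ω).toENNReal ∂P ≤ ∫⁻ ω, ENNReal.ofReal (f ω) ∂P :=
    lintegral_mono fun ω => by
      simpa using EReal.toENNReal_le_toENNReal (hY ω)
  have h2 : ∫⁻ ω, ENNReal.ofReal (-f ω) ∂P ≤ ∫⁻ ω, (-Y ω).toENNReal ∂P :=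
    lintegral_mono fun ω => by
      have := EReal.toENNReal_le_toENNReal (EReal.neg_le_neg_iff.2 (hY ω))
      rwa [← EReal.coe_neg, EReal.real_coe_toENNReal] at this
  have h3 : ∫⁻ ω, ENNReal.ofReal (f ω) ∂P ≠ ⊤ := hf.lintegral_lt_top.ne
  have h4 : ∫⁻ ω, ENNReal.ofReal (-f ω) ∂P ≠ ⊤ := hf.neg.lintegral_lt_top.ne
  rw [extExpect, if_neg (ne_top_of_le_ne_top h3 h1),
    integral_eq_lintegral_pos_part_sub_lintegral_neg_part hf, EReal.coe_sub,
    EReal.coe_ennreal_toReal h3, EReal.coe_ennreal_toReal h4]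
  exact EReal.sub_le_sub (EReal.coe_ennreal_le_coe_ennreal_iff.2 h1)
    (EReal.coe_ennreal_le_coe_ennreal_iff.2 h2)

end Consequences

/-! ### Extended expectations and assertion (1) -/

section Expectation

variable {Ω : Type*} {m : MeasurableSpace Ω} {P : Measure Ω} {𝓕 : Filtration ℝ≥0 m}
  {η : ℝ≥0 → ℝ≥0} {c : ℝ≥0}

lemma extExpect_mono {Y Z : Ω → EReal} (h : ∀ᵐ ω ∂P, Y ω ≤ Z ω) :
    extExpect P Y ≤ extExpect P Z := by
  have h1 : ∫⁻ ω, (Y ω).toENNReal ∂P ≤ ∫⁻ ω, (Z ω).toENNReal ∂P :=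
    lintegral_mono_ae (h.mono fun ω hω => EReal.toENNReal_le_toENNReal hω)
  have h2 : ∫⁻ ω, (-Z ω).toENNReal ∂P ≤ ∫⁻ ω, (-Y ω).toENNReal ∂P :=
    lintegral_mono_ae (h.mono fun ω hω =>
      EReal.toENNReal_le_toENNReal (EReal.neg_le_neg_iff.2 hω))
  by_cases hZ : ∫⁻ ω, (Z ω).toENNReal ∂P = ⊤
  · rw [extExpect, extExpect, if_pos hZ]; exact le_top
  · rw [extExpect, extExpect, if_neg hZ, if_neg (ne_top_of_le_ne_top hZ h1)]
    exact EReal.sub_le_sub (EReal.coe_ennreal_le_coe_ennreal_iff.2 h1)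
      (EReal.coe_ennreal_le_coe_ennreal_iff.2 h2)

lemma extExpect_const [IsProbabilityMeasure P] (y : EReal) : extExpect P (fun _ => y) = y := by
  induction y with
  | bot => simp [extExpect]
  | top => simp [extExpect]
  | coe r =>
    simp [extExpect]
    norm_cast
    rcases le_total r 0 with hr | hr <;> simp [hr]

lemma extExpect_of_nonneg {Y : Ω → EReal} (h : ∀ᵐ ω ∂P, 0 ≤ Y ω) :
    extExpect P Y = ((∫⁻ ω, (Y ω).toENNReal ∂P : ℝ≥0∞) : EReal) := by
  have h0 : ∫⁻ ω, (-Y ω).toENNReal ∂P = 0 := by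
    rw [lintegral_congr_ae (h.mono fun ω hω => EReal.toENNReal_of_nonpos
      (EReal.neg_le.2 (by simpa using hω))), lintegral_zero]
  rw [extExpect, h0]
  split_ifs with ht
  · rw [ht]; rfl
  · simp

/-- The Bihari inequality in expectation, at a bounded stopping time. -/
lemma AssumptionSup.extExpect_bihariG_le [IsProbabilityMeasure P] [𝓕.IsRightContinuous]
    {X A H : ℝ≥0 → Ω → ℝ≥0} {M : ℝ≥0 → Ω → ℝ}
    (h : AssumptionSup 𝓕 P η X A H M) (hc : 0 < c) {θ : Ω → ℝ≥0}
    (hθ : IsFiniteStoppingTime 𝓕 θ) {T : ℝ≥0} (hT : ∀ ω, θ ω ≤ T) :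
    extExpect P (fun ω => bihariG η c (X (θ ω) ω)) ≤
      ((∫⁻ ω, (A (θ ω) ω : ℝ≥0∞) ∂P : ℝ≥0∞) : EReal) +
        bihariG η c (∫⁻ ω, (H (θ ω) ω : ℝ≥0∞) ∂P) := by
  have hη := h.eta_mono
  have hpos := h.eta_pos
  rcases eq_or_ne (∫⁻ ω, (A (θ ω) ω : ℝ≥0∞) ∂P) ⊤ with ha | ha
  · rw [ha, EReal.coe_ennreal_top]
    rcases eq_or_ne (bihariG η c (∫⁻ ω, (H (θ ω) ω : ℝ≥0∞) ∂P)) ⊥ with hb | hb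
    · have hH0 : ∫⁻ ω, (H (θ ω) ω : ℝ≥0∞) ∂P = 0 := by
        by_contra hne
        rcases eq_or_ne (∫⁻ ω, (H (θ ω) ω : ℝ≥0∞) ∂P) ⊤ with ht | ht
        · exact absurd (bihariG_nonneg (η := η) (c := c) (ht ▸ le_top)) (by rw [hb]; simp)
        · lift (∫⁻ ω, (H (θ ω) ω : ℝ≥0∞) ∂P) to ℝ≥0 using ht with b
          rw [bihariG_eq_bihariReal hη hpos hc
            (pos_iff_ne_zero.2 (by exact_mod_cast hne))] at hb
          exact EReal.coe_ne_bot _ hb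
      rw [hH0] at hb ⊢
      rw [hb, EReal.add_bot, le_bot_iff, ← le_bot_iff]
      -- The bound must be `-∞` although `E[A] = ∞`. Here `G(0) = -∞` is the Osgood condition and
      -- `H` vanishes almost surely at `θ`, so uniqueness forces `X = 0` and the left side is `-∞`
      -- too.
      have hX0 := h.ae_not_exceed (osgoodCondition_of_bihariG_zero hη hpos hb) hc hθ hT hH0
      refine (extExpect_mono (Z := fun _ => ⊥) ?_).trans (extExpect_const _).le
      filter_upwards [hX0] with ω hω
      rw [hω _ le_rfl, ENNReal.coe_zero, hb]
    · rw [EReal.top_add_of_ne_bot hb]; exact le_top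
  rcases eq_or_ne (∫⁻ ω, (H (θ ω) ω : ℝ≥0∞) ∂P) ⊤ with hb | hb
  · rw [hb]
    refine (extExpect_mono (Z := fun _ => bihariG η c ⊤)
      (ae_of_all _ fun ω => bihariG_mono le_top)).trans ?_
    rw [extExpect_const]
    exact le_add_of_nonneg_left (EReal.coe_ennreal_nonneg _)
  lift (∫⁻ ω, (A (θ ω) ω : ℝ≥0∞) ∂P) to ℝ≥0 using ha with a ha'
  lift (∫⁻ ω, (H (θ ω) ω : ℝ≥0∞) ∂P) to ℝ≥0 using hb with b hb'
  -- Addition on `EReal` is continuous here because `a` is finite, even if `G(b) = -∞`.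
  have hlim : Tendsto (fun n : ℕ => ((a : ℝ≥0∞) : EReal) +
      (bihariReal η c (b + 1 / ((n : ℝ) + 1)) : EReal)) atTop
      (𝓝 (((a : ℝ≥0∞) : EReal) + bihariG η c b)) :=
    Tendsto.comp (g := fun p : EReal × EReal => p.1 + p.2)
      (EReal.continuousAt_add (p := (((a : ℝ≥0∞) : EReal), bihariG η c b))
        (Or.inl (by simp)) (Or.inl (by simp))).tendsto
      (tendsto_const_nhds.prodMk_nhds (tendsto_bihariReal_add hη hpos hc b))
  refine ge_of_tendsto' hlim fun n => ?_
  have hε : (0 : ℝ≥0) < 1 / ((n : ℝ≥0) + 1) := by positivity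
  obtain ⟨hi, hle⟩ := h.integral_bihariReal_le hc hθ hT ha'.ge hb'.ge hε
  refine (extExpect_le_integral hi fun ω => ?_).trans ?_
  · simpa using bihariG_le_bihariReal hη hpos hc (X (θ ω) ω) hε
  · refine (EReal.coe_le_coe_iff.2 hle).trans (le_of_eq ?_)
    push_cast
    rfl

end Expectation

/-! ### The running supremum and assertion (2) -/

section MaximalProcess

variable {Ω : Type*} {m : MeasurableSpace Ω} {P : Measure Ω} {𝓕 : Filtration ℝ≥0 m}
  {η : ℝ≥0 → ℝ≥0} {c : ℝ≥0}

lemma measurable_runSup [𝓕.IsRightContinuous] {X : ℝ≥0 → Ω → ℝ≥0} (hX : StronglyAdapted 𝓕 X)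
    (hr : ∀ ω, IsRightContPath fun t => X t ω) (T : ℝ≥0) : Measurable (runSup X T) := by
  refine measurable_of_Ioi fun δ => ?_
  rcases eq_or_ne δ ⊤ with rfl | hδ
  · simp
  lift δ to ℝ≥0 using hδ
  have : runSup X T ⁻¹' Ioi (δ : ℝ≥0∞) = {ω | hitAbove X δ T ω < T} ∪ {ω | δ < X T ω} := by
    ext ω
    simp only [mem_preimage, mem_Ioi, lt_runSup_iff, mem_union, mem_ofPred_eq, hitAbove_lt_iff,
      lt_irrefl, or_false]
    constructor
    · rintro ⟨s, hs, h⟩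
      rcases hs.lt_or_eq with hs | rfl
      · exact Or.inl ⟨s, hs, h⟩
      · exact Or.inr h
    · rintro (⟨s, hs, h⟩ | h)
      · exact ⟨s, hs.le, h⟩
      · exact ⟨T, le_rfl, h⟩
  rw [this]
  exact ((isFiniteStoppingTime_hitAbove hX hr δ T).measurable measurableSet_Iio).union
    ((((hX T).mono (𝓕.le T)).measurable) measurableSet_Ioi)

lemma AssumptionSup.ae_runSup_eq_zero [IsProbabilityMeasure P] [𝓕.IsRightContinuous]
    (ho : OsgoodCondition η) (hc : 0 < c) {X A H : ℝ≥0 → Ω → ℝ≥0} {M : ℝ≥0 → Ω → ℝ}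
    (h : AssumptionSup 𝓕 P η X A H M) {T : ℝ≥0} (hH : ∀ᵐ ω ∂P, H T ω = 0) :
    ∀ᵐ ω ∂P, runSup X T ω = 0 := by
  have hH' : ∫⁻ ω, (H T ω : ℝ≥0∞) ∂P = 0 := by
    rw [lintegral_congr_ae (hH.mono fun ω hω => by rw [hω]), ENNReal.coe_zero, lintegral_zero]
  filter_upwards [h.ae_not_exceed ho hc (.const T) (fun _ => le_rfl) hH'] with ω hω
  simp only [runSup, ENNReal.iSup_eq_zero, ENNReal.coe_eq_zero]
  exact hω

end MaximalProcess

/-! ### From weak-type tails to moments -/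

section LayerCake

lemma setLIntegral_Ioc_rpow {p : ℝ} (hp : 0 < p) {y : ℝ} (hy : 0 ≤ y) :
    ∫⁻ x in Ioc 0 y, ENNReal.ofReal (p * x ^ (p - 1)) = ENNReal.ofReal (y ^ p) := by
  have hi : IntervalIntegrable (fun x : ℝ => x ^ (p - 1)) volume 0 y :=
    intervalIntegral.intervalIntegrable_rpow' (by linarith)
  rw [← ofReal_integral_eq_lintegral_ofReal
    (((intervalIntegrable_iff_integrableOn_Ioc_of_le hy).1 hi).const_mul p)
    ((ae_restrict_iff' measurableSet_Ioc).2 (ae_of_all _ fun x hx =>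
      mul_nonneg hp.le (Real.rpow_nonneg hx.1.le _))), ← intervalIntegral.integral_of_le hy,
    intervalIntegral.integral_const_mul, integral_rpow (Or.inl (by linarith))]
  congr 1
  rw [sub_add_cancel, Real.zero_rpow hp.ne', sub_zero, mul_div_cancel₀ _ hp.ne']

lemma setLIntegral_Ioi_rpow {q : ℝ} (hq : q < -1) {y : ℝ} (hy : 0 < y) :
    ∫⁻ x in Ioi y, ENNReal.ofReal (x ^ q) = ENNReal.ofReal (-y ^ (q + 1) / (q + 1)) := by
  rw [← ofReal_integral_eq_lintegral_ofReal (integrableOn_Ioi_rpow_of_lt hq hy)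
    ((ae_restrict_iff' measurableSet_Ioi).2 (ae_of_all _ fun x hx =>
      Real.rpow_nonneg (hy.le.trans (le_of_lt hx)) _)), integral_Ioi_rpow_of_lt hq hy]

/-- The layer-cake formula, of which one direction suffices. An infinite value is treated by testing
with all finite `r ≤ y`. -/
lemma rpow_le_lintegral_indicator {p : ℝ} (hp : 0 < p) (y : ℝ≥0∞) :
    y ^ p ≤ ∫⁻ x in Ioi (0 : ℝ), ENNReal.ofReal (p * x ^ (p - 1)) *
      {x : ℝ | ENNReal.ofReal x < y}.indicator 1 x := by
  have key : ∀ r : ℝ≥0, (r : ℝ≥0∞) ≤ y → (r : ℝ≥0∞) ^ p ≤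
      ∫⁻ x in Ioi (0 : ℝ), ENNReal.ofReal (p * x ^ (p - 1)) *
        {x : ℝ | ENNReal.ofReal x < y}.indicator 1 x := by
    intro r hr
    have hr0 : (0 : ℝ) ≤ r := r.2
    calc (r : ℝ≥0∞) ^ p = ∫⁻ x in Ioc 0 (r : ℝ), ENNReal.ofReal (p * x ^ (p - 1)) := by
          rw [setLIntegral_Ioc_rpow hp hr0, ← ENNReal.ofReal_rpow_of_nonneg hr0 hp.le,
            ENNReal.ofReal_coe_nnreal]
      _ = ∫⁻ x in Ioo 0 (r : ℝ), ENNReal.ofReal (p * x ^ (p - 1)) :=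
          setLIntegral_congr Ioo_ae_eq_Ioc.symm
      _ = ∫⁻ x in Ioo 0 (r : ℝ), ENNReal.ofReal (p * x ^ (p - 1)) *
            {x : ℝ | ENNReal.ofReal x < y}.indicator 1 x := by
          refine setLIntegral_congr_fun measurableSet_Ioo fun x hx => ?_
          have : ENNReal.ofReal x < y := by
            refine lt_of_lt_of_le ?_ hr
            rw [← ENNReal.ofReal_coe_nnreal]
            exact (ENNReal.ofReal_lt_ofReal_iff_of_nonneg hx.1.le).2 hx.2
          simp [indicator_of_mem (show x ∈ {x : ℝ | ENNReal.ofReal x < y} from this)]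
      _ ≤ _ := lintegral_mono_set fun x hx => hx.1
  rcases eq_or_ne y ⊤ with rfl | hy
  · rw [ENNReal.top_rpow_of_pos hp, top_le_iff]
    refine ENNReal.eq_top_of_forall_nnreal_le fun r => ?_
    refine le_trans (le_of_eq ?_) (key (r ^ p⁻¹) le_top)
    rw [← ENNReal.coe_rpow_of_nonneg _ hp.le, ← NNReal.rpow_mul, inv_mul_cancel₀ hp.ne',
      NNReal.rpow_one]
  · lift y to ℝ≥0 using hy
    exact key y le_rfl

/-- Split at `r = b / p`, where `p * x` crosses `b`. The two pieces contribute `(1 + p) r^p` and `p²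
/ (1 - p) r^p`, which sum to `r^p / (1 - p)`. The factor `p` in the truncation is optimal: with `l *
x` in its place the total would be `l^(-p) (1 + l / (1 - p)) b^p`, which is smallest at `l = p`. -/
lemma lintegral_min_weight {p : ℝ} (hp : 0 < p) (hp1 : p < 1) (b : ℝ≥0) :
    ∫⁻ x in Ioi (0 : ℝ), ENNReal.ofReal (p * x ^ (p - 1)) *
      ({x : ℝ | p * x ≤ b}.indicator 1 x + ENNReal.ofReal (min (b : ℝ) (p * x) / x)) ≤
      ENNReal.ofReal (p ^ (-p) / (1 - p)) * (b : ℝ≥0∞) ^ p := by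
  have hb0 : (0 : ℝ) ≤ b := b.2
  set r : ℝ := b / p with hr
  have hr0 : 0 ≤ r := by positivity
  have hbr : (b : ℝ) = p * r := by rw [hr]; field_simp
  have hsplit : Ioi (0 : ℝ) = Ioc 0 r ∪ Ioi r := (Ioc_union_Ioi_eq_Ioi hr0).symm
  have h1 : ∫⁻ x in Ioc 0 r, ENNReal.ofReal (p * x ^ (p - 1)) *
      ({x : ℝ | p * x ≤ b}.indicator 1 x + ENNReal.ofReal (min (b : ℝ) (p * x) / x)) =
      ENNReal.ofReal (r ^ p) * ENNReal.ofReal (1 + p) := by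
    rw [← setLIntegral_Ioc_rpow hp hr0, ← lintegral_mul_const' _ _ ENNReal.ofReal_ne_top]
    refine setLIntegral_congr_fun measurableSet_Ioc fun x hx => ?_
    have hx' : p * x ≤ b := by rw [hbr]; exact mul_le_mul_of_nonneg_left hx.2 hp.le
    rw [indicator_of_mem (show x ∈ {x : ℝ | p * x ≤ b} from hx'), min_eq_right hx',
      mul_div_cancel_right₀ _ hx.1.ne', ENNReal.ofReal_add zero_le_one hp.le, ENNReal.ofReal_one]
    rfl
  have h2 : ∫⁻ x in Ioi r, ENNReal.ofReal (p * x ^ (p - 1)) *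
      ({x : ℝ | p * x ≤ b}.indicator 1 x + ENNReal.ofReal (min (b : ℝ) (p * x) / x)) =
      ENNReal.ofReal (p ^ 2 / (1 - p) * r ^ p) := by
    have h3 : ∫⁻ x in Ioi r, ENNReal.ofReal (p * x ^ (p - 1)) *
        ({x : ℝ | p * x ≤ b}.indicator 1 x + ENNReal.ofReal (min (b : ℝ) (p * x) / x)) =
        ENNReal.ofReal (p * b) * ∫⁻ x in Ioi r, ENNReal.ofReal (x ^ (p - 2)) := by
      rw [← lintegral_const_mul' _ _ ENNReal.ofReal_ne_top]
      refine setLIntegral_congr_fun measurableSet_Ioi fun x hx => ?_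
      have hx0 : 0 < x := hr0.trans_lt hx
      have hx' : b < p * x := by rw [hbr]; exact mul_lt_mul_of_pos_left hx hp
      rw [indicator_of_notMem (show x ∉ {x : ℝ | p * x ≤ b} from not_le.2 hx'),
        min_eq_left hx'.le, zero_add, ← ENNReal.ofReal_mul (by positivity),
        ← ENNReal.ofReal_mul (by positivity)]
      congr 1
      rw [show p - 2 = p - 1 - 1 by ring, Real.rpow_sub_one hx0.ne' (p - 1)]
      ring
    rw [h3]
    rcases hr0.eq_or_lt with h0 | hr'
    · rw [hbr, ← h0, Real.zero_rpow hp.ne']; simp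
    · rw [setLIntegral_Ioi_rpow (by linarith) hr', ← ENNReal.ofReal_mul (by positivity)]
      congr 1
      rw [show p - 2 + 1 = p - 1 by ring, Real.rpow_sub_one hr'.ne', hbr]
      have : p - 1 ≠ 0 := by linarith
      have : 1 - p ≠ 0 := by linarith
      field_simp
      ring
  have hrp : 0 ≤ r ^ p := Real.rpow_nonneg hr0 _
  have h1p : 0 < 1 - p := by linarith
  rw [hsplit]
  refine (lintegral_union_le _ _ _).trans (le_of_eq ?_)
  rw [h1, h2, ← ENNReal.ofReal_coe_nnreal, ENNReal.ofReal_rpow_of_nonneg hb0 hp.le,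
    ← ENNReal.ofReal_mul hrp, ← ENNReal.ofReal_add (by positivity) (by positivity),
    ← ENNReal.ofReal_mul (by positivity)]
  congr 1
  rw [hr, Real.div_rpow hb0 hp.le, Real.rpow_neg hp.le]
  have := (Real.rpow_pos_of_pos hp p).ne'
  field_simp
  ring

/-- Lenglart's argument: a tail estimate of weak type gives a bound on the `p`-th moment. -/
lemma lintegral_rpow_le_of_tail {Ω : Type*} {m : MeasurableSpace Ω} {P : Measure Ω} [SFinite P]
    {Y : Ω → ℝ≥0∞} {B : Ω → ℝ≥0} (hY : Measurable Y) (hB : Measurable B) {p : ℝ} (hp : 0 < p)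
    (hp1 : p < 1)
    (h : ∀ x : ℝ, 0 < x → ENNReal.ofReal x * P {ω | ENNReal.ofReal x < Y ω} ≤
      ENNReal.ofReal x * P {ω | p * x ≤ B ω} + ∫⁻ ω, ENNReal.ofReal (min (B ω : ℝ) (p * x)) ∂P) :
    ∫⁻ ω, Y ω ^ p ∂P ≤ ENNReal.ofReal (p ^ (-p) / (1 - p)) * ∫⁻ ω, (B ω : ℝ≥0∞) ^ p ∂P := by
  have hw : Measurable fun x : ℝ => ENNReal.ofReal (p * x ^ (p - 1)) := by fun_prop
  have hS1 : MeasurableSet {z : Ω × ℝ | ENNReal.ofReal z.2 < Y z.1} :=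
    measurableSet_lt (by fun_prop) (by fun_prop)
  have hS2 : MeasurableSet {z : Ω × ℝ | p * z.2 ≤ B z.1} :=
    measurableSet_le (by fun_prop) (by fun_prop)
  have hm1 : Measurable fun z : Ω × ℝ => ENNReal.ofReal (p * z.2 ^ (p - 1)) *
      {x : ℝ | ENNReal.ofReal x < Y z.1}.indicator (1 : ℝ → ℝ≥0∞) z.2 :=
    (hw.comp measurable_snd).mul (measurable_one.indicator hS1)
  have hm2' : Measurable fun z : Ω × ℝ =>
      {x : ℝ | p * x ≤ B z.1}.indicator (1 : ℝ → ℝ≥0∞) z.2 :=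
    measurable_one.indicator hS2
  have hm2 : Measurable fun z : Ω × ℝ => ENNReal.ofReal (p * z.2 ^ (p - 1)) *
      ({x : ℝ | p * x ≤ B z.1}.indicator (1 : ℝ → ℝ≥0∞) z.2 +
        ENNReal.ofReal (min (B z.1 : ℝ) (p * z.2) / z.2)) :=
    (hw.comp measurable_snd).mul (hm2'.add (by fun_prop))
  calc ∫⁻ ω, Y ω ^ p ∂P
      ≤ ∫⁻ ω, (∫⁻ x in Ioi (0 : ℝ), ENNReal.ofReal (p * x ^ (p - 1)) *
          {x : ℝ | ENNReal.ofReal x < Y ω}.indicator 1 x) ∂P :=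
        lintegral_mono fun ω => rpow_le_lintegral_indicator hp (Y ω)
    _ = ∫⁻ x in Ioi (0 : ℝ), ∫⁻ ω, ENNReal.ofReal (p * x ^ (p - 1)) *
          {x : ℝ | ENNReal.ofReal x < Y ω}.indicator 1 x ∂P :=
        lintegral_lintegral_swap hm1.aemeasurable
    _ ≤ ∫⁻ x in Ioi (0 : ℝ), ∫⁻ ω, ENNReal.ofReal (p * x ^ (p - 1)) *
          ({x : ℝ | p * x ≤ B ω}.indicator 1 x + ENNReal.ofReal (min (B ω : ℝ) (p * x) / x)) ∂P := by
        refine setLIntegral_mono' measurableSet_Ioi fun x hx => ?_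
        have hx0 : 0 < x := hx
        rw [lintegral_const_mul' _ _ ENNReal.ofReal_ne_top,
          lintegral_const_mul' _ _ ENNReal.ofReal_ne_top]
        refine mul_le_mul_right ?_ _
        have e1 : ∫⁻ ω, {x : ℝ | ENNReal.ofReal x < Y ω}.indicator (1 : ℝ → ℝ≥0∞) x ∂P =
            P {ω | ENNReal.ofReal x < Y ω} :=
          lintegral_indicator_one (s := {ω | ENNReal.ofReal x < Y ω})
            (measurableSet_lt measurable_const hY)
        have e2 : ∫⁻ ω, {x : ℝ | p * x ≤ B ω}.indicator (1 : ℝ → ℝ≥0∞) x ∂P =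
            P {ω | p * x ≤ B ω} :=
          lintegral_indicator_one (s := {ω | p * x ≤ B ω})
            (measurableSet_le measurable_const (by fun_prop))
        rw [e1, lintegral_add_right _ (by fun_prop), e2]
        have hx1 : ENNReal.ofReal x ≠ 0 := (ENNReal.ofReal_pos.2 hx0).ne'
        rw [← ENNReal.mul_le_mul_iff_right hx1 ENNReal.ofReal_ne_top, mul_add,
          ← lintegral_const_mul' _ _ ENNReal.ofReal_ne_top]
        refine (h x hx0).trans (le_of_eq ?_)
        congr 1
        refine lintegral_congr fun ω => ?_
        rw [← ENNReal.ofReal_mul hx0.le, mul_div_cancel₀ _ hx0.ne']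
    _ = ∫⁻ ω, (∫⁻ x in Ioi (0 : ℝ), ENNReal.ofReal (p * x ^ (p - 1)) *
          ({x : ℝ | p * x ≤ B ω}.indicator 1 x + ENNReal.ofReal (min (B ω : ℝ) (p * x) / x))) ∂P :=
        (lintegral_lintegral_swap hm2.aemeasurable).symm
    _ ≤ ∫⁻ ω, ENNReal.ofReal (p ^ (-p) / (1 - p)) * (B ω : ℝ≥0∞) ^ p ∂P :=
        lintegral_mono fun ω => lintegral_min_weight hp hp1 (B ω)
    _ = _ := lintegral_const_mul' _ _ ENNReal.ofReal_ne_top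

end LayerCake

/-! ### Assertion (4): Lenglart domination for `G(X*)` -/

section MomentBound

variable {Ω : Type*} {m : MeasurableSpace Ω} {P : Measure Ω} {𝓕 : Filtration ℝ≥0 m}
  {η : ℝ≥0 → ℝ≥0} {c : ℝ≥0}

lemma exists_bihariReal_eq (hη : Monotone η) (hpos : ∀ x, 0 < x → 0 < η x) (hc : 0 < c)
    {x : ℝ} (hx : 0 ≤ x) (hlt : (x : EReal) < bihariG η c ⊤) :
    ∃ y : ℝ≥0, c ≤ y ∧ bihariReal η c y = x := by
  obtain ⟨n, hn, hcn⟩ := (((tendsto_bihariReal_atTop hη hpos hc).eventually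
    (lt_mem_nhds hlt)).and (eventually_ge_atTop ⌈(c : ℝ)⌉₊)).exists
  have hcn' : (c : ℝ) ≤ n := Nat.ceil_le.1 hcn
  have hc' : (0 : ℝ) < c := by exact_mod_cast hc
  have hcont : ContinuousOn (bihariReal η c) (Icc c n) := fun y hy =>
    (bihariReal_continuousAt hη hpos hc (hc'.trans_le hy.1)).continuousWithinAt
  obtain ⟨y, hy, hyx⟩ := intermediate_value_Icc hcn' hcont
    ⟨by rwa [bihariReal_self], (EReal.coe_lt_coe_iff.1 hn).le⟩
  exact ⟨⟨y, hc'.le.trans hy.1⟩, hy.1, hyx⟩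

/-- At time `0` the integral and `M` vanish, so `c ≤ X 0 ≤ H 0 ≤ H T`. Hence `G(E[H T])` is
non-negative. -/
lemma AssumptionSup.le_lintegral_H [IsProbabilityMeasure P] {X A H : ℝ≥0 → Ω → ℝ≥0}
    {M : ℝ≥0 → Ω → ℝ} (h : AssumptionSup 𝓕 P η X A H M) {T : ℝ≥0}
    (hX : ∀ᵐ ω ∂P, ∀ t ≤ T, c ≤ X t ω) : (c : ℝ≥0∞) ≤ ∫⁻ ω, (H T ω : ℝ≥0∞) ∂P := by
  calc (c : ℝ≥0∞) = ∫⁻ _, (c : ℝ≥0∞) ∂P := by simp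
    _ ≤ _ := by
      refine lintegral_mono_ae ?_
      filter_upwards [hX, h.inequality 0] with ω h1 h2
      have h3 : X 0 ω ≤ H 0 ω := by
        simpa [h.M_local_martingale.zero] using h2
      exact ENNReal.coe_le_coe.2 (((h1 0 zero_le).trans h3).trans (h.H_mono ω zero_le))

/-- A Lenglart-type tail estimate for `G(X*_T)`. -/
lemma AssumptionSup.measure_bihariG_runSup_le [IsProbabilityMeasure P] [𝓕.IsRightContinuous]
    {X A H : ℝ≥0 → Ω → ℝ≥0} {M : ℝ≥0 → Ω → ℝ}
    (h : AssumptionSup 𝓕 P η X A H M) (hc : 0 < c) {T : ℝ≥0}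
    (hX : ∀ᵐ ω ∂P, ∀ t ≤ T, c ≤ X t ω) {g : ℝ≥0}
    (hg : bihariG η c (∫⁻ ω, (H T ω : ℝ≥0∞) ∂P) = ((g : ℝ) : EReal)) {v x : ℝ} (hx : 0 < x) :
    ENNReal.ofReal x * P {ω | ENNReal.ofReal x < (bihariG η c (runSup X T ω)).toENNReal} ≤
      ENNReal.ofReal x * P {ω | v ≤ (A T ω + g : ℝ≥0)} +
        ∫⁻ ω, ENNReal.ofReal (min ((A T ω + g : ℝ≥0) : ℝ) v) ∂P := by
  have hη := h.eta_mono
  have hpos := h.eta_pos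
  -- Both degenerate cases are trivial: if `v ≤ g` the first event on the right is certain, and if
  -- `x` is at least `G(∞)` the event on the left is empty. Otherwise `x` is a value of `G` and `v -
  -- g` is a genuine level for `A`.
  rcases le_or_gt v g with hvg | hvg
  · have : {ω | v ≤ (A T ω + g : ℝ≥0)} = univ :=
      eq_univ_of_forall fun ω => hvg.trans (by exact_mod_cast le_add_self)
    rw [this, measure_univ]
    exact (mul_le_mul_right prob_le_one _).trans le_self_add
  rcases le_or_gt (bihariG η c ⊤) x with htop | htop
  · have : {ω | ENNReal.ofReal x < (bihariG η c (runSup X T ω)).toENNReal} = ∅ := by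
      refine eq_empty_of_forall_notMem fun ω hω => ?_
      rw [mem_ofPred_eq] at hω
      refine not_lt.2 ?_ hω
      exact EReal.toENNReal_le_toENNReal ((bihariG_mono le_top).trans htop)
    rw [this, measure_empty, mul_zero]
    exact zero_le
  obtain ⟨y, hcy, hy⟩ := exists_bihariReal_eq hη hpos hc hx.le htop
  have hGy : bihariG η c y = (x : EReal) := by
    rw [bihariG_eq_bihariReal hη hpos hc (hc.trans_le hcy), hy]
  have hsub : {ω | ENNReal.ofReal x < (bihariG η c (runSup X T ω)).toENNReal} ⊆
      {ω | ∃ s ≤ T, y < X s ω} := by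
    intro ω hω
    rw [mem_ofPred_eq] at hω
    refine lt_runSup_iff.1 (not_le.1 fun hle => not_lt.2 ?_ hω)
    exact EReal.toENNReal_le_toENNReal ((bihariG_mono hle).trans hGy.le)
  refine (mul_le_mul_right (measure_mono hsub) _).trans ?_
  set u : ℝ≥0 := ⟨v - g, sub_nonneg.2 hvg.le⟩ with hu
  have hu0 : 0 < u := sub_pos.2 hvg
  have huv : (u : ℝ) + g = v := sub_add_cancel v (g : ℝ)
  refine ENNReal.le_of_forall_pos_le_add fun e he _ => ?_
  obtain ⟨ρ, hρs, hρT, hAρ, hPρ⟩ := exists_stopping_lt_level (P := P) h.A_predictable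
    h.A_mono (fun ω => (h.A_cadlag ω).1) h.A_zero hu0 T
    (e := e / ENNReal.ofReal x)
    (ENNReal.div_pos (ENNReal.coe_pos.2 he).ne' ENNReal.ofReal_ne_top).ne'
  -- Up to `κ` one has `A < v - g`, so `A + g` is at most the minimum of `A T + g` and `v`. At `κ`,
  -- if passage occurred and `ρ` did not cut early, `G(X)` is at least `x`.
  set κ : Ω → ℝ≥0 := fun ω => min (hitAbove X y T ω) (ρ ω) with hκ
  have hκs : IsFiniteStoppingTime 𝓕 κ :=
    (isFiniteStoppingTime_hitAbove h.X_adapted h.X_right_cont _ _).min hρs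
  have hκT : ∀ ω, κ ω ≤ T := fun ω => (min_le_right _ _).trans (hρT ω)
  have hmain := h.extExpect_bihariG_le hc hκs hκT
  have hAκm : Measurable fun ω => A (κ ω) ω :=
    measurable_eval_of_rightCont h.measurable_A (fun ω => (h.A_cadlag ω).1) hκs.measurable
  have hXκm : Measurable fun ω => X (κ ω) ω :=
    measurable_eval_of_rightCont h.measurable_X h.X_right_cont hκs.measurable
  rw [extExpect_of_nonneg (hX.mono fun ω hω =>
    bihariG_nonneg (ENNReal.coe_le_coe.2 (hω _ (hκT ω))))] at hmain
  have hmain' : ∫⁻ ω, (bihariG η c (X (κ ω) ω)).toENNReal ∂P ≤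
      ∫⁻ ω, (A (κ ω) ω : ℝ≥0∞) ∂P + g := by
    rw [← EReal.coe_ennreal_le_coe_ennreal_iff, EReal.coe_ennreal_add]
    refine hmain.trans (add_le_add_right ?_ _)
    refine (bihariG_mono (lintegral_mono fun ω => ENNReal.coe_le_coe.2
      (h.H_mono ω (hκT ω)))).trans (hg.trans_le ?_)
    rfl
  have hAg : ∫⁻ ω, (A (κ ω) ω : ℝ≥0∞) ∂P + g ≤
      ∫⁻ ω, ENNReal.ofReal (min ((A T ω + g : ℝ≥0) : ℝ) v) ∂P := by
    calc ∫⁻ ω, (A (κ ω) ω : ℝ≥0∞) ∂P + g = ∫⁻ ω, ((A (κ ω) ω : ℝ≥0∞) + g) ∂P := by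
          rw [lintegral_add_right _ measurable_const]; simp
      _ ≤ _ := by
        refine lintegral_mono_ae ?_
        filter_upwards [hAρ] with ω hω
        rw [← ENNReal.coe_add, ← ENNReal.ofReal_coe_nnreal]
        refine ENNReal.ofReal_le_ofReal (le_min ?_ ?_)
        · exact NNReal.coe_le_coe.2 (by gcongr; exact h.A_mono ω (hκT ω))
        · rw [← huv]
          have : A (κ ω) ω ≤ u := (h.A_mono ω (min_le_right _ _)).trans hω.le
          exact_mod_cast (by gcongr : A (κ ω) ω + g ≤ u + g)
  have hcheb : ENNReal.ofReal x * P {ω | (∃ s ≤ T, y < X s ω) ∧ T ≤ ρ ω} ≤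
      ∫⁻ ω, (bihariG η c (X (κ ω) ω)).toENNReal ∂P := by
    refine le_trans (mul_le_mul_right (measure_mono ?_) _) (mul_meas_ge_le_lintegral₀ ?_ _)
    · rintro ω ⟨⟨s, hs, hsX⟩, hTρ⟩
      have h2 : κ ω = hitAbove X y T ω := min_eq_left ((hitAbove_le _ _ _ _).trans hTρ)
      have h3 : y ≤ X (κ ω) ω := h2 ▸ le_apply_hitAbove h.X_right_cont ⟨s, hs, hsX⟩
      refine EReal.toENNReal_le_toENNReal (x := (x : EReal)) ?_
      exact hGy.ge.trans (bihariG_mono (ENNReal.coe_le_coe.2 h3))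
    · exact (measurable_ereal_toENNReal.comp
        (bihariG_mono.measurable.comp hXκm.coe_nnreal_ennreal)).aemeasurable
  calc ENNReal.ofReal x * P {ω | ∃ s ≤ T, y < X s ω}
      ≤ ENNReal.ofReal x * P ({ω | (∃ s ≤ T, y < X s ω) ∧ T ≤ ρ ω} ∪
          {ω | v ≤ (A T ω + g : ℝ≥0)} ∪ {ω | A T ω < u ∧ ρ ω < T}) := by
        refine mul_le_mul_right (measure_mono fun ω hω => ?_) _
        by_cases h1 : v ≤ (A T ω + g : ℝ≥0)
        · exact Or.inl (Or.inr h1)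
        · by_cases h2 : ρ ω < T
          · refine Or.inr ⟨?_, h2⟩
            rw [not_le, ← huv] at h1
            exact lt_of_add_lt_add_right (a := g) (by exact_mod_cast h1)
          · exact Or.inl (Or.inl ⟨hω, not_lt.1 h2⟩)
    _ ≤ ENNReal.ofReal x * (P {ω | (∃ s ≤ T, y < X s ω) ∧ T ≤ ρ ω} +
          P {ω | v ≤ (A T ω + g : ℝ≥0)} + e / ENNReal.ofReal x) :=
        mul_le_mul_right ((measure_union_le _ _).trans
          (add_le_add (measure_union_le _ _) hPρ)) _
    _ = ENNReal.ofReal x * P {ω | v ≤ (A T ω + g : ℝ≥0)} +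
          ENNReal.ofReal x * P {ω | (∃ s ≤ T, y < X s ω) ∧ T ≤ ρ ω} + e := by
        rw [mul_add, mul_add, ENNReal.mul_div_cancel (ENNReal.ofReal_pos.2 hx).ne'
          ENNReal.ofReal_ne_top, add_comm (_ * _) (_ * _)]
    _ ≤ _ := by
        gcongr
        exact hcheb.trans (hmain'.trans hAg)

lemma AssumptionSup.lintegral_bihariG_runSup_rpow_le [IsProbabilityMeasure P]
    [𝓕.IsRightContinuous] {X A H : ℝ≥0 → Ω → ℝ≥0} {M : ℝ≥0 → Ω → ℝ}
    (h : AssumptionSup 𝓕 P η X A H M) (hc : 0 < c) {T : ℝ≥0}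
    (hX : ∀ᵐ ω ∂P, ∀ t ≤ T, c ≤ X t ω) {g : ℝ≥0}
    (hg : bihariG η c (∫⁻ ω, (H T ω : ℝ≥0∞) ∂P) = ((g : ℝ) : EReal)) {p : ℝ} (hp : 0 < p)
    (hp1 : p < 1) :
    ∫⁻ ω, (bihariG η c (runSup X T ω)).toENNReal ^ p ∂P ≤
      ENNReal.ofReal (p ^ (-p) / (1 - p)) * ∫⁻ ω, ((A T ω + g : ℝ≥0) : ℝ≥0∞) ^ p ∂P :=
  lintegral_rpow_le_of_tail (measurable_ereal_toENNReal.comp (bihariG_mono.measurable.comp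
      (measurable_runSup h.X_adapted h.X_right_cont T)))
    ((h.measurable_A T).add_const g) hp hp1
    fun _ hx => h.measure_bihariG_runSup_le hc hX hg hx

lemma EReal.abs_eq_toENNReal {x : EReal} (hx : 0 ≤ x) : x.abs = x.toENNReal := by
  induction x with
  | bot => simp at hx
  | top => rfl
  | coe r => rw [EReal.abs_def, EReal.real_coe_toENNReal, abs_of_nonneg (by exact_mod_cast hx)]

lemma le_runSup {X : ℝ≥0 → Ω → ℝ≥0} {T : ℝ≥0}
    (hX : ∀ᵐ ω ∂P, ∀ t ≤ T, c ≤ X t ω) : ∀ᵐ ω ∂P, (c : ℝ≥0∞) ≤ runSup X T ω :=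
  hX.mono fun ω hω => (ENNReal.coe_le_coe.2 (hω T le_rfl)).trans
    (le_iSup₂ (f := fun s (_ : s ≤ T) => (X s ω : ℝ≥0∞)) T le_rfl)

/-- The moment bound for `G(X*_T)`. -/
lemma AssumptionSup.pNorm_bihariG_runSup_le [IsProbabilityMeasure P] [𝓕.IsRightContinuous]
    {X A H : ℝ≥0 → Ω → ℝ≥0} {M : ℝ≥0 → Ω → ℝ}
    (h : AssumptionSup 𝓕 P η X A H M) (hc : 0 < c) {T : ℝ≥0}
    (hX : ∀ᵐ ω ∂P, ∀ t ≤ T, c ≤ X t ω) {p : ℝ} (hp : 0 < p) (hp1 : p < 1) :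
    pNorm P p (fun ω => bihariG η c (runSup X T ω)) ≤
      ENNReal.ofReal (alphaOne p * alphaTwo p) * pNorm P p (fun ω => ((A T ω : ℝ) : EReal) +
        bihariG η c (∫⁻ ω', (H T ω' : ℝ≥0∞) ∂P)) := by
  have h1p : 0 < 1 - p := by linarith
  have hα : 0 < alphaOne p * alphaTwo p :=
    mul_pos (Real.rpow_pos_of_pos h1p _) (inv_pos.2 hp)
  have hg0 : 0 ≤ bihariG η c (∫⁻ ω', (H T ω' : ℝ≥0∞) ∂P) := bihariG_nonneg (h.le_lintegral_H hX)
  rcases eq_or_ne (bihariG η c (∫⁻ ω', (H T ω' : ℝ≥0∞) ∂P)) ⊤ with hg | hg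
  · have : pNorm P p (fun ω => ((A T ω : ℝ) : EReal) +
        bihariG η c (∫⁻ ω', (H T ω' : ℝ≥0∞) ∂P)) = ⊤ := by
      simp [pNorm, hg, hp, ENNReal.top_rpow_of_pos]
    rw [this, ENNReal.mul_top (ENNReal.ofReal_pos.2 hα).ne']
    exact le_top
  obtain ⟨g, hg'⟩ : ∃ g : ℝ≥0,
      bihariG η c (∫⁻ ω', (H T ω' : ℝ≥0∞) ∂P) = ((g : ℝ) : EReal) := by
    lift bihariG η c (∫⁻ ω', (H T ω' : ℝ≥0∞) ∂P) to ℝ using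
      ⟨hg, ne_bot_of_le_ne_bot (by simp) hg0⟩ with r
    exact ⟨⟨r, by exact_mod_cast hg0⟩, rfl⟩
  have h1 : ∫⁻ ω, (bihariG η c (runSup X T ω)).abs ^ p ∂P =
      ∫⁻ ω, (bihariG η c (runSup X T ω)).toENNReal ^ p ∂P :=
    lintegral_congr_ae ((le_runSup hX).mono fun ω hω => by
      simp only [EReal.abs_eq_toENNReal (bihariG_nonneg hω)])
  have h2 : ∀ ω, (((A T ω : ℝ) : EReal) + ((g : ℝ) : EReal)).abs =
      ((A T ω + g : ℝ≥0) : ℝ≥0∞) := fun ω => by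
    rw [← EReal.coe_add, EReal.abs_def, ← NNReal.coe_add, abs_of_nonneg (NNReal.coe_nonneg _),
      ENNReal.ofReal_coe_nnreal]
  rw [hg']
  simp only [pNorm, h1, h2]
  -- The `1 / p`-th power of `p^(-p) / (1 - p)` is exactly `alphaOne p * alphaTwo p`.
  refine (ENNReal.rpow_le_rpow (h.lintegral_bihariG_runSup_rpow_le hc hX hg' hp hp1)
    (by positivity)).trans (le_of_eq ?_)
  rw [ENNReal.mul_rpow_of_nonneg _ _ (by positivity),
    ENNReal.ofReal_rpow_of_nonneg (div_nonneg (Real.rpow_nonneg hp.le _) h1p.le) (by positivity)]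
  congr 2
  rw [Real.div_rpow (Real.rpow_nonneg hp.le _) h1p.le, ← Real.rpow_mul hp.le, alphaOne, alphaTwo,
    show -1 / p = -(1 / p) by ring, Real.rpow_neg h1p.le,
    show -p * (1 / p) = -1 by field_simp, Real.rpow_neg_one]
  ring

/-- The moment of `G(X*_T)` is finite, by subadditivity of `x ↦ x^p`, so `G(X*_T)` is finite almost
surely; as `G(∞) = ∞`, the supremum is then finite. -/
lemma AssumptionSup.ae_runSup_lt_top [IsProbabilityMeasure P] [𝓕.IsRightContinuous]
    {X A H : ℝ≥0 → Ω → ℝ≥0} {M : ℝ≥0 → Ω → ℝ}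
    (h : AssumptionSup 𝓕 P η X A H M) (hc : 0 < c) {T : ℝ≥0}
    (hX : ∀ᵐ ω ∂P, ∀ t ≤ T, c ≤ X t ω) {p : ℝ} (hp : 0 < p) (hp1 : p < 1)
    (hη : ∫⁻ u in Ioi (1 : ℝ), (η u.toNNReal : ℝ≥0∞)⁻¹ = ⊤)
    (hA : ∫⁻ ω, (A T ω : ℝ≥0∞) ^ p ∂P < ⊤) (hH : ∫⁻ ω, (H T ω : ℝ≥0∞) ∂P < ⊤) :
    ∀ᵐ ω ∂P, runSup X T ω < ⊤ := by
  have hcb := h.le_lintegral_H hX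
  obtain ⟨g, hg⟩ : ∃ g : ℝ≥0,
      bihariG η c (∫⁻ ω', (H T ω' : ℝ≥0∞) ∂P) = ((g : ℝ) : EReal) := by
    have hg0 := bihariG_nonneg (η := η) hcb
    lift (∫⁻ ω', (H T ω' : ℝ≥0∞) ∂P) to ℝ≥0 using hH.ne with b
    rw [bihariG_eq_bihariReal h.eta_mono h.eta_pos hc
      (hc.trans_le (ENNReal.coe_le_coe.1 hcb))] at hg0 ⊢
    exact ⟨⟨_, by exact_mod_cast hg0⟩, rfl⟩
  have hfin : ∫⁻ ω, (bihariG η c (runSup X T ω)).toENNReal ^ p ∂P < ⊤ := by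
    refine (h.lintegral_bihariG_runSup_rpow_le hc hX hg hp hp1).trans_lt
      (ENNReal.mul_lt_top ENNReal.ofReal_lt_top ?_)
    calc ∫⁻ ω, ((A T ω + g : ℝ≥0) : ℝ≥0∞) ^ p ∂P
        ≤ ∫⁻ ω, ((A T ω : ℝ≥0∞) ^ p + (g : ℝ≥0∞) ^ p) ∂P := lintegral_mono fun ω => by
          rw [ENNReal.coe_add]
          exact ENNReal.rpow_add_le_add_rpow _ _ hp.le hp1.le
      _ = ∫⁻ ω, (A T ω : ℝ≥0∞) ^ p ∂P + (g : ℝ≥0∞) ^ p := by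
          rw [lintegral_add_right _ measurable_const]; simp
      _ < ⊤ := ENNReal.add_lt_top.2
          ⟨hA, ENNReal.rpow_lt_top_of_nonneg hp.le ENNReal.coe_ne_top⟩
  have hmeas : Measurable fun ω => (bihariG η c (runSup X T ω)).toENNReal ^ p :=
    (measurable_ereal_toENNReal.comp (bihariG_mono.measurable.comp
      (measurable_runSup h.X_adapted h.X_right_cont T))).pow_const p
  filter_upwards [ae_lt_top hmeas hfin.ne] with ω hω
  refine lt_top_iff_ne_top.2 fun htop => ?_
  rw [htop, bihariG_top_eq_top h.eta_mono h.eta_pos hη, EReal.toENNReal_top,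
    ENNReal.top_rpow_of_pos hp] at hω
  exact lt_irrefl _ hω

end MomentBound

/-! ### Assembly of the four assertions -/

theorem theorem3p8 {Ω : Type*} {m : MeasurableSpace Ω} (P : Measure Ω) [IsProbabilityMeasure P]
    (𝓕 : Filtration ℝ≥0 m) (h𝓕 : UsualConditions 𝓕 P)
    (η : ℝ≥0 → ℝ≥0) (hη : Tendsto η atTop atTop) (c : ℝ≥0) (hc : 0 < c) :
    -- (1)
    (∀ (X A H : ℝ≥0 → Ω → ℝ≥0) (M : ℝ≥0 → Ω → ℝ), AssumptionSup 𝓕 P η X A H M →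
      ∀ τ : Ω → WithTop ℝ≥0, IsStoppingTime 𝓕 τ → ∀ T : ℝ≥0,
        extExpect P (fun ω => bihariG η c ((stoppedProcess X τ T ω : ℝ≥0) : ℝ≥0∞)) ≤
          ((∫⁻ ω, ((stoppedProcess A τ T ω : ℝ≥0) : ℝ≥0∞) ∂P : ℝ≥0∞) : EReal)
            + bihariG η c (∫⁻ ω, ((stoppedProcess H τ T ω : ℝ≥0) : ℝ≥0∞) ∂P)) ∧
    -- (2)
    (OsgoodCondition η →
      ∀ (X A H : ℝ≥0 → Ω → ℝ≥0) (M : ℝ≥0 → Ω → ℝ), AssumptionSup 𝓕 P η X A H M →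
      ∀ T : ℝ≥0, (∀ᵐ ω ∂P, H T ω = 0) → ∀ᵐ ω ∂P, runSup X T ω = 0) ∧
    -- (3)
    (OsgoodCondition η →
      ∀ (X : ℕ → ℝ≥0 → Ω → ℝ≥0) (A : ℝ≥0 → Ω → ℝ≥0) (H : ℕ → ℝ≥0 → Ω → ℝ≥0)
        (M : ℕ → ℝ≥0 → Ω → ℝ), (∀ n, AssumptionSup 𝓕 P η (X n) A (H n) (M n)) →
      ∀ T : ℝ≥0, Tendsto (fun n => ∫⁻ ω, (H n T ω : ℝ≥0∞) ∂P) atTop (𝓝 0) →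
      ∀ δ : ℝ≥0, 0 < δ →
        Tendsto (fun n => P {ω | (δ : ℝ≥0∞) < runSup (X n) T ω}) atTop (𝓝 0)) ∧
    -- (4)
    (∀ (X A H : ℝ≥0 → Ω → ℝ≥0) (M : ℝ≥0 → Ω → ℝ), AssumptionSup 𝓕 P η X A H M →
      ∀ T : ℝ≥0, 0 < T → (∀ᵐ ω ∂P, ∀ t ≤ T, c ≤ X t ω) →
      ∀ p : ℝ, 0 < p → p < 1 →
        pNorm P p (fun ω => bihariG η c (runSup X T ω)) ≤
          ENNReal.ofReal (alphaOne p * alphaTwo p)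
            * pNorm P p (fun ω => ((A T ω : ℝ) : EReal)
                + bihariG η c (∫⁻ ω', (H T ω' : ℝ≥0∞) ∂P)) ∧
        (∫⁻ u in Ioi (1 : ℝ), (η u.toNNReal : ℝ≥0∞)⁻¹ = ⊤ →
          ∫⁻ ω, (A T ω : ℝ≥0∞) ^ p ∂P < ⊤ → ∫⁻ ω, (H T ω : ℝ≥0∞) ∂P < ⊤ →
          ∀ᵐ ω ∂P, runSup X T ω < ⊤)) := by
  have : 𝓕.IsRightContinuous := ⟨h𝓕.right_cont.le⟩
  refine ⟨fun X A H M h τ hτ T => ?_, fun ho X A H M h T hH => h.ae_runSup_eq_zero ho hc hH,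
    fun ho X A H M h T hH δ hδ => ?_, fun X A H M h T _ hX p hp hp1 =>
      ⟨h.pNorm_bihariG_runSup_le hc hX hp hp1, h.ae_runSup_lt_top hc hX hp hp1⟩⟩
  · exact h.extExpect_bihariG_le hc (isFiniteStoppingTime_cutoff hτ T) (cutoff_le τ T)
  · simp only [lt_runSup_iff]
    exact tendsto_measure_exceed ho hc h (.const T) (fun _ => le_rfl) hH hδ
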